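/- Let $n$ be a dimension and let $L^2(\mathbb{R}^n)$ be the space of real- or complex-valued square-integrable functions. Let $T\colon L^2(\mathbb{R}^n)\to L^2(\mathbb{R}^n)$ be a sublinear operator, that is, $|T(f+g)|\le |Tf|+|Tg|$ and $|T(\lambda f)|=|\lambda|\,|Tf|$ almost everywhere for all $f,g$ and all scalars $\lambda$ (real $\lambda$ suffice), and suppose that $T$ is bounded on $L^2(\mathbb{R}^n)$: $\|Tf\|_{L^2}\le C\|f\|_{L^2}$. For a ball $B$ and $\lambda>0$, $\lambda B$ denotes the concentric ball with $\lambda$ times the radius; and $Mf(x)=\sup_{B\ni x}\frac1{|B|}\int_B|f|\,dx$ is the Hardy–Littlewood maximal function, the supremum being over balls $B$ containing $x$. For $1<p<\infty$ and $p'=p/(p-1)$, a nonnegative locally integrable function $w$ on $\mathbb{R}^n$ belongs to $A_p$ if there is a constant $C$ such that for every ball $B$ $$\Big(\frac1{|B|}\int_B w\,dx\Big)\Big(\frac1{|B|}\int_B w^{1-p'}\,dx\Big)^{p-1}\le C,$$ and $L^p(w)=L^p(w\,dx)$. Consider the following two conditions, in each of which $C$ is a constant independent of $B$ and $f$. (1)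 For every ball $B$ and every bounded function $f$ supported on $B$ with $\int_B f\,dx=0$, $$\int_{\mathbb{R}^n\setminus 4B}|Tf(x)|\,dx\le C\int_B|f(x)|\,dx.$$ (2) For every ball $B$ and every bounded function $f$ with bounded support contained in $\mathbb{R}^n\setminus 4B$, $$\sup_{x\in B}|Tf(x)|\le C\,\frac1{|2B|}\int_{2B}|Tf(x)|\,dx+C\inf_{x\in B}Mf(x),$$ where the supremum on the left is the essential supremum. Say that $T$ is bounded on $L^p(w)$ if there is a constant $C$ with $\|Tf\|_{L^p(w)}\le C\|f\|_{L^p(w)}$ for all $f\in L^2(\mathbb{R}^n)\cap L^p(w)$ (and on $L^p(\mathbb{R}^n)$ if this holds with $w=1$), and that $T$ is of weak type $(1,1)$ if there is a constant $C$ with $|\{x:|Tf(x)|>t\}|\le \frac Ct\|f\|_{L^1}$ for all $t>0$ and all $f\in L^1(\mathbb{R}^n)\cap L^2(\mathbb{R}^n)$. Then: (i) If $T$ satisfies (1), then $T$ is of weak type $(1,1)$ and bounded on $L^p(\mathbb{R}^n)$ for every $1<p<2$. (ii) If $T$ satisfies (2), then $T$ is bounded on $L^p(\mathbb{R}^n)$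 for every $2<p<\infty$, and on $L^p(w)$ for every $2<p<\infty$ and every $w\in A_{p/2}$. (iii) If $T$ satisfies (1) and (2), then $T$ is bounded on $L^p(w)$ for every $1<p<\infty$ and every $w\in A_p$. -/

import Mathlib

open MeasureTheory Metric
open scoped ENNReal NNReal

noncomputable section

namespace CZO

/-- Euclidean space `ℝⁿ`. -/
abbrev E (n : ℕ) : Type := EuclideanSpace ℝ (Fin n)

/-- The average `⨍_s g = |s|⁻¹ ∫_s g` of a `[0, ∞]`-valued function. -/
def avg {n : ℕ} (s : Set (E n)) (g : E n → ℝ≥0∞) : ℝ≥0∞ :=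
  (volume s)⁻¹ * ∫⁻ x in s, g x

/-- The (uncentered) Hardy–Littlewood maximal function
`Mf(x) = sup_{B ∋ x} ⨍_B |f|`, the supremum being over all balls `B` that contain `x`. -/
def maximalFunction {n : ℕ} {𝕜 : Type*} [RCLike 𝕜] (f : E n → 𝕜) (x : E n) : ℝ≥0∞ :=
  ⨆ (c : E n) (r : ℝ) (_ : x ∈ ball c r), avg (ball c r) fun y => ‖f y‖ₑ

/-- `w ∈ A_p` (for `1 < p < ∞`): `w` is a nonnegative locally integrable function and
`(⨍_B w) (⨍_B w^{1-p'})^{p-1} ≤ C` for all balls `B`. The averages are taken in `[0, ∞]`, where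
a negative power of `0` is `∞`. -/
structure MuckenhouptA {n : ℕ} (p : ℝ) (w : E n → ℝ) : Prop where
  nonneg : ∀ x, 0 ≤ w x
  locallyIntegrable : LocallyIntegrable w volume
  bound : ∃ C : ℝ≥0, ∀ (c : E n) (r : ℝ), 0 < r →
    (avg (ball c r) fun x => ENNReal.ofReal (w x)) *
      (avg (ball c r) fun x => ENNReal.ofReal (w x) ^ (1 - p.conjExponent)) ^ (p - 1) ≤ C

/-- The measure `dw = w dx`. -/
def weightMeasure {n : ℕ} (w : E n → ℝ) : Measure (E n) :=
  volume.withDensity fun x => ENNReal.ofReal (w x)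

section Operators

variable {n : ℕ} {𝕜 : Type*} [RCLike 𝕜]

/-- A map `T` of `L²(ℝⁿ)` to itself is sublinear if, almost everywhere,
`|T(f+g)| ≤ |Tf| + |Tg|` and `|T(a f)| = |a| |Tf|`. Only real scalars `a` are required. -/
structure IsSublinear
    (T : Lp 𝕜 2 (volume : Measure (E n)) → Lp 𝕜 2 (volume : Measure (E n))) : Prop where
  add_le : ∀ f g, ∀ᵐ x, ‖T (f + g) x‖ ≤ ‖T f x‖ + ‖T g x‖
  smul_eq : ∀ (a : ℝ) (f), ∀ᵐ x, ‖T (a • f) x‖ = |a| * ‖T f x‖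

/-- `T` is bounded on `L²(ℝⁿ)`. -/
def BoundedOnL2
    (T : Lp 𝕜 2 (volume : Measure (E n)) → Lp 𝕜 2 (volume : Measure (E n))) : Prop :=
  ∃ C : ℝ, ∀ f, ‖T f‖ ≤ C * ‖f‖

/-- `f` is (essentially) bounded and supported on `s`. -/
def IsBoundedSupportedOn (f : E n → 𝕜) (s : Set (E n)) : Prop :=
  MemLp f ∞ volume ∧ ∀ᵐ x, x ∉ s → f x = 0

/-- `∫_{ℝⁿ ∖ 4B} |Tf| ≤ C ∫_B |f|` for all balls `B` and all bounded `f` supported on `B` with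
mean `0`. -/
def CancellationCondition
    (T : Lp 𝕜 2 (volume : Measure (E n)) → Lp 𝕜 2 (volume : Measure (E n))) : Prop :=
  ∃ C : ℝ≥0, ∀ (c : E n) (r : ℝ), 0 < r → ∀ f : Lp 𝕜 2 (volume : Measure (E n)),
    IsBoundedSupportedOn f (ball c r) → ∫ x, f x = 0 →
      ∫⁻ x in (ball c (4 * r))ᶜ, ‖T f x‖ₑ ≤ C * ∫⁻ x in ball c r, ‖f x‖ₑ

/-- `sup_B |Tf| ≤ C ⨍_{2B} |Tf| + C inf_B Mf` for all balls `B` and all bounded, boundedly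
supported `f` with support in `ℝⁿ ∖ 4B`. As `Tf` is a class of functions modulo null sets, the
supremum on the left is the essential one. -/
def SupCondition
    (T : Lp 𝕜 2 (volume : Measure (E n)) → Lp 𝕜 2 (volume : Measure (E n))) : Prop :=
  ∃ C : ℝ≥0, ∀ (c : E n) (r : ℝ), 0 < r → ∀ f : Lp 𝕜 2 (volume : Measure (E n)),
    IsBoundedSupportedOn f (ball c (4 * r))ᶜ → (∃ R : ℝ, IsBoundedSupportedOn f (ball 0 R)) →
      essSup (fun x => ‖T f x‖ₑ) (volume.restrict (ball c r)) ≤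
        C * (avg (ball c (2 * r)) fun x => ‖T f x‖ₑ) + C * ⨅ x ∈ ball c r, maximalFunction f x

/-- `T` is of weak type `(1,1)`: `|{|Tf| > t}| ≤ (C / t) ‖f‖₁` for all `t > 0` and all
`f ∈ L¹ ∩ L²`. -/
def WeakTypeOneOne
    (T : Lp 𝕜 2 (volume : Measure (E n)) → Lp 𝕜 2 (volume : Measure (E n))) : Prop :=
  ∃ C : ℝ≥0, ∀ f : Lp 𝕜 2 (volume : Measure (E n)), MemLp f 1 volume →
    ∀ t : ℝ≥0, 0 < t → volume {x | t < ‖T f x‖ₑ} ≤ C / t * eLpNorm f 1 volume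

/-- `T` is bounded on `L^p(μ)`: `‖Tf‖_{L^p(μ)} ≤ C ‖f‖_{L^p(μ)}` for all `f ∈ L² ∩ L^p(μ)`.
It is used for measures `μ` that are absolutely continuous, so that classes of functions modulo
Lebesgue null sets have a well-defined `L^p(μ)` norm. -/
def BoundedOnLp
    (T : Lp 𝕜 2 (volume : Measure (E n)) → Lp 𝕜 2 (volume : Measure (E n)))
    (p : ℝ) (μ : Measure (E n)) : Prop :=
  ∃ C : ℝ≥0, ∀ f : Lp 𝕜 2 (volume : Measure (E n)), MemLp f (ENNReal.ofReal p) μ →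
    eLpNorm (T f) (ENNReal.ofReal p) μ ≤ C * eLpNorm f (ENNReal.ofReal p) μ

end Operators

end CZO

end

/-! Part (i) is the Calderón–Zygmund method. At height `t` one selects the maximal dyadic cubes on
which the mean of `|f|` exceeds `t` (`exists_stopping_cubes`) and replaces `f` by its mean on
finitely many of them. The good part is estimated in `L²`, the mean-zero pieces by the cancellation
condition (`mul_volume_two_mul_lt_le`). Sublinearity bounds only finite sums, so the discarded cubes
are arranged to carry so little `L²` mass that they may stay in the good part. Interpolation with
`L²` gives `1 < p < 2`.

Parts (ii) and (iii) follow from one sparse domination, for an operator of weak type `(r,r)`: `r =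
2` by Chebyshev, `r = 1` by part (i). The sup condition involves the `L¹` average of `|Tf|`, which
weak type `(1,1)` does not control. But a sup bound valid on all small balls improves itself to one
by the `L^{1/2}` average (`essSup_le_avg_sqrt`), and Kolmogorov's inequality controls that average
(`avg_sqrt_le`).

One step of the domination (`exists_sparse_children`): for a cube `Q` let `f_Q` be the restriction
of `f` to the enlarged ball of `Q` and `α` the `L^r` average of `f` there. Off a small exceptional
set, `|T f_Q|` and the maximal functions of `|T f_Q|^{1/2}` and `|f_Q|^r` are bounded by multiples
of `α`, `α^{1/2}` and `α^r`. Disjoint subcubes `P` of total measure at most `|Q|/2` cover the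
exceptional part of `Q`, and each contains a point `z` that is not exceptional. As `f_Q - f_P`
vanishes on the enlarged ball of `P`, the sup condition bounds `T(f_Q - f_P)` on `P` by averages and
a maximal function controlled by what is known at `z`, hence by `A α`. So `|T f_Q| ≤ A α + |T f_P|`
on `P`, and `|T f_Q| ≤ A α` on the rest of `Q`. Iteration (`le_sum_generation`) bounds `|Tf|` by a
sum of averages over balls whose cubes keep disjoint portions of at least half their measure.

Such sums are bounded on `L^p(W)` for `W ∈ A_q`, `p = q r` (`IsApWeight.exists_sparse_bound`): after
pairing with a dual function, all averages are rewritten with respect to `W` and the dual weight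
`W^{-1/(q-1)}`. The `A_q` constant pays for the conversion, both weights are doubling, and Hölder's
inequality over the disjoint portions reduces everything to the maximal theorems of the two weights.
Estimates are proved for bounded functions with bounded support and extended by `exists_approx`. -/

noncomputable section

/-! ### Maximal functions and layer cake formulas -/

namespace CZO

open Set Filter Topology

variable {n : ℕ}

/-- The uncentered maximal function with respect to a measure `μ`. -/
def maxFn (μ : Measure (E n)) (g : E n → ℝ≥0∞) (x : E n) : ℝ≥0∞ :=
  ⨆ (c : E n) (r : ℝ) (_ : x ∈ ball c r), (μ (ball c r))⁻¹ * ∫⁻ y in ball c r, g y ∂μ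

theorem avg_le_maxFn {μ : Measure (E n)} {g : E n → ℝ≥0∞} {x c : E n} {r : ℝ}
    (hx : x ∈ ball c r) :
    (μ (ball c r))⁻¹ * ∫⁻ y in ball c r, g y ∂μ ≤ maxFn μ g x :=
  le_iSup_of_le c <| le_iSup_of_le r <| le_iSup_of_le hx le_rfl

theorem maxFn_mono {μ : Measure (E n)} {g h : E n → ℝ≥0∞} (hgh : ∀ᵐ x ∂μ, g x ≤ h x) (x : E n) :
    maxFn μ g x ≤ maxFn μ h x := by
  refine iSup_mono fun c => iSup_mono fun r => iSup_mono fun _ => ?_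
  refine mul_le_mul_right ?_ _
  exact lintegral_mono_ae (ae_restrict_of_ae hgh)

theorem isOpen_lt_maxFn (μ : Measure (E n)) (g : E n → ℝ≥0∞) (t : ℝ≥0∞) :
    IsOpen {x | t < maxFn μ g x} := by
  have : {x | t < maxFn μ g x} = ⋃ (c : E n) (r : ℝ)
      (_ : t < (μ (ball c r))⁻¹ * ∫⁻ y in ball c r, g y ∂μ), ball c r := by
    ext x
    simp only [maxFn, lt_iSup_iff, mem_ofPred_eq, mem_iUnion, exists_prop]
    grind
  rw [this]
  exact isOpen_iUnion fun c => isOpen_iUnion fun r => isOpen_iUnion fun _ => isOpen_ball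

theorem measurable_maxFn (μ : Measure (E n)) (g : E n → ℝ≥0∞) : Measurable (maxFn μ g) :=
  measurable_of_Ioi fun t => (isOpen_lt_maxFn μ g t).measurableSet

/-- Weak type `(1,1)` of the maximal function of a doubling measure. -/
theorem mul_measure_lt_maxFn_le {μ : Measure (E n)} {D : ℝ≥0∞}
    (hD : ∀ (c : E n) (r : ℝ), 0 < r → μ (ball c (4 * r)) ≤ D * μ (ball c r))
    (g : E n → ℝ≥0∞) (t : ℝ≥0∞) :
    t * μ {x | t < maxFn μ g x} ≤ D * ∫⁻ x, g x ∂μ := by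
  -- Vitali's covering lemma needs bounded radii, so the level set is exhausted by balls of radius
  -- at most `N`.
  set F : ℕ → Set (E n × ℝ) := fun N =>
    {b | b.2 ≤ N ∧ t < (μ (ball b.1 b.2))⁻¹ * ∫⁻ y in ball b.1 b.2, g y ∂μ} with hF
  set U : ℕ → Set (E n) := fun N => ⋃ b ∈ F N, ball b.1 b.2 with hU
  have hmono : Monotone U := by
    intro N M hNM
    refine biUnion_subset_biUnion_left fun b hb => ⟨hb.1.trans (by exact_mod_cast hNM), hb.2⟩
  have hcov : {x | t < maxFn μ g x} = ⋃ N, U N := by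
    ext x
    simp only [maxFn, lt_iSup_iff, mem_ofPred_eq, mem_iUnion, hU, exists_prop, Prod.exists, hF]
    constructor
    · rintro ⟨c, r, hx, h⟩
      obtain ⟨N, hN⟩ := exists_nat_ge r
      exact ⟨N, c, r, ⟨hN, h⟩, hx⟩
    · rintro ⟨N, c, r, ⟨-, h⟩, hx⟩
      exact ⟨c, r, hx, h⟩
  rw [hcov, hmono.measure_iUnion, ENNReal.mul_iSup]
  refine iSup_le fun N => ?_
  obtain ⟨u, hut, hdisj, hcover⟩ := Vitali.exists_disjoint_subfamily_covering_enlargement_ball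
    (F N) (fun b => b.1) (fun b => b.2) N (fun b hb => hb.1) 4 (by norm_num)
  -- An empty ball has average `∞ * 0 = 0`, which is not above `t`.
  have hpos : ∀ b ∈ u, 0 < b.2 := by
    intro b hb
    by_contra! hneg
    have := (hut hb).2
    simp [ball_eq_empty.2 hneg] at this
  have hcount : u.Countable := hdisj.countable_of_isOpen (fun b _ => isOpen_ball)
    fun b hb => nonempty_ball.2 (hpos b hb)
  have hsub : U N ⊆ ⋃ b ∈ u, ball b.1 (4 * b.2) := by
    intro x hx
    simp only [hU, mem_iUnion] at hx
    obtain ⟨b, hb, hxb⟩ := hx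
    obtain ⟨b', hb', hbb'⟩ := hcover b hb
    exact mem_biUnion hb' (hbb' hxb)
  have hball : ∀ b ∈ u, t * μ (ball b.1 b.2) ≤ ∫⁻ y in ball b.1 b.2, g y ∂μ := by
    intro b hb
    have h := (hut hb).2.le
    rwa [mul_comm, ← div_eq_mul_inv, ENNReal.le_div_iff_mul_le] at h
    · by_contra! h'
      have := (hut hb).2
      simp [Measure.restrict_eq_zero.2 h'.1] at this
    · by_contra! h'
      have := (hut hb).2
      simp [h'.1] at this
  calc t * μ (U N) ≤ t * ∑' b : u, μ (ball b.1.1 (4 * b.1.2)) := by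
        gcongr
        exact (measure_mono hsub).trans (measure_biUnion_le _ hcount _)
    _ ≤ t * ∑' b : u, D * μ (ball b.1.1 b.1.2) := by
        gcongr with b
        exact hD _ _ (hpos _ b.2)
    _ = D * ∑' b : u, t * μ (ball b.1.1 b.1.2) := by
        rw [ENNReal.tsum_mul_left, ENNReal.tsum_mul_left]; ring
    _ ≤ D * ∑' b : u, ∫⁻ y in ball b.1.1 b.1.2, g y ∂μ := by
        gcongr with b
        exact hball _ b.2
    _ = D * ∫⁻ y in ⋃ b ∈ u, ball b.1 b.2, g y ∂μ := by
        rw [lintegral_biUnion hcount (fun b _ => measurableSet_ball) hdisj]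
    _ ≤ D * ∫⁻ x, g x ∂μ := by
        gcongr
        exact Measure.restrict_le_self

theorem maxFn_add_le (μ : Measure (E n)) {g h : E n → ℝ≥0∞} (hg : AEMeasurable g μ) (x : E n) :
    maxFn μ (fun y => g y + h y) x ≤ maxFn μ g x + maxFn μ h x := by
  refine iSup_le fun c => iSup_le fun r => iSup_le fun hx => ?_
  rw [lintegral_add_left' hg.restrict, mul_add]
  exact add_le_add (avg_le_maxFn hx) (avg_le_maxFn hx)

theorem maxFn_const_le (μ : Measure (E n)) (a : ℝ≥0∞) (x : E n) : maxFn μ (fun _ => a) x ≤ a := by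
  refine iSup_le fun c => iSup_le fun r => iSup_le fun hx => ?_
  rw [setLIntegral_const, mul_comm, mul_assoc]
  exact mul_le_of_le_one_right' (ENNReal.mul_inv_le_one _)

/-- `μ {Mg > 2t} ≤ (D/t) ∫_{g > t} g`. -/
theorem mul_measure_two_mul_lt_maxFn_le {μ : Measure (E n)} {D : ℝ≥0∞}
    (hD : ∀ (c : E n) (r : ℝ), 0 < r → μ (ball c (4 * r)) ≤ D * μ (ball c r))
    {g : E n → ℝ≥0∞} (hg : Measurable g) (t : ℝ≥0∞) :
    t * μ {x | 2 * t < maxFn μ g x} ≤ D * ∫⁻ x in {x | t < g x}, g x ∂μ := by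
  have hm : MeasurableSet {x | t < g x} := measurableSet_lt measurable_const hg
  rw [← lintegral_indicator hm]
  refine le_trans ?_ (mul_measure_lt_maxFn_le hD _ t)
  refine mul_le_mul_right (measure_mono fun x hx => ?_) _
  -- The part of `g` below `t` adds at most `t` to the maximal function, so only the part above `t`
  -- enters the weak type bound.
  have h1 : maxFn μ g x ≤ maxFn μ ({x | t < g x}.indicator g) x + t := by
    refine (maxFn_mono (h := fun y => {x | t < g x}.indicator g y + t)
      (Eventually.of_forall fun y => ?_) x).trans
      ((maxFn_add_le μ (hg.indicator hm).aemeasurable x).trans ?_)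
    · by_cases hy : t < g y
      · simp [indicator, hy]
      · simp [indicator, hy, not_lt.1 hy]
    · gcongr
      exact maxFn_const_le μ t x
  rw [mem_ofPred_eq, two_mul] at hx
  by_contra h2
  rw [mem_ofPred_eq, not_lt] at h2
  exact absurd (h1.trans (add_le_add_left h2 _)) (not_le.2 hx)

/-! ### Power integrals and layer cake formulas -/

theorem setLIntegral_rpow_lt {q : ℝ} (hq : 0 < q) (u : ℝ≥0∞) :
    ∫⁻ t in Ioi (0 : ℝ), {t : ℝ | ENNReal.ofReal t < u}.indicator
      (fun t => ENNReal.ofReal t ^ (q - 1)) t = ENNReal.ofReal q⁻¹ * u ^ q := by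
  have key : ∀ a : ℝ, 0 ≤ a → ∫⁻ t in Ioi (0 : ℝ), {t : ℝ | ENNReal.ofReal t <
      ENNReal.ofReal a}.indicator (fun t => ENNReal.ofReal t ^ (q - 1)) t =
        ENNReal.ofReal q⁻¹ * ENNReal.ofReal a ^ q := by
    intro a ha
    have hset : ∀ t ∈ Ioi (0 : ℝ), {t : ℝ | ENNReal.ofReal t < ENNReal.ofReal a}.indicator
        (fun t => ENNReal.ofReal t ^ (q - 1)) t =
        (Ioo 0 a).indicator (fun t => ENNReal.ofReal (t ^ (q - 1))) t := by
      intro t ht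
      have ht' : (0 : ℝ) < t := ht
      by_cases hta : t < a
      · have : ENNReal.ofReal t < ENNReal.ofReal a :=
          (ENNReal.ofReal_lt_ofReal_iff (ht'.trans hta)).2 hta
        simp [indicator, this, ht', hta, ENNReal.ofReal_rpow_of_pos ht']
      · have : ¬ ENNReal.ofReal t < ENNReal.ofReal a :=
          not_lt.2 (ENNReal.ofReal_le_ofReal (not_lt.1 hta))
        simp [indicator, this, hta]
    rw [setLIntegral_congr_fun measurableSet_Ioi hset, lintegral_indicator measurableSet_Ioo,
      Measure.restrict_restrict measurableSet_Ioo, inter_eq_left.2 (fun t ht => ht.1),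
      restrict_Ioo_eq_restrict_Ioc, ← ofReal_integral_eq_lintegral_ofReal,
      ← intervalIntegral.integral_of_le ha, integral_rpow (Or.inl (by linarith)),
      ENNReal.ofReal_rpow_of_nonneg ha hq.le, ← ENNReal.ofReal_mul (inv_nonneg.2 hq.le)]
    · congr 1
      rw [sub_add_cancel, Real.zero_rpow hq.ne', sub_zero]
      field_simp
    · exact (intervalIntegrable_iff_integrableOn_Ioc_of_le ha).1
        (intervalIntegral.intervalIntegrable_rpow' (by linarith))
    · filter_upwards [ae_restrict_mem measurableSet_Ioc] with t ht
      exact Real.rpow_nonneg ht.1.le _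
  by_cases hu : u = ∞
  · subst hu
    rw [ENNReal.top_rpow_of_pos hq, ENNReal.mul_top (by simpa using hq)]
    -- For `u = ∞` the integral dominates that for every finite `a`, and `a ^ q / q` exceeds any
    -- given bound.
    refine ENNReal.eq_top_of_forall_nnreal_le fun r => ?_
    obtain ⟨a, ha, har⟩ : ∃ a : ℝ, 0 ≤ a ∧ (r : ℝ) ≤ q⁻¹ * a ^ q := by
      refine ⟨(q * r) ^ q⁻¹, by positivity, ?_⟩
      rw [← Real.rpow_mul (by positivity), inv_mul_cancel₀ hq.ne', Real.rpow_one]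
      field_simp
      exact le_rfl
    calc (r : ℝ≥0∞) = ENNReal.ofReal r := by simp
      _ ≤ ENNReal.ofReal (q⁻¹ * a ^ q) := ENNReal.ofReal_le_ofReal har
      _ = ENNReal.ofReal q⁻¹ * ENNReal.ofReal a ^ q := by
        rw [ENNReal.ofReal_rpow_of_nonneg ha hq.le, ENNReal.ofReal_mul (inv_nonneg.2 hq.le)]
      _ = _ := (key a ha).symm
      _ ≤ _ := lintegral_mono fun t => indicator_le_indicator_of_subset
        (fun t ht => ht.out.trans_le le_top) (fun _ => zero_le) t
  · rw [← ENNReal.ofReal_toReal hu]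
    exact key _ ENNReal.toReal_nonneg

theorem setLIntegral_rpow_ge_le {q : ℝ} (hq : 0 < q) {u : ℝ≥0∞} (hu : u ≠ ∞) :
    ∫⁻ t in Ioi (0 : ℝ), {t : ℝ | u ≤ ENNReal.ofReal t}.indicator
      (fun t => ENNReal.ofReal t ^ (-q - 1)) t ≤ ENNReal.ofReal q⁻¹ * u ^ (-q) := by
  rcases eq_or_ne u 0 with rfl | hu0
  · rw [ENNReal.zero_rpow_of_neg (by linarith), ENNReal.mul_top (by simpa using hq)]
    exact le_top
  set a := u.toReal with ha
  have ha0 : 0 < a := ENNReal.toReal_pos hu0 hu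
  have hua : u = ENNReal.ofReal a := (ENNReal.ofReal_toReal hu).symm
  have hset : ∀ t ∈ Ioi (0 : ℝ), {t : ℝ | u ≤ ENNReal.ofReal t}.indicator
      (fun t => ENNReal.ofReal t ^ (-q - 1)) t =
      (Ici a).indicator (fun t => ENNReal.ofReal (t ^ (-q - 1))) t := by
    intro t ht
    have ht' : (0 : ℝ) < t := ht
    have : u ≤ ENNReal.ofReal t ↔ a ≤ t := by
      rw [hua]; exact ENNReal.ofReal_le_ofReal_iff ht'.le
    simp [indicator, this, ENNReal.ofReal_rpow_of_pos ht']
  rw [setLIntegral_congr_fun measurableSet_Ioi hset, lintegral_indicator measurableSet_Ici,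
    Measure.restrict_restrict measurableSet_Ici,
    inter_eq_left.2 (Ici_subset_Ioi.2 ha0), ← restrict_Ioi_eq_restrict_Ici,
    ← ofReal_integral_eq_lintegral_ofReal, integral_Ioi_rpow_of_lt (by linarith) ha0, hua,
    ENNReal.ofReal_rpow_of_pos ha0, ← ENNReal.ofReal_mul (inv_nonneg.2 hq.le)]
  · apply ENNReal.ofReal_le_ofReal
    rw [sub_add_cancel, neg_div_neg_eq, div_eq_inv_mul]
  · exact integrableOn_Ioi_rpow_of_lt (by linarith) ha0
  · filter_upwards [ae_restrict_mem measurableSet_Ioi] with t ht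
    exact Real.rpow_nonneg (ha0.trans ht).le _

section LayerCake

variable {α : Type*} [MeasurableSpace α] {μ : Measure α} [SFinite μ]

theorem measurableSet_ofReal_lt {F : α → ℝ≥0∞} (hF : Measurable F) :
    MeasurableSet {z : α × ℝ | ENNReal.ofReal z.2 < F z.1} :=
  measurableSet_lt (by fun_prop) (by fun_prop)

theorem lintegral_rpow_eq_layercake {F : α → ℝ≥0∞} (hF : Measurable F) {p : ℝ} (hp : 0 < p) :
    ∫⁻ x, F x ^ p ∂μ = ENNReal.ofReal p *
      ∫⁻ t in Ioi (0 : ℝ), ENNReal.ofReal t ^ (p - 1) * μ {x | ENNReal.ofReal t < F x} := by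
  have h1 : ∀ x, F x ^ p = ENNReal.ofReal p * ∫⁻ t in Ioi (0 : ℝ),
      {t : ℝ | ENNReal.ofReal t < F x}.indicator (fun t => ENNReal.ofReal t ^ (p - 1)) t := by
    intro x
    rw [setLIntegral_rpow_lt hp, ← mul_assoc, ← ENNReal.ofReal_mul hp.le,
      mul_inv_cancel₀ hp.ne', ENNReal.ofReal_one, one_mul]
  have hmeas : Measurable (Function.uncurry fun (x : α) (t : ℝ) =>
      {t : ℝ | ENNReal.ofReal t < F x}.indicator (fun t => ENNReal.ofReal t ^ (p - 1)) t) := by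
    have : (Function.uncurry fun (x : α) (t : ℝ) =>
      {t : ℝ | ENNReal.ofReal t < F x}.indicator (fun t => ENNReal.ofReal t ^ (p - 1)) t) =
      {z : α × ℝ | ENNReal.ofReal z.2 < F z.1}.indicator
        (fun z => ENNReal.ofReal z.2 ^ (p - 1)) := by
      ext ⟨x, t⟩; simp [indicator, Function.uncurry]
    rw [this]
    exact Measurable.indicator (by fun_prop) (measurableSet_ofReal_lt hF)
  simp_rw [h1]
  rw [lintegral_const_mul _ (Measurable.lintegral_prod_right hmeas),
    lintegral_lintegral_swap hmeas.aemeasurable]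
  congr 1
  refine lintegral_congr fun t => ?_
  have : (fun x => {t : ℝ | ENNReal.ofReal t < F x}.indicator
      (fun t => ENNReal.ofReal t ^ (p - 1)) t) =
      {x | ENNReal.ofReal t < F x}.indicator fun _ => ENNReal.ofReal t ^ (p - 1) := by
    ext x; simp [indicator]
  rw [this, lintegral_indicator_const (measurableSet_lt measurable_const hF)]

/-- Fubini: at fixed `x` the `t`-integral runs over `t < K * h x`. This is how a weak type `(1,1)`
bound on the large part of a function integrates to an `L^p` bound; `p > 1` makes the integral
converge at `0`. -/
theorem setLIntegral_rpow_mul_lintegral_lt {h : α → ℝ≥0∞} (hh : Measurable h) (K : ℝ≥0∞)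
    {p : ℝ} (hp : 1 < p) :
    ∫⁻ t in Ioi (0 : ℝ), ENNReal.ofReal t ^ (p - 2) *
        ∫⁻ x in {x | ENNReal.ofReal t < K * h x}, h x ∂μ =
      ENNReal.ofReal (p - 1)⁻¹ * ∫⁻ x, h x * (K * h x) ^ (p - 1) ∂μ := by
  have hmeas : Measurable (Function.uncurry fun (x : α) (t : ℝ) => h x *
      {t : ℝ | ENNReal.ofReal t < K * h x}.indicator (fun t => ENNReal.ofReal t ^ (p - 2)) t) := by
    have : (Function.uncurry fun (x : α) (t : ℝ) => h x *
      {t : ℝ | ENNReal.ofReal t < K * h x}.indicator (fun t => ENNReal.ofReal t ^ (p - 2)) t) =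
      {z : α × ℝ | ENNReal.ofReal z.2 < K * h z.1}.indicator
        (fun z => h z.1 * ENNReal.ofReal z.2 ^ (p - 2)) := by
      ext ⟨x, t⟩; simp [indicator, Function.uncurry]
    rw [this]
    exact Measurable.indicator (by fun_prop) (measurableSet_ofReal_lt (hh.const_mul K))
  have h1 : ∀ x, ENNReal.ofReal (p - 1)⁻¹ * (h x * (K * h x) ^ (p - 1)) =
      ∫⁻ t in Ioi (0 : ℝ), h x * {t : ℝ | ENNReal.ofReal t < K * h x}.indicator
        (fun t => ENNReal.ofReal t ^ (p - 2)) t := by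
    intro x
    have hm : Measurable ({t : ℝ | ENNReal.ofReal t < K * h x}.indicator
        (fun t => ENNReal.ofReal t ^ (p - 2))) :=
      Measurable.indicator (by fun_prop) (measurableSet_lt (by fun_prop) (by fun_prop))
    rw [lintegral_const_mul _ hm]
    have := setLIntegral_rpow_lt (q := p - 1) (by linarith) (K * h x)
    rw [show p - 1 - 1 = p - 2 by ring] at this
    rw [this]; ring
  rw [← lintegral_const_mul _ (by fun_prop)]
  simp_rw [h1]
  rw [lintegral_lintegral_swap hmeas.aemeasurable]
  refine lintegral_congr fun t => ?_
  rw [← lintegral_indicator (measurableSet_lt measurable_const (hh.const_mul K)),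
    ← lintegral_const_mul _ (hh.indicator (measurableSet_lt measurable_const (hh.const_mul K)))]
  refine lintegral_congr fun x => ?_
  by_cases hx : ENNReal.ofReal t < K * h x <;> simp [indicator, hx, mul_comm]

/-- The counterpart for the small part of a function and an `L²` bound: at fixed `x` the
`t`-integral runs over `t ≥ h x`, and `p < 2` makes it converge at infinity. -/
theorem setLIntegral_rpow_mul_lintegral_le {h : α → ℝ≥0∞} (hh : Measurable h)
    (hfin : ∀ x, h x ≠ ∞) {p : ℝ} (hp0 : 0 < p) (hp : p < 2) :
    ∫⁻ t in Ioi (0 : ℝ), ENNReal.ofReal t ^ (p - 3) *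
        ∫⁻ x in {x | h x ≤ ENNReal.ofReal t}, h x ^ (2 : ℝ) ∂μ ≤
      ENNReal.ofReal (2 - p)⁻¹ * ∫⁻ x, h x ^ p ∂μ := by
  have hset : MeasurableSet {z : α × ℝ | h z.1 ≤ ENNReal.ofReal z.2} :=
    measurableSet_le (by fun_prop) (by fun_prop)
  have hmeas : Measurable (Function.uncurry fun (x : α) (t : ℝ) => h x ^ (2 : ℝ) *
      {t : ℝ | h x ≤ ENNReal.ofReal t}.indicator (fun t => ENNReal.ofReal t ^ (p - 3)) t) := by
    have : (Function.uncurry fun (x : α) (t : ℝ) => h x ^ (2 : ℝ) *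
      {t : ℝ | h x ≤ ENNReal.ofReal t}.indicator (fun t => ENNReal.ofReal t ^ (p - 3)) t) =
      {z : α × ℝ | h z.1 ≤ ENNReal.ofReal z.2}.indicator
        (fun z => h z.1 ^ (2 : ℝ) * ENNReal.ofReal z.2 ^ (p - 3)) := by
      ext ⟨x, t⟩; simp [indicator, Function.uncurry]
    rw [this]
    exact Measurable.indicator (by fun_prop) hset
  calc _ = ∫⁻ t in Ioi (0 : ℝ), ∫⁻ x, h x ^ (2 : ℝ) *
      {t : ℝ | h x ≤ ENNReal.ofReal t}.indicator (fun t => ENNReal.ofReal t ^ (p - 3)) t ∂μ := by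
        refine lintegral_congr fun t => ?_
        have hs : MeasurableSet {x | h x ≤ ENNReal.ofReal t} := measurableSet_le hh measurable_const
        rw [← lintegral_indicator hs,
          ← lintegral_const_mul _ (Measurable.indicator (by fun_prop) hs)]
        refine lintegral_congr fun x => ?_
        by_cases hx : h x ≤ ENNReal.ofReal t <;> simp [indicator, hx, mul_comm]
    _ = ∫⁻ x, (∫⁻ t in Ioi (0 : ℝ), h x ^ (2 : ℝ) *
      {t : ℝ | h x ≤ ENNReal.ofReal t}.indicator (fun t => ENNReal.ofReal t ^ (p - 3)) t) ∂μ :=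
        (lintegral_lintegral_swap hmeas.aemeasurable).symm
    _ ≤ ∫⁻ x, ENNReal.ofReal (2 - p)⁻¹ * h x ^ p ∂μ := by
        refine lintegral_mono fun x => ?_
        have hm : Measurable ({t : ℝ | h x ≤ ENNReal.ofReal t}.indicator
            (fun t => ENNReal.ofReal t ^ (p - 3))) :=
          Measurable.indicator (by fun_prop) (measurableSet_le (by fun_prop) (by fun_prop))
        rw [lintegral_const_mul _ hm]
        have := setLIntegral_rpow_ge_le (q := 2 - p) (by linarith) (hfin x)
        rw [show -(2 - p) - 1 = p - 3 by ring] at this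
        refine (mul_le_mul_right this _).trans (le_of_eq ?_)
        rcases eq_or_ne (h x) 0 with h0 | h0
        · simp [h0, ENNReal.zero_rpow_of_pos hp0]
        · rw [mul_left_comm, ← ENNReal.rpow_add _ _ h0 (hfin x)]
          congr 2; ring
    _ = _ := lintegral_const_mul _ (by fun_prop)

end LayerCake

/-- Strong type `(p,p)`, `1 < p < ∞`, of the maximal function of a doubling measure. -/
theorem lintegral_maxFn_rpow_le {μ : Measure (E n)} [SFinite μ] {D : ℝ≥0∞}
    (hD : ∀ (c : E n) (r : ℝ), 0 < r → μ (ball c (4 * r)) ≤ D * μ (ball c r))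
    {g : E n → ℝ≥0∞} (hg : Measurable g) {p : ℝ} (hp : 1 < p) :
    ∫⁻ x, maxFn μ g x ^ p ∂μ ≤
      ENNReal.ofReal p * (2 * D) * ENNReal.ofReal (p - 1)⁻¹ * 2 ^ (p - 1) * ∫⁻ x, g x ^ p ∂μ := by
  rw [lintegral_rpow_eq_layercake (measurable_maxFn μ g) (by linarith)]
  have h1 : ∀ t ∈ Ioi (0 : ℝ), ENNReal.ofReal t ^ (p - 1) * μ {x | ENNReal.ofReal t < maxFn μ g x}
      ≤ (2 * D) * (ENNReal.ofReal t ^ (p - 2) *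
        ∫⁻ x in {x | ENNReal.ofReal t < 2 * g x}, g x ∂μ) := by
    intro t ht
    have ht0 : ENNReal.ofReal t ≠ 0 := by simpa using ht
    -- The truncated weak type bound is used at height `t / 2`, where its left side is the level set
    -- at `t`.
    have h2 := mul_measure_two_mul_lt_maxFn_le hD hg (ENNReal.ofReal t / 2)
    rw [ENNReal.mul_div_cancel (by norm_num) (by norm_num)] at h2
    have h3 : {x | ENNReal.ofReal t / 2 < g x} = {x | ENNReal.ofReal t < 2 * g x} := by
      ext x
      rw [mem_ofPred_eq, mem_ofPred_eq, ENNReal.div_lt_iff (by simp) (by simp), mul_comm]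
    rw [h3] at h2
    have h4 : ENNReal.ofReal t ^ (p - 1) = 2 * (ENNReal.ofReal t ^ (p - 2) *
        (ENNReal.ofReal t / 2)) := by
      rw [show p - 1 = p - 2 + 1 by ring, ENNReal.rpow_add _ _ ht0 ENNReal.ofReal_ne_top,
        ENNReal.rpow_one, mul_left_comm, ENNReal.mul_div_cancel (by norm_num) (by norm_num)]
    rw [h4, mul_assoc, mul_assoc, mul_assoc 2 D, mul_left_comm D]
    gcongr
  have hm : Measurable fun t : ℝ => ENNReal.ofReal t ^ (p - 2) *
        ∫⁻ x in {x | ENNReal.ofReal t < 2 * g x}, g x ∂μ := by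
    have : Measurable fun t : ℝ => ∫⁻ x in {x | ENNReal.ofReal t < 2 * g x}, g x ∂μ := by
      have hanti : Antitone fun t : ℝ => ∫⁻ x in {x | ENNReal.ofReal t < 2 * g x}, g x ∂μ :=
        fun s t hst => lintegral_mono_set fun x hx =>
          (ENNReal.ofReal_le_ofReal hst).trans_lt hx
      exact hanti.measurable
    fun_prop
  calc _ ≤ ENNReal.ofReal p * ∫⁻ t in Ioi (0 : ℝ), (2 * D) * (ENNReal.ofReal t ^ (p - 2) *
        ∫⁻ x in {x | ENNReal.ofReal t < 2 * g x}, g x ∂μ) :=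
        mul_le_mul_right (setLIntegral_mono' measurableSet_Ioi h1) _
    _ = ENNReal.ofReal p * ((2 * D) * (ENNReal.ofReal (p - 1)⁻¹ *
        ∫⁻ x, g x * (2 * g x) ^ (p - 1) ∂μ)) := by
        rw [lintegral_const_mul _ hm, setLIntegral_rpow_mul_lintegral_lt hg 2 hp]
    _ = ENNReal.ofReal p * ((2 * D) * (ENNReal.ofReal (p - 1)⁻¹ *
        (2 ^ (p - 1) * ∫⁻ x, g x ^ p ∂μ))) := by
        rw [← lintegral_const_mul (2 ^ (p - 1)) (by fun_prop)]
        congr 3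
        refine lintegral_congr fun x => ?_
        rw [ENNReal.mul_rpow_of_nonneg _ _ (by linarith), mul_left_comm]
        congr 1
        nth_rewrite 1 [← ENNReal.rpow_one (g x)]
        rw [← ENNReal.rpow_add_of_nonneg _ _ (by norm_num) (by linarith)]
        congr 1; ring
    _ = _ := by ring

end CZO

/-! ### Dyadic cubes -/

namespace CZO

open Set Filter Topology

variable {n : ℕ}

theorem volume_ball_eq (c : E n) {r : ℝ} (hr : 0 < r) :
    volume (ball c r) = ENNReal.ofReal r ^ n * volume (ball (0 : E n) 1) := by
  rw [Measure.addHaar_ball_of_pos _ _ hr, ENNReal.ofReal_pow hr.le]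
  simp

theorem volume_ball_mul (c c' : E n) {a r : ℝ} (ha : 0 < a) (hr : 0 < r) :
    volume (ball c (a * r)) = ENNReal.ofReal a ^ n * volume (ball c' r) := by
  rw [volume_ball_eq c (mul_pos ha hr), volume_ball_eq c' hr, ENNReal.ofReal_mul ha.le, mul_pow,
    mul_assoc]

theorem volume_ball_ne_zero (c : E n) {r : ℝ} (hr : 0 < r) : volume (ball c r) ≠ 0 :=
  (measure_ball_pos volume c hr).ne'

theorem volume_ball_ne_top (c : E n) (r : ℝ) : volume (ball c r) ≠ ∞ :=
  measure_ball_lt_top.ne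

/-- Indices of dyadic cubes: the generation and the position. -/
abbrev Idx (n : ℕ) : Type := ℕ × (Fin n → ℤ)

/-- The position of the cube of generation `k` that contains `x`; the cube of generation `0` and
position `0` has side `s` and is centered at the origin. -/
def cubeIdx (s : ℝ) (k : ℕ) (x : E n) : Fin n → ℤ := fun i => ⌊(2 : ℝ) ^ k * (x i / s + 1 / 2)⌋

/-- Dyadic cubes. -/
def cube (s : ℝ) (Q : Idx n) : Set (E n) := {x | cubeIdx s Q.1 x = Q.2}

/-- The center of a dyadic cube. -/
def cubeCenter (s : ℝ) (Q : Idx n) : E n :=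
  WithLp.toLp 2 fun i => s * (((Q.2 i : ℝ) + 1 / 2) / 2 ^ Q.1 - 1 / 2)

/-- The radius of a ball around the center that contains the dyadic cube. -/
def cubeRadius (s : ℝ) (Q : Idx n) : ℝ := (n + 1) * (s / 2 ^ Q.1)

theorem mem_cube {s : ℝ} {Q : Idx n} {x : E n} : x ∈ cube s Q ↔ cubeIdx s Q.1 x = Q.2 := Iff.rfl

theorem mem_cube_self (s : ℝ) (k : ℕ) (x : E n) : x ∈ cube s (k, cubeIdx s k x) := rfl

theorem cubeRadius_pos {s : ℝ} (hs : 0 < s) (Q : Idx n) : 0 < cubeRadius s Q := by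
  unfold cubeRadius; positivity

theorem cubeRadius_le {s : ℝ} (hs : 0 < s) {P Q : Idx n} (h : Q.1 < P.1) :
    2 * cubeRadius s P ≤ cubeRadius s Q := by
  unfold cubeRadius
  have : (2 : ℝ) * (s / 2 ^ P.1) ≤ s / 2 ^ Q.1 := by
    rw [mul_div_assoc', div_le_div_iff₀ (by positivity) (by positivity)]
    have : (2 : ℝ) ^ (Q.1 + 1) ≤ 2 ^ P.1 := pow_le_pow_right₀ (by norm_num) h
    rw [pow_succ] at this
    nlinarith
  have hn : (0 : ℝ) ≤ n + 1 := by positivity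
  nlinarith

/-- The source of the nesting of dyadic cubes: the position of a parent is that of its child, halved
and rounded down. -/
theorem floor_eq_floor_two_mul_div (a : ℝ) : ⌊a⌋ = ⌊2 * a⌋ / 2 := by
  have h1 := Int.floor_le a
  have h2 := Int.lt_floor_add_one a
  have h3 : 2 * ⌊a⌋ ≤ ⌊2 * a⌋ := Int.le_floor.2 (by push_cast; linarith)
  have h4 : ⌊2 * a⌋ < 2 * ⌊a⌋ + 2 := Int.floor_lt.2 (by push_cast; linarith)
  omega

theorem cubeIdx_eq_of_le {s : ℝ} {k l : ℕ} (hkl : k ≤ l) {x y : E n}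
    (h : cubeIdx s l x = cubeIdx s l y) : cubeIdx s k x = cubeIdx s k y := by
  induction l, hkl using Nat.le_induction with
  | base => exact h
  | succ l _ ih =>
    refine ih (funext fun i => ?_)
    have hi := congrFun h i
    simp only [cubeIdx] at hi ⊢
    rw [floor_eq_floor_two_mul_div, floor_eq_floor_two_mul_div (2 ^ l * (y i / s + 1 / 2)),
      ← mul_assoc, ← mul_assoc, ← pow_succ', hi]

theorem cube_subset_of_mem {s : ℝ} {P Q : Idx n} (h : Q.1 ≤ P.1) {x : E n} (hP : x ∈ cube s P)
    (hQ : x ∈ cube s Q) : cube s P ⊆ cube s Q := fun _ hy =>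
  (cubeIdx_eq_of_le h (mem_cube.1 hy |>.trans (mem_cube.1 hP).symm)).trans hQ

theorem measurable_cubeIdx (s : ℝ) (k : ℕ) : Measurable (cubeIdx s k : E n → Fin n → ℤ) := by
  unfold cubeIdx
  refine measurable_pi_lambda _ fun i => Int.measurable_floor.comp ?_
  fun_prop

theorem measurableSet_cube (s : ℝ) (Q : Idx n) : MeasurableSet (cube s Q) :=
  measurable_cubeIdx s Q.1 (measurableSet_singleton Q.2)

theorem mem_cube_iff {s : ℝ} (hs : 0 < s) {Q : Idx n} {x : E n} :
    x ∈ cube s Q ↔ ∀ i, x i ∈ Ico (s * ((Q.2 i : ℝ) / 2 ^ Q.1 - 1 / 2))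
      (s * (((Q.2 i : ℝ) + 1) / 2 ^ Q.1 - 1 / 2)) := by
  rw [mem_cube, funext_iff]
  refine forall_congr' fun i => ?_
  have h2 : (0 : ℝ) < 2 ^ Q.1 := by positivity
  rw [cubeIdx, Int.floor_eq_iff, mem_Ico]
  have e1 : s * ((Q.2 i : ℝ) / 2 ^ Q.1 - 1 / 2) ≤ x i ↔
      (Q.2 i : ℝ) ≤ 2 ^ Q.1 * (x i / s + 1 / 2) := by
    rw [← le_div_iff₀' hs, sub_le_iff_le_add, div_le_iff₀' h2]
  have e2 : x i < s * (((Q.2 i : ℝ) + 1) / 2 ^ Q.1 - 1 / 2) ↔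
      2 ^ Q.1 * (x i / s + 1 / 2) < (Q.2 i : ℝ) + 1 := by
    rw [← div_lt_iff₀' hs, lt_sub_iff_add_lt, lt_div_iff₀' h2]
  rw [e1, e2]

theorem volume_cube {s : ℝ} (hs : 0 < s) (Q : Idx n) :
    volume (cube s Q) = ENNReal.ofReal (s / 2 ^ Q.1) ^ n := by
  have h : cube s Q = (@WithLp.ofLp 2 (Fin n → ℝ)) ⁻¹' (univ.pi fun i =>
      Ico (s * ((Q.2 i : ℝ) / 2 ^ Q.1 - 1 / 2)) (s * (((Q.2 i : ℝ) + 1) / 2 ^ Q.1 - 1 / 2))) := by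
    ext x
    simp only [mem_cube_iff hs, mem_preimage, mem_univ_pi]
  rw [h, (PiLp.volume_preserving_ofLp (Fin n)).measure_preimage
    (MeasurableSet.univ_pi fun i => measurableSet_Ico).nullMeasurableSet, Real.volume_pi_Ico]
  have : ∀ i, s * (((Q.2 i : ℝ) + 1) / 2 ^ Q.1 - 1 / 2) - s * ((Q.2 i : ℝ) / 2 ^ Q.1 - 1 / 2) =
    s / 2 ^ Q.1 := fun i => by ring
  simp_rw [this]
  simp

theorem volume_cube_ne_zero {s : ℝ} (hs : 0 < s) (Q : Idx n) : volume (cube s Q) ≠ 0 := by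
  rw [volume_cube hs]
  exact pow_ne_zero _ (by simpa using (by positivity : 0 < s / 2 ^ Q.1))

theorem volume_cube_ne_top {s : ℝ} (hs : 0 < s) (Q : Idx n) : volume (cube s Q) ≠ ∞ := by
  rw [volume_cube hs]
  exact ENNReal.pow_ne_top ENNReal.ofReal_ne_top

theorem volume_cube_succ {s : ℝ} (hs : 0 < s) {P Q : Idx n} (h : Q.1 + 1 = P.1) :
    volume (cube s Q) = 2 ^ n * volume (cube s P) := by
  rw [volume_cube hs, volume_cube hs, ← h, ← mul_pow, ← ENNReal.ofReal_ofNat,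
    ← ENNReal.ofReal_mul (by norm_num)]
  congr 2
  rw [pow_succ]
  field_simp

/-- Every coordinate is within one side length of the center, so the distance is at most `√n` sides.
The factor `n + 1` is strictly larger, also for `n = 0`. -/
theorem cube_subset_ball {s : ℝ} (hs : 0 < s) (Q : Idx n) :
    cube s Q ⊆ ball (cubeCenter s Q) (cubeRadius s Q) := by
  intro x hx
  rw [mem_cube_iff hs] at hx
  have hpos : 0 < s / 2 ^ Q.1 := by positivity
  have hi : ∀ i, ‖(x - cubeCenter s Q) i‖ ≤ s / 2 ^ Q.1 := by
    intro i
    have := hx i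
    rw [mem_Ico] at this
    have e1 : s * ((Q.2 i : ℝ) / 2 ^ Q.1 - 1 / 2) =
      cubeCenter s Q i - s / 2 ^ Q.1 / 2 := by simp only [cubeCenter]; ring
    have e2 : s * (((Q.2 i : ℝ) + 1) / 2 ^ Q.1 - 1 / 2) =
      cubeCenter s Q i + s / 2 ^ Q.1 / 2 := by simp only [cubeCenter]; ring
    rw [e1, e2] at this
    rw [PiLp.sub_apply, Real.norm_eq_abs, abs_le]
    constructor <;> linarith
  rw [mem_ball, dist_eq_norm, cubeRadius, EuclideanSpace.norm_eq]
  refine (Real.sqrt_lt' (by positivity)).2 ?_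
  calc ∑ i, ‖(x - cubeCenter s Q) i‖ ^ 2 ≤ ∑ i : Fin n, (s / 2 ^ Q.1) ^ 2 :=
        Finset.sum_le_sum fun i _ => pow_le_pow_left₀ (norm_nonneg _) (hi i) 2
    _ = n * (s / 2 ^ Q.1) ^ 2 := by simp
    _ < ((n + 1) * (s / 2 ^ Q.1)) ^ 2 := by
        rw [mul_pow]
        have : (n : ℝ) < (n + 1) ^ 2 := by nlinarith [(Nat.cast_nonneg n : (0 : ℝ) ≤ n)]
        gcongr

/-- The ratio of the volume of a dyadic cube and the volume of the ball around it. -/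
def cubeConst (n : ℕ) : ℝ≥0∞ := ENNReal.ofReal (n + 1) ^ n * volume (ball (0 : E n) 1)

theorem cubeConst_ne_top (n : ℕ) : cubeConst n ≠ ∞ :=
  ENNReal.mul_ne_top (ENNReal.pow_ne_top ENNReal.ofReal_ne_top) (volume_ball_ne_top _ _)

theorem volume_cubeBall {s : ℝ} (hs : 0 < s) (Q : Idx n) (c : E n) :
    volume (ball c (cubeRadius s Q)) = cubeConst n * volume (cube s Q) := by
  rw [volume_ball_eq _ (cubeRadius_pos hs Q), volume_cube hs, cubeRadius,
    ENNReal.ofReal_mul (by positivity), mul_pow, cubeConst]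
  ring

theorem volume_mul_cubeBall {s : ℝ} (hs : 0 < s) (Q : Idx n) (c : E n) {a : ℝ} (ha : 0 < a) :
    volume (ball c (a * cubeRadius s Q)) =
      ENNReal.ofReal a ^ n * cubeConst n * volume (cube s Q) := by
  rw [volume_ball_mul c c ha (cubeRadius_pos hs Q), volume_cubeBall hs, mul_assoc]

theorem ball_subset_cube_zero {s : ℝ} (hs : 0 < s) : ball (0 : E n) (s / 2) ⊆ cube s (0, 0) := by
  intro x hx
  rw [mem_cube_iff hs]
  intro i
  have h1 : ‖x i‖ ≤ ‖x‖ := PiLp.norm_apply_le x i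
  rw [mem_ball_zero_iff] at hx
  rw [Real.norm_eq_abs, abs_le] at h1
  simp only [Pi.zero_apply, Int.cast_zero, pow_zero, mem_Ico]
  constructor <;> linarith

theorem exists_cube_subset {s : ℝ} (hs : 0 < s) {U : Set (E n)} (hU : IsOpen U) {x : E n}
    (hx : x ∈ U) (k₀ : ℕ) : ∃ k ≥ k₀, cube s (k, cubeIdx s k x) ⊆ U := by
  obtain ⟨ε, hε, hεU⟩ := Metric.isOpen_iff.1 hU x hx
  have hlim : Tendsto (fun k : ℕ => 2 * ((n + 1) * (s / 2 ^ k))) atTop (𝓝 (2 * ((n + 1) * 0))) := by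
    refine Tendsto.const_mul _ (Tendsto.const_mul _ ?_)
    exact tendsto_const_nhds.div_atTop (tendsto_pow_atTop_atTop_of_one_lt (by norm_num))
  simp only [mul_zero] at hlim
  obtain ⟨k, hk, hkk⟩ := ((hlim.eventually (gt_mem_nhds hε)).and (eventually_ge_atTop k₀)).exists
  refine ⟨k, hkk, fun y hy => hεU ?_⟩
  have h1 := cube_subset_ball hs _ hy
  have h2 := cube_subset_ball hs _ (mem_cube_self s k x)
  rw [mem_ball] at h1 h2 ⊢
  have h3 := dist_triangle_right y x (cubeCenter s (k, cubeIdx s k x))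
  simp only [cubeRadius] at h1 h2
  linarith

/-- Selection of the maximal bad dyadic cubes in a dyadic cube that is not bad. -/
theorem exists_stopping_cubes (s : ℝ) (Q : Idx n) (bad : Idx n → Prop) (hQ : ¬ bad Q) :
    ∃ J : Set (Idx n), (∀ P ∈ J, bad P ∧ Q.1 < P.1 ∧ cube s P ⊆ cube s Q ∧
        ∃ R : Idx n, ¬ bad R ∧ R.1 + 1 = P.1 ∧ cube s P ⊆ cube s R ∧ cube s R ⊆ cube s Q) ∧
      J.PairwiseDisjoint (cube s) ∧
      ∀ x ∈ cube s Q, ∀ k, Q.1 ≤ k → bad (k, cubeIdx s k x) → x ∈ ⋃ P ∈ J, cube s P := by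
  -- A cube is selected when it is the first bad one in the chain of cubes from `Q` down to one of
  -- its points. The cube one generation up is then not bad.
  refine ⟨{P | Q.1 < P.1 ∧ bad P ∧ ∃ x ∈ cube s P, x ∈ cube s Q ∧
    ∀ j, Q.1 ≤ j → j < P.1 → ¬ bad (j, cubeIdx s j x)}, ?_, ?_, ?_⟩
  · rintro P ⟨hlt, hbad, x, hxP, hxQ, hx⟩
    refine ⟨hbad, hlt, cube_subset_of_mem hlt.le hxP hxQ, (P.1 - 1, cubeIdx s (P.1 - 1) x),
      hx _ (by omega) (by omega), by dsimp only; omega, ?_, ?_⟩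
    · exact cube_subset_of_mem (by dsimp only; omega) hxP (mem_cube_self _ _ _)
    · exact cube_subset_of_mem (by dsimp only; omega) (mem_cube_self _ _ _) hxQ
  -- If the coarser bad cube `P` met `P'` it would contain `P'`, and the chain towards `x` would
  -- have stopped at `P`.
  · have key : ∀ P P' : Idx n, bad P → Q.1 < P.1 → P.1 < P'.1 → (∃ x ∈ cube s P', x ∈ cube s Q ∧
        ∀ j, Q.1 ≤ j → j < P'.1 → ¬ bad (j, cubeIdx s j x)) → Disjoint (cube s P) (cube s P') := by
      rintro P P' hb h0 hlt ⟨x, hxP', -, hx⟩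
      rw [Set.disjoint_left]
      intro y hyP hyP'
      have h1 : cubeIdx s P.1 x = cubeIdx s P.1 y :=
        cubeIdx_eq_of_le hlt.le ((mem_cube.1 hxP').trans (mem_cube.1 hyP').symm)
      refine hx P.1 h0.le hlt ?_
      rw [h1, mem_cube.1 hyP]
      exact hb
    rintro P ⟨h1, h2, h3⟩ P' ⟨h1', h2', h3'⟩ hne
    rcases lt_trichotomy P.1 P'.1 with h | h | h
    · exact key P P' h2 h1 h h3'
    · rw [Function.onFun, Set.disjoint_left]
      intro y hy hy'
      exact hne (Prod.ext h ((mem_cube.1 hy).symm.trans (by rw [h]; exact hy')))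
    · exact (key P' P h2' h1' h h3).symm
  · intro x hx k hk hb
    classical
    have hex : ∃ k, Q.1 ≤ k ∧ bad (k, cubeIdx s k x) := ⟨k, hk, hb⟩
    have hsp := Nat.find_spec hex
    have hlt : Q.1 < Nat.find hex := by
      refine lt_of_le_of_ne hsp.1 fun h => hQ ?_
      have := hsp.2
      rwa [← h, mem_cube.1 hx] at this
    refine mem_biUnion (x := (Nat.find hex, cubeIdx s (Nat.find hex) x)) ?_ (mem_cube_self _ _ _)
    exact ⟨hlt, hsp.2, x, mem_cube_self _ _ _, hx, fun j hj hjlt hbj =>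
      Nat.find_min hex hjlt ⟨hj, hbj⟩⟩

end CZO

/-! ### Weights and sparse bounds -/

namespace CZO

open Set Filter Topology

variable {n : ℕ}

/-- A positive finite measurable weight with finite `A_q` constant at most `C`, together with the
local finiteness of the weight and of its dual weight. -/
structure IsApWeight (q : ℝ) (W : E n → ℝ≥0∞) (C : ℝ≥0∞) : Prop where
  measurable : Measurable W
  ne_zero : ∀ x, W x ≠ 0
  ne_top : ∀ x, W x ≠ ∞
  ball_ne_top : ∀ c r, ∫⁻ x in ball c r, W x ≠ ∞
  dual_ball_ne_top : ∀ c r, ∫⁻ x in ball c r, W x ^ (-(q - 1)⁻¹) ≠ ∞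
  const_ne_top : C ≠ ∞
  bound : ∀ (c : E n) (r : ℝ), 0 < r → (∫⁻ x in ball c r, W x) *
    (∫⁻ x in ball c r, W x ^ (-(q - 1)⁻¹)) ^ (q - 1) ≤ C * volume (ball c r) ^ q

/-- Hölder's inequality for `1 = W^{1/q} W^{-1/q}`. It is the reverse of the `A_q` condition, and
valid on every set. -/
theorem volume_rpow_le_mul {q : ℝ} (hq : 1 < q) {W : E n → ℝ≥0∞} (hW : Measurable W)
    (h0 : ∀ x, W x ≠ 0) (htop : ∀ x, W x ≠ ∞) (A : Set (E n)) :
    volume A ^ q ≤ (∫⁻ x in A, W x) * (∫⁻ x in A, W x ^ (-(q - 1)⁻¹)) ^ (q - 1) := by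
  have hq0 : 0 < q := by linarith
  have hpq : q.HolderConjugate q.conjExponent := Real.HolderConjugate.conjExponent hq
  have h := ENNReal.lintegral_mul_le_Lp_mul_Lq (volume.restrict A) hpq
    (f := fun x => W x ^ q⁻¹) (g := fun x => W x ^ (-q⁻¹)) (by fun_prop) (by fun_prop)
  have e1 : ∀ x, ((fun x => W x ^ q⁻¹) * fun x => W x ^ (-q⁻¹)) x = 1 := fun x => by
    rw [Pi.mul_apply, ← ENNReal.rpow_add _ _ (h0 x) (htop x), add_neg_cancel, ENNReal.rpow_zero]
  have e2 : ∀ x, (W x ^ q⁻¹) ^ q = W x := fun x => by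
    rw [← ENNReal.rpow_mul, inv_mul_cancel₀ hq0.ne', ENNReal.rpow_one]
  have e3 : ∀ x, (W x ^ (-q⁻¹)) ^ q.conjExponent = W x ^ (-(q - 1)⁻¹) := fun x => by
    rw [← ENNReal.rpow_mul]
    congr 1
    have : q - 1 ≠ 0 := by linarith
    rw [Real.conjExponent]
    field_simp
  simp_rw [e1, e2, e3] at h
  rw [lintegral_one, Measure.restrict_apply_univ] at h
  refine (ENNReal.rpow_le_rpow h hq0.le).trans (le_of_eq ?_)
  rw [ENNReal.mul_rpow_of_nonneg _ _ hq0.le, ← ENNReal.rpow_mul, ← ENNReal.rpow_mul,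
    one_div_mul_cancel hq0.ne', ENNReal.rpow_one]
  congr 2
  have : q - 1 ≠ 0 := by linarith
  rw [Real.conjExponent]
  field_simp

variable {q : ℝ} {W : E n → ℝ≥0∞} {C : ℝ≥0∞}

/-- Hölder on `A` against the `A_q` condition on the ball: the dual integral over `A` is at most
that over the ball and cancels. With `A` a smaller ball this is doubling; with `A` a large portion
of a cube it carries the sparse estimate. -/
theorem IsApWeight.weight_ball_le (h : IsApWeight q W C) (hq : 1 < q) {c : E n} {r : ℝ}
    (hr : 0 < r) {A : Set (E n)} (hA : A ⊆ ball c r) {L : ℝ≥0∞}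
    (hL : volume (ball c r) ≤ L * volume A) :
    ∫⁻ x in ball c r, W x ≤ C * L ^ q * ∫⁻ x in A, W x := by
  have hq0 : 0 < q := by linarith
  have hA0 : volume A ≠ 0 := by
    intro h0
    rw [h0, mul_zero, nonpos_iff_eq_zero] at hL
    exact volume_ball_ne_zero c hr hL
  have hAt : volume A ≠ ∞ := ((measure_mono hA).trans_lt measure_ball_lt_top).ne
  refine (ENNReal.mul_le_mul_iff_left (c := volume A ^ q) ?_ ?_).1 ?_
  · exact (ENNReal.rpow_pos (pos_iff_ne_zero.2 hA0) hAt).ne'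
  · exact ENNReal.rpow_ne_top_of_nonneg hq0.le hAt
  calc (∫⁻ x in ball c r, W x) * volume A ^ q
      ≤ (∫⁻ x in ball c r, W x) *
          ((∫⁻ x in A, W x) * (∫⁻ x in ball c r, W x ^ (-(q - 1)⁻¹)) ^ (q - 1)) := by
        gcongr
        refine (volume_rpow_le_mul hq h.measurable h.ne_zero h.ne_top A).trans ?_
        gcongr
    _ = (∫⁻ x in A, W x) * ((∫⁻ x in ball c r, W x) *
          (∫⁻ x in ball c r, W x ^ (-(q - 1)⁻¹)) ^ (q - 1)) := by ring
    _ ≤ (∫⁻ x in A, W x) * (C * (L * volume A) ^ q) := by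
        refine mul_le_mul_right ((h.bound c r hr).trans ?_) _
        gcongr
    _ = C * L ^ q * (∫⁻ x in A, W x) * volume A ^ q := by
        rw [ENNReal.mul_rpow_of_nonneg _ _ hq0.le]; ring

/-- The same argument with the weight and its dual interchanged, carried out after raising to the
power `q - 1`. -/
theorem IsApWeight.dual_ball_le (h : IsApWeight q W C) (hq : 1 < q) {c : E n} {r : ℝ}
    (hr : 0 < r) {A : Set (E n)} (hA : A ⊆ ball c r) {L : ℝ≥0∞}
    (hL : volume (ball c r) ≤ L * volume A) :
    ∫⁻ x in ball c r, W x ^ (-(q - 1)⁻¹) ≤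
      (C * L ^ q) ^ (q - 1)⁻¹ * ∫⁻ x in A, W x ^ (-(q - 1)⁻¹) := by
  have hq0 : 0 < q := by linarith
  have hq1 : 0 < q - 1 := by linarith
  have hA0 : volume A ≠ 0 := by
    intro h0
    rw [h0, mul_zero, nonpos_iff_eq_zero] at hL
    exact volume_ball_ne_zero c hr hL
  have hAt : volume A ≠ ∞ := ((measure_mono hA).trans_lt measure_ball_lt_top).ne
  refine (ENNReal.rpow_le_rpow_iff hq1).1 ?_
  rw [ENNReal.mul_rpow_of_nonneg _ _ hq1.le, ← ENNReal.rpow_mul, inv_mul_cancel₀ hq1.ne',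
    ENNReal.rpow_one]
  refine (ENNReal.mul_le_mul_iff_left (c := volume A ^ q) ?_ ?_).1 ?_
  · exact (ENNReal.rpow_pos (pos_iff_ne_zero.2 hA0) hAt).ne'
  · exact ENNReal.rpow_ne_top_of_nonneg hq0.le hAt
  calc (∫⁻ x in ball c r, W x ^ (-(q - 1)⁻¹)) ^ (q - 1) * volume A ^ q
      ≤ (∫⁻ x in ball c r, W x ^ (-(q - 1)⁻¹)) ^ (q - 1) *
          ((∫⁻ x in ball c r, W x) * (∫⁻ x in A, W x ^ (-(q - 1)⁻¹)) ^ (q - 1)) := by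
        gcongr
        refine (volume_rpow_le_mul hq h.measurable h.ne_zero h.ne_top A).trans ?_
        gcongr
    _ = (∫⁻ x in A, W x ^ (-(q - 1)⁻¹)) ^ (q - 1) * ((∫⁻ x in ball c r, W x) *
          (∫⁻ x in ball c r, W x ^ (-(q - 1)⁻¹)) ^ (q - 1)) := by ring
    _ ≤ (∫⁻ x in A, W x ^ (-(q - 1)⁻¹)) ^ (q - 1) * (C * (L * volume A) ^ q) := by
        refine mul_le_mul_right ((h.bound c r hr).trans ?_) _
        gcongr
    _ = C * L ^ q * (∫⁻ x in A, W x ^ (-(q - 1)⁻¹)) ^ (q - 1) * volume A ^ q := by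
        rw [ENNReal.mul_rpow_of_nonneg _ _ hq0.le]; ring

theorem volume_ball_four_mul (c : E n) {r : ℝ} (hr : 0 < r) :
    volume (ball c (4 * r)) ≤ 4 ^ n * volume (ball c r) := by
  rw [volume_ball_mul c c (by norm_num) hr]
  norm_num

/-- The weight `W` satisfies the strong type maximal inequality with respect to itself. -/
theorem IsApWeight.exists_maxFn_weight (h : IsApWeight q W C) (hq : 1 < q) {p : ℝ} (hp : 1 < p) :
    ∃ K : ℝ≥0∞, K ≠ ∞ ∧ ∀ g : E n → ℝ≥0∞, Measurable g →
      ∫⁻ x, maxFn (volume.withDensity W) g x ^ p ∂(volume.withDensity W) ≤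
        K * ∫⁻ x, g x ^ p ∂(volume.withDensity W) := by
  refine ⟨_, ?_, fun g hg => lintegral_maxFn_rpow_le (D := C * (4 ^ n) ^ q) ?_ hg hp⟩
  · have := h.const_ne_top
    have : ((4 : ℝ≥0∞) ^ n) ^ q ≠ ∞ := ENNReal.rpow_ne_top_of_nonneg (by linarith) (by simp)
    have : (2 : ℝ≥0∞) ^ (p - 1) ≠ ∞ := ENNReal.rpow_ne_top_of_nonneg (by linarith) (by simp)
    finiteness
  · intro c r hr
    rw [withDensity_apply _ measurableSet_ball, withDensity_apply _ measurableSet_ball]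
    exact h.weight_ball_le hq (by linarith) (ball_subset_ball (by linarith))
      (volume_ball_four_mul c hr)

theorem IsApWeight.exists_maxFn_dual (h : IsApWeight q W C) (hq : 1 < q) {p : ℝ} (hp : 1 < p) :
    ∃ K : ℝ≥0∞, K ≠ ∞ ∧ ∀ g : E n → ℝ≥0∞, Measurable g →
      ∫⁻ x, maxFn (volume.withDensity fun x => W x ^ (-(q - 1)⁻¹)) g x ^ p
          ∂(volume.withDensity fun x => W x ^ (-(q - 1)⁻¹)) ≤
        K * ∫⁻ x, g x ^ p ∂(volume.withDensity fun x => W x ^ (-(q - 1)⁻¹)) := by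
  refine ⟨_, ?_, fun g hg => lintegral_maxFn_rpow_le (D := (C * (4 ^ n) ^ q) ^ (q - 1)⁻¹) ?_ hg hp⟩
  · have := h.const_ne_top
    have : ((4 : ℝ≥0∞) ^ n) ^ q ≠ ∞ := ENNReal.rpow_ne_top_of_nonneg (by linarith) (by simp)
    have : (2 : ℝ≥0∞) ^ (p - 1) ≠ ∞ := ENNReal.rpow_ne_top_of_nonneg (by linarith) (by simp)
    have : (C * (4 ^ n) ^ q) ^ (q - 1)⁻¹ ≠ ∞ :=
      ENNReal.rpow_ne_top_of_nonneg (inv_nonneg.2 (by linarith)) (by finiteness)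
    finiteness
  · intro c r hr
    rw [withDensity_apply _ measurableSet_ball, withDensity_apply _ measurableSet_ball]
    exact h.dual_ball_le hq (by linarith) (ball_subset_ball (by linarith))
      (volume_ball_four_mul c hr)

/-- The point where sparseness pays: because the sets are disjoint, the overlapping balls no longer
matter once averages have been replaced by infima of a maximal function over the sets. -/
theorem sum_iInf_rpow_mul_le {ι : Type*} {μ : Measure (E n)} (I : Finset ι) {A : ι → Set (E n)}
    (hA : ∀ i ∈ I, MeasurableSet (A i)) (hdisj : (I : Set ι).PairwiseDisjoint A)
    (X : E n → ℝ≥0∞) {p : ℝ} (hp : 0 ≤ p) :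
    ∑ i ∈ I, (⨅ x ∈ A i, X x) ^ p * μ (A i) ≤ ∫⁻ x, X x ^ p ∂μ := by
  calc ∑ i ∈ I, (⨅ x ∈ A i, X x) ^ p * μ (A i) ≤ ∑ i ∈ I, ∫⁻ x in A i, X x ^ p ∂μ := by
        refine Finset.sum_le_sum fun i hi => ?_
        rw [← setLIntegral_const]
        refine setLIntegral_mono' (hA i hi) fun x hx => ?_
        exact ENNReal.rpow_le_rpow (iInf₂_le x hx) hp
    _ = ∫⁻ x in ⋃ i ∈ I, A i, X x ^ p ∂μ := (lintegral_biUnion_finset hdisj hA _).symm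
    _ ≤ _ := setLIntegral_le_lintegral _ _

/-- With `v`, `σ`, `ω` the three measures of one ball, this is the price of passing to weighted
averages. As `1/r = q/p`, the power `σ^{1/r}` splits into `σ^{1/p}` and `σ^{(q-1)/p}`; the latter
joins `ω^{1/p}` to form the `A_q` product. -/
theorem sparse_coeff_le {q r p p' : ℝ} (hr : 0 < r) (hq : 1 < q) (hp : p = q * r)
    (hpp : p.HolderConjugate p') {v σ ω C : ℝ≥0∞} (hv : v ≠ 0) (hv' : v ≠ ∞)
    (h : ω * σ ^ (q - 1) ≤ C * v ^ q) :
    (v⁻¹ * σ) ^ r⁻¹ * ω ≤ C ^ p⁻¹ * (σ ^ p⁻¹ * ω ^ p'⁻¹) := by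
  have hp0 : 0 < p := hpp.pos
  have hp1 : 0 ≤ p⁻¹ := by positivity
  have hr1 : 0 ≤ r⁻¹ := by positivity
  have e1 : ω = ω ^ p⁻¹ * ω ^ p'⁻¹ := by
    rw [← ENNReal.rpow_add_of_nonneg _ _ hp1 (inv_nonneg.2 hpp.symm.pos.le),
      hpp.inv_add_inv_eq_one, ENNReal.rpow_one]
  have e2 : σ ^ r⁻¹ = σ ^ p⁻¹ * (σ ^ (q - 1)) ^ p⁻¹ := by
    rw [← ENNReal.rpow_mul, ← ENNReal.rpow_add_of_nonneg _ _ hp1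
      (mul_nonneg (by linarith) hp1)]
    congr 1
    rw [hp]
    field_simp
    ring
  calc (v⁻¹ * σ) ^ r⁻¹ * ω = (v⁻¹) ^ r⁻¹ * (σ ^ p⁻¹ * (σ ^ (q - 1)) ^ p⁻¹) *
        (ω ^ p⁻¹ * ω ^ p'⁻¹) := by
        rw [ENNReal.mul_rpow_of_nonneg _ _ hr1, e2, ← e1]
    _ = (v⁻¹) ^ r⁻¹ * (ω * σ ^ (q - 1)) ^ p⁻¹ * (σ ^ p⁻¹ * ω ^ p'⁻¹) := by
        rw [ENNReal.mul_rpow_of_nonneg _ _ hp1]; ring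
    _ ≤ (v⁻¹) ^ r⁻¹ * (C * v ^ q) ^ p⁻¹ * (σ ^ p⁻¹ * ω ^ p'⁻¹) := by gcongr
    _ = (v⁻¹) ^ r⁻¹ * v ^ r⁻¹ * (C ^ p⁻¹ * (σ ^ p⁻¹ * ω ^ p'⁻¹)) := by
        rw [ENNReal.mul_rpow_of_nonneg _ _ hp1, ← ENNReal.rpow_mul]
        have : q * p⁻¹ = r⁻¹ := by rw [hp]; field_simp
        rw [this]; ring
    _ = _ := by
        rw [← ENNReal.mul_rpow_of_nonneg _ _ hr1, ENNReal.inv_mul_cancel hv hv',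
          ENNReal.one_rpow, one_mul]

/-- Sparse operators built from `L^r` averages are bounded on `L^p(W)` if `W ∈ A_{p/r}`. -/
theorem IsApWeight.exists_sparse_bound (h : IsApWeight q W C) (hq : 1 < q) {r p : ℝ} (hr : 1 ≤ r)
    (hp : p = q * r) {L : ℝ≥0∞} (hL : L ≠ ∞) :
    ∃ K : ℝ≥0∞, K ≠ ∞ ∧ ∀ {ι : Type} (I : Finset ι) (c : ι → E n) (ρ : ι → ℝ)
      (A : ι → Set (E n)) (f : E n → ℝ≥0∞), Measurable f →
      (∀ i ∈ I, 0 < ρ i ∧ MeasurableSet (A i) ∧ A i ⊆ ball (c i) (ρ i) ∧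
        volume (ball (c i) (ρ i)) ≤ L * volume (A i) ∧
        ∫⁻ x in ball (c i) (ρ i), f x ^ r ≠ ∞) →
      (I : Set ι).PairwiseDisjoint A →
      ∫⁻ x, (∑ i ∈ I, (ball (c i) (ρ i)).indicator (fun _ =>
        ((volume (ball (c i) (ρ i)))⁻¹ * ∫⁻ y in ball (c i) (ρ i), f y ^ r) ^ r⁻¹) x) ^ p * W x ≤
        K * ∫⁻ x, f x ^ p * W x := by
  have hr0 : 0 < r := by linarith
  have hp1 : 1 < p := by nlinarith
  have hp0 : 0 < p := by linarith
  set p' := p.conjExponent with hp'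
  have hpp : p.HolderConjugate p' := Real.HolderConjugate.conjExponent hp1
  obtain ⟨K₁, hK₁, hmax₁⟩ := h.exists_maxFn_weight hq hpp.symm.lt
  obtain ⟨K₂, hK₂, hmax₂⟩ := h.exists_maxFn_dual hq hq
  set S : E n → ℝ≥0∞ := fun x => W x ^ (-(q - 1)⁻¹) with hS
  have hSm : Measurable S := h.measurable.pow_const _
  have hS0 : ∀ x, S x ≠ 0 := fun x =>
    (ENNReal.rpow_pos (pos_iff_ne_zero.2 (h.ne_zero x)) (h.ne_top x)).ne'
  have hSt : ∀ x, S x ≠ ∞ := fun x => by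
    simp [S, ENNReal.rpow_eq_top_iff, h.ne_zero x, h.ne_top x]
  set ω := volume.withDensity W with hω
  set σ := volume.withDensity S with hσ
  set M : ℝ≥0∞ := C ^ p⁻¹ * (((C * L ^ q) ^ (q - 1)⁻¹) ^ p⁻¹ * (C * L ^ q) ^ p'⁻¹) *
    (K₂ ^ p⁻¹ * K₁ ^ p'⁻¹) with hM
  have hpi : 0 ≤ p⁻¹ := inv_nonneg.2 hp0.le
  have hpi' : 0 ≤ p'⁻¹ := inv_nonneg.2 hpp.symm.pos.le
  have hMt : M ≠ ∞ := by
    have h1 : C * L ^ q ≠ ∞ :=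
      ENNReal.mul_ne_top h.const_ne_top (ENNReal.rpow_ne_top_of_nonneg (by linarith) hL)
    have h2 := ENNReal.rpow_ne_top_of_nonneg hpi
      (ENNReal.rpow_ne_top_of_nonneg (inv_nonneg.2 (by linarith : (0 : ℝ) ≤ q - 1)) h1)
    have h3 := ENNReal.rpow_ne_top_of_nonneg hpi' h1
    have h4 := ENNReal.rpow_ne_top_of_nonneg hpi h.const_ne_top
    have h5 := ENNReal.rpow_ne_top_of_nonneg hpi hK₂
    have h6 := ENNReal.rpow_ne_top_of_nonneg hpi' hK₁
    exact ENNReal.mul_ne_top (ENNReal.mul_ne_top h4 (ENNReal.mul_ne_top h2 h3))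
      (ENNReal.mul_ne_top h5 h6)
  refine ⟨M ^ p, ENNReal.rpow_ne_top_of_nonneg hp0.le hMt, ?_⟩
  intro ι I c ρ A f hf hI hdisj
  set B : ι → Set (E n) := fun i => ball (c i) (ρ i) with hB
  set α : ι → ℝ≥0∞ := fun i => ((volume (B i))⁻¹ * ∫⁻ y in B i, f y ^ r) ^ r⁻¹ with hα
  set F : E n → ℝ≥0∞ := fun x => ∑ i ∈ I, (B i).indicator (fun _ => α i) x with hF
  have hFm : Measurable F := Finset.measurable_fun_sum I fun i _ =>
    measurable_const.indicator measurableSet_ball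
  set H := ∫⁻ x, F x ^ p * W x with hH
  set N := ∫⁻ x, f x ^ p * W x with hN
  have hαt : ∀ i ∈ I, α i ≠ ∞ := fun i hi =>
    ENNReal.rpow_ne_top_of_nonneg (inv_nonneg.2 hr0.le) (ENNReal.mul_ne_top
      (ENNReal.inv_ne_top.2 (volume_ball_ne_zero _ (hI i hi).1)) (hI i hi).2.2.2.2)
  -- Finiteness of `H` is needed for dividing by `H^{1/p'}` at the end. It holds because `F` is
  -- bounded and lives on finitely many balls.
  have hHt : H ≠ ∞ := by
    have hle : H ≤ ∑ i ∈ I, (∑ i ∈ I, α i) ^ p * ∫⁻ x in B i, W x := by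
      calc H ≤ ∫⁻ x, ∑ i ∈ I, (B i).indicator (fun x => (∑ i ∈ I, α i) ^ p * W x) x := by
            refine lintegral_mono fun x => ?_
            by_cases hx : ∃ i ∈ I, x ∈ B i
            · obtain ⟨i, hi, hxi⟩ := hx
              refine le_trans ?_ (Finset.single_le_sum (fun _ _ => zero_le) hi)
              rw [indicator_of_mem hxi]
              refine mul_le_mul_left (ENNReal.rpow_le_rpow (Finset.sum_le_sum fun j _ => ?_) hp0.le) _
              exact indicator_apply_le' (fun _ => le_rfl) fun _ => zero_le
            · have : F x = 0 := Finset.sum_eq_zero fun i hi => indicator_of_notMem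
                (fun hxi => hx ⟨i, hi, hxi⟩) _
              simp [this, ENNReal.zero_rpow_of_pos hp0]
        _ = _ := by
            rw [lintegral_finsetSum _ fun i _ =>
              (h.measurable.const_mul _).indicator measurableSet_ball]
            refine Finset.sum_congr rfl fun i _ => ?_
            rw [lintegral_indicator measurableSet_ball, lintegral_const_mul _ h.measurable]
    refine ne_top_of_le_ne_top (ENNReal.sum_ne_top.2 fun i hi => ENNReal.mul_ne_top
      (ENNReal.rpow_ne_top_of_nonneg hp0.le (ENNReal.sum_ne_top.2 hαt)) (h.ball_ne_top _ _)) hle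
  -- The extremal dual function: `F * g = F^p` and `g^{p'} = F^p`.
  set g : E n → ℝ≥0∞ := fun x => F x ^ (p - 1) with hg
  have hgm : Measurable g := hFm.pow_const _
  have hgF : ∀ x, g x ^ p' = F x ^ p := fun x => by
    rw [hg, ← ENNReal.rpow_mul]
    congr 1
    rw [hp', Real.conjExponent]
    have : p - 1 ≠ 0 := by linarith
    field_simp
  -- Chosen so that the Lebesgue integral of `f^r` is the `σ`-integral of `u`, while `u^q σ = f^p
  -- W`.
  set u : E n → ℝ≥0∞ := fun x => f x ^ r * (S x)⁻¹ with hu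
  have hum : Measurable u := by fun_prop
  set X := maxFn σ u with hX
  set Y := maxFn ω g with hY
  have hXint : ∫⁻ x, X x ^ q ∂σ ≤ K₂ * N := by
    refine (hmax₂ u hum).trans (mul_le_mul_right (le_of_eq ?_) _)
    rw [lintegral_withDensity_eq_lintegral_mul _ hSm (hum.pow_const _)]
    refine lintegral_congr fun x => ?_
    have e1 : W x = S x * (S x)⁻¹ ^ q := by
      rw [ENNReal.inv_rpow, ← ENNReal.rpow_neg]
      nth_rewrite 1 [← ENNReal.rpow_one (S x)]
      rw [← ENNReal.rpow_add _ _ (hS0 x) (hSt x), hS, ← ENNReal.rpow_mul]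
      have : -(q - 1)⁻¹ * (1 + -q) = 1 := by
        have : q - 1 ≠ 0 := by linarith
        field_simp
        ring
      rw [this, ENNReal.rpow_one]
    rw [Pi.mul_apply, ENNReal.mul_rpow_of_nonneg _ _ (by linarith), ← ENNReal.rpow_mul,
      mul_comm r q, ← hp, mul_left_comm, ← e1]
  have hYint : ∫⁻ x, Y x ^ p' ∂ω ≤ K₁ * H := by
    refine (hmax₁ g hgm).trans (mul_le_mul_right (le_of_eq ?_) _)
    rw [lintegral_withDensity_eq_lintegral_mul _ h.measurable (hgm.pow_const _)]
    refine lintegral_congr fun x => ?_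
    rw [Pi.mul_apply, hgF, mul_comm]
  have hωB : ∀ s, MeasurableSet s → ω s = ∫⁻ x in s, W x := fun s hs => withDensity_apply _ hs
  have hσB : ∀ s, MeasurableSet s → σ s = ∫⁻ x in s, S x := fun s hs => withDensity_apply _ hs
  have hposW : ∀ i ∈ I, ω (B i) ≠ 0 ∧ σ (B i) ≠ 0 := by
    intro i hi
    have key := volume_rpow_le_mul hq h.measurable h.ne_zero h.ne_top (B i)
    have hpos : 0 < volume (B i) ^ q := ENNReal.rpow_pos
      (measure_ball_pos _ _ (hI i hi).1) (volume_ball_ne_top _ _)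
    rw [hωB _ measurableSet_ball, hσB _ measurableSet_ball]
    constructor
    · intro h0
      rw [h0, zero_mul] at key
      exact absurd key (not_le.2 hpos)
    · intro h0
      rw [h0, ENNReal.zero_rpow_of_pos (by linarith), mul_zero] at key
      exact absurd key (not_le.2 hpos)
  have hterm : ∀ i ∈ I, α i * ∫⁻ x in B i, g x * W x ≤
      C ^ p⁻¹ * (((C * L ^ q) ^ (q - 1)⁻¹) ^ p⁻¹ * (C * L ^ q) ^ p'⁻¹) *
      (((⨅ x ∈ A i, X x) ^ q * σ (A i)) ^ p⁻¹ * ((⨅ x ∈ A i, Y x) ^ p' * ω (A i)) ^ p'⁻¹) := by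
    intro i hi
    obtain ⟨hρ, hAm, hAB, hvol, -⟩ := hI i hi
    have hσt : σ (B i) ≠ ∞ := by
      rw [hσB _ measurableSet_ball]; exact h.dual_ball_ne_top _ _
    have hωt : ω (B i) ≠ ∞ := by
      rw [hωB _ measurableSet_ball]; exact h.ball_ne_top _ _
    have h1 : ∫⁻ y in B i, f y ^ r ≤ σ (B i) * ⨅ x ∈ A i, X x := by
      have e : ∫⁻ y in B i, f y ^ r = ∫⁻ y in B i, u y ∂σ := by
        rw [hσ, setLIntegral_withDensity_eq_setLIntegral_mul _ hSm hum measurableSet_ball]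
        refine lintegral_congr fun x => ?_
        rw [Pi.mul_apply, mul_left_comm, ENNReal.mul_inv_cancel (hS0 x) (hSt x), mul_one]
      rw [e]
      calc ∫⁻ y in B i, u y ∂σ = σ (B i) * ((σ (B i))⁻¹ * ∫⁻ y in B i, u y ∂σ) := by
            rw [← mul_assoc, ENNReal.mul_inv_cancel (hposW i hi).2 hσt, one_mul]
        _ ≤ _ := by
            gcongr
            exact le_iInf₂ fun x hx => avg_le_maxFn (hAB hx)
    have h2 : ∫⁻ x in B i, g x * W x ≤ ω (B i) * ⨅ x ∈ A i, Y x := by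
      have e : ∫⁻ x in B i, g x * W x = ∫⁻ y in B i, g y ∂ω := by
        rw [hω, setLIntegral_withDensity_eq_setLIntegral_mul _ h.measurable hgm measurableSet_ball]
        exact lintegral_congr fun x => mul_comm _ _
      rw [e]
      calc ∫⁻ y in B i, g y ∂ω = ω (B i) * ((ω (B i))⁻¹ * ∫⁻ y in B i, g y ∂ω) := by
            rw [← mul_assoc, ENNReal.mul_inv_cancel (hposW i hi).1 hωt, one_mul]
        _ ≤ _ := by
            gcongr
            exact le_iInf₂ fun x hx => avg_le_maxFn (hAB hx)
    have h3 : ω (B i) * σ (B i) ^ (q - 1) ≤ C * volume (B i) ^ q := by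
      rw [hωB _ measurableSet_ball, hσB _ measurableSet_ball]
      exact h.bound _ _ hρ
    have h4 : σ (B i) ≤ (C * L ^ q) ^ (q - 1)⁻¹ * σ (A i) := by
      rw [hσB _ measurableSet_ball, hσB _ hAm]
      exact h.dual_ball_le hq hρ hAB hvol
    have h5 : ω (B i) ≤ C * L ^ q * ω (A i) := by
      rw [hωB _ measurableSet_ball, hωB _ hAm]
      exact h.weight_ball_le hq hρ hAB hvol
    have hri : 0 ≤ r⁻¹ := inv_nonneg.2 hr0.le
    have e1 : (⨅ x ∈ A i, X x) ^ r⁻¹ = ((⨅ x ∈ A i, X x) ^ q) ^ p⁻¹ := by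
      rw [← ENNReal.rpow_mul]
      congr 1
      rw [hp]
      field_simp
    have e2 : (⨅ x ∈ A i, Y x) = ((⨅ x ∈ A i, Y x) ^ p') ^ p'⁻¹ := by
      rw [← ENNReal.rpow_mul, mul_inv_cancel₀ hpp.symm.pos.ne', ENNReal.rpow_one]
    calc α i * ∫⁻ x in B i, g x * W x
        ≤ ((volume (B i))⁻¹ * (σ (B i) * ⨅ x ∈ A i, X x)) ^ r⁻¹ *
          (ω (B i) * ⨅ x ∈ A i, Y x) :=
          mul_le_mul' (ENNReal.rpow_le_rpow (mul_le_mul_right h1 _) hri) h2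
      _ = (((volume (B i))⁻¹ * σ (B i)) ^ r⁻¹ * ω (B i)) *
          ((⨅ x ∈ A i, X x) ^ r⁻¹ * ⨅ x ∈ A i, Y x) := by
          rw [← mul_assoc (volume (B i))⁻¹, ENNReal.mul_rpow_of_nonneg _ (⨅ x ∈ A i, X x) hri]; ring
      _ ≤ (C ^ p⁻¹ * (σ (B i) ^ p⁻¹ * ω (B i) ^ p'⁻¹)) *
          ((⨅ x ∈ A i, X x) ^ r⁻¹ * ⨅ x ∈ A i, Y x) := by
          refine mul_le_mul_left ?_ _
          exact sparse_coeff_le hr0 hq hp hpp (volume_ball_ne_zero _ hρ) (volume_ball_ne_top _ _) h3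
      _ ≤ (C ^ p⁻¹ * (((C * L ^ q) ^ (q - 1)⁻¹ * σ (A i)) ^ p⁻¹ *
          (C * L ^ q * ω (A i)) ^ p'⁻¹)) *
          ((⨅ x ∈ A i, X x) ^ r⁻¹ * ⨅ x ∈ A i, Y x) := by
          gcongr
      _ = _ := by
          rw [e1]
          nth_rewrite 1 [e2]
          rw [ENNReal.mul_rpow_of_nonneg _ (σ (A i)) hpi, ENNReal.mul_rpow_of_nonneg _ (ω (A i)) hpi',
            ENNReal.mul_rpow_of_nonneg _ (σ (A i)) hpi, ENNReal.mul_rpow_of_nonneg _ (ω (A i)) hpi']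
          ring
  have hsplit : H = ∑ i ∈ I, α i * ∫⁻ x in B i, g x * W x := by
    have hgW : Measurable fun x => g x * W x := hgm.mul h.measurable
    calc H = ∫⁻ x, ∑ i ∈ I, (B i).indicator (fun x => α i * (g x * W x)) x := by
          refine lintegral_congr fun x => ?_
          have : F x ^ p = F x * g x := by
            rw [hg]
            nth_rewrite 2 [← ENNReal.rpow_one (F x)]
            rw [← ENNReal.rpow_add_of_nonneg _ _ zero_le_one (by linarith)]
            congr 1; ring
          rw [this, hF, mul_assoc, Finset.sum_mul]
          refine Finset.sum_congr rfl fun i _ => ?_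
          by_cases hx : x ∈ B i <;> simp [hx]
      _ = _ := by
          rw [lintegral_finsetSum _ fun i _ => (hgW.const_mul _).indicator measurableSet_ball]
          refine Finset.sum_congr rfl fun i _ => ?_
          rw [lintegral_indicator measurableSet_ball, lintegral_const_mul _ hgW]
  -- Hölder for the sum over balls, with one maximal function in each factor; `H` reappears on the
  -- right through the norm of `g`.
  have hmain : H ≤ M * (N ^ p⁻¹ * H ^ p'⁻¹) := by
    calc H = ∑ i ∈ I, α i * ∫⁻ x in B i, g x * W x := hsplit
      _ ≤ ∑ i ∈ I, C ^ p⁻¹ * (((C * L ^ q) ^ (q - 1)⁻¹) ^ p⁻¹ * (C * L ^ q) ^ p'⁻¹) *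
        (((⨅ x ∈ A i, X x) ^ q * σ (A i)) ^ p⁻¹ *
          ((⨅ x ∈ A i, Y x) ^ p' * ω (A i)) ^ p'⁻¹) := Finset.sum_le_sum hterm
      _ = C ^ p⁻¹ * (((C * L ^ q) ^ (q - 1)⁻¹) ^ p⁻¹ * (C * L ^ q) ^ p'⁻¹) *
        ∑ i ∈ I, ((⨅ x ∈ A i, X x) ^ q * σ (A i)) ^ p⁻¹ *
          ((⨅ x ∈ A i, Y x) ^ p' * ω (A i)) ^ p'⁻¹ := by rw [Finset.mul_sum]
      _ ≤ C ^ p⁻¹ * (((C * L ^ q) ^ (q - 1)⁻¹) ^ p⁻¹ * (C * L ^ q) ^ p'⁻¹) *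
        ((K₂ * N) ^ p⁻¹ * (K₁ * H) ^ p'⁻¹) := by
          gcongr
          refine (ENNReal.inner_le_Lp_mul_Lq I _ _ hpp).trans ?_
          simp_rw [← ENNReal.rpow_mul, inv_mul_cancel₀ hp0.ne', inv_mul_cancel₀ hpp.symm.pos.ne',
            ENNReal.rpow_one, one_div]
          gcongr
          · exact (sum_iInf_rpow_mul_le I (fun i hi => (hI i hi).2.1) hdisj X
              (by linarith)).trans hXint
          · exact (sum_iInf_rpow_mul_le I (fun i hi => (hI i hi).2.1) hdisj Y
              hpp.symm.pos.le).trans hYint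
      _ = _ := by
          rw [ENNReal.mul_rpow_of_nonneg K₂ N hpi, ENNReal.mul_rpow_of_nonneg K₁ H hpi', hM]
          ring
  rcases eq_or_ne H 0 with h0 | h0
  · rw [h0]; exact zero_le
  have hfin : H ^ p⁻¹ ≤ M * N ^ p⁻¹ := by
    have hc0 : H ^ p'⁻¹ ≠ 0 := (ENNReal.rpow_pos (pos_iff_ne_zero.2 h0) hHt).ne'
    have hct : H ^ p'⁻¹ ≠ ∞ := ENNReal.rpow_ne_top_of_nonneg hpi' hHt
    refine (ENNReal.mul_le_mul_iff_left hc0 hct).1 ?_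
    rw [← ENNReal.rpow_add_of_nonneg _ _ hpi hpi', hpp.inv_add_inv_eq_one, ENNReal.rpow_one,
      mul_assoc]
    exact hmain
  calc H = (H ^ p⁻¹) ^ p := by
        rw [← ENNReal.rpow_mul, inv_mul_cancel₀ hp0.ne', ENNReal.rpow_one]
    _ ≤ (M * N ^ p⁻¹) ^ p := ENNReal.rpow_le_rpow hfin hp0.le
    _ = M ^ p * N := by
        rw [ENNReal.mul_rpow_of_nonneg _ _ hp0.le, ← ENNReal.rpow_mul, inv_mul_cancel₀ hp0.ne',
          ENNReal.rpow_one]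

end CZO

/-! ### The sup condition -/

namespace CZO

open Set Filter Topology

variable {n : ℕ}

/-- Since `A^{1/2} K ≤ A/2 + K²/2`, half of `A` can be absorbed on the left, which is legitimate
only for finite `A`. -/
theorem le_sq_add_of_le_sqrt_mul {A K c : ℝ≥0∞} (hA : A ≠ ∞)
    (h : A ≤ A ^ (1 / 2 : ℝ) * K + c) : A ≤ K ^ 2 + 2 * c := by
  rcases eq_or_ne K ∞ with rfl | hK
  · simp
  rcases eq_or_ne c ∞ with rfl | hc
  · simp
  set a := A ^ (1 / 2 : ℝ) with ha
  have ha2 : A = a ^ 2 := by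
    rw [ha, ← ENNReal.rpow_natCast, ← ENNReal.rpow_mul]; norm_num
  have hat : a ≠ ∞ := ENNReal.rpow_ne_top_of_nonneg (by norm_num) hA
  rw [ha2] at h ⊢
  clear_value a
  lift a to ℝ≥0 using hat
  lift K to ℝ≥0 using hK
  lift c to ℝ≥0 using hc
  norm_cast at h ⊢
  have h' : (a : ℝ) ^ 2 ≤ a * K + c := by exact_mod_cast h
  have : (a : ℝ) ^ 2 ≤ K ^ 2 + 2 * c := by nlinarith [sq_nonneg ((a : ℝ) - K)]
  exact_mod_cast this

/-- A local sup bound by `L¹` averages improves to a bound by `L^{1/2}` averages. -/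
theorem essSup_le_avg_sqrt {G : E n → ℝ≥0∞} (hG : Measurable G) {c : E n} {r : ℝ} (hr : 0 < r)
    (hint : ∫⁻ x in ball c (2 * r), G x ≠ ∞) {C m : ℝ≥0∞} (hC : C ≠ ∞) (hm : m ≠ ∞)
    (h : ∀ (x : E n) (δ : ℝ), 0 < δ → ball x (4 * δ) ⊆ ball c (2 * r) →
      x ∈ ball c (3 / 2 * r) →
      essSup G (volume.restrict (ball x δ)) ≤
        C * ((volume (ball x (2 * δ)))⁻¹ * ∫⁻ y in ball x (2 * δ), G y) + C * m) :
    essSup G (volume.restrict (ball c r)) ≤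
      4 ^ n * ((C * 8 ^ n) ^ 2 + 2 * C) * (((volume (ball c (2 * r)))⁻¹ *
        ∫⁻ y in ball c (2 * r), G y ^ (1 / 2 : ℝ)) ^ 2 + m) := by
  set v := volume (ball c r) with hv
  have hv0 : v ≠ 0 := volume_ball_ne_zero c hr
  have hvt : v ≠ ∞ := volume_ball_ne_top c r
  -- The parameter `a` is the distance, in units of `r`, to the sphere of radius `3r/2`. Balls of
  -- radius `a r / 4` bound `Φ a` by an integral over the ball belonging to `a / 2`, with a loss of
  -- order `a^{-n}`.
  set Φ : ℝ → ℝ≥0∞ := fun a => essSup G (volume.restrict (ball c ((3 / 2 - a) * r))) with hΦ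
  set J := ∫⁻ y in ball c (2 * r), G y ^ (1 / 2 : ℝ) with hJ
  have step1 : ∀ a : ℝ, 0 < a → a ≤ 1 / 2 → Φ a ≤
      C * ((ENNReal.ofReal (a / 2) ^ n * v)⁻¹ * ∫⁻ y in ball c ((3 / 2 - a / 2) * r), G y)
        + C * m := by
    intro a ha ha2
    set K := C * ((ENNReal.ofReal (a / 2) ^ n * v)⁻¹ *
      ∫⁻ y in ball c ((3 / 2 - a / 2) * r), G y) + C * m with hK
    refine essSup_le_of_ae_le K ?_
    rw [EventuallyLE, ae_restrict_iff' measurableSet_ball, ae_iff]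
    -- An essential bound is a local property, so it suffices to have it on a small ball around each
    -- point.
    refine measure_null_of_locally_null _ fun x hx => ?_
    simp only [mem_ofPred_eq, Classical.not_imp, not_le] at hx
    have hxd : dist x c < (3 / 2 - a) * r := hx.1
    have har : 0 < a * r := mul_pos ha hr
    have hb := h x (a / 4 * r) (by positivity) (ball_subset_ball' (by nlinarith))
      (mem_ball.2 (by nlinarith))
    refine ⟨_, inter_mem_nhdsWithin _ (ball_mem_nhds x (show 0 < a / 4 * r by positivity)), ?_⟩
    have hle : essSup G (volume.restrict (ball x (a / 4 * r))) ≤ K := by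
      refine hb.trans ?_
      rw [show 2 * (a / 4 * r) = a / 2 * r by ring, volume_ball_mul x c (by positivity) hr, hK]
      gcongr
      exact ball_subset_ball' (by nlinarith)
    have hae : ∀ᵐ y ∂volume.restrict (ball x (a / 4 * r)), G y ≤ K := by
      filter_upwards [ae_le_essSup (f := G) (μ := volume.restrict (ball x (a / 4 * r)))] with y hy
      exact hy.trans hle
    rw [ae_restrict_iff' measurableSet_ball, ae_iff] at hae
    refine measure_mono_null (fun y hy => ?_) hae
    simp only [mem_inter_iff, mem_ofPred_eq, Classical.not_imp, not_le] at hy ⊢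
    exact ⟨hy.2, hy.1.2⟩
  have hsub : ∀ a : ℝ, 0 < a → ball c ((3 / 2 - a) * r) ⊆ ball c (2 * r) := fun a ha =>
    ball_subset_ball (by nlinarith)
  have hinv : ∀ a : ℝ, 0 < a → ENNReal.ofReal a ^ n * (ENNReal.ofReal (a / 2) ^ n * v)⁻¹ =
      2 ^ n * v⁻¹ := by
    intro a ha
    have h0 : ENNReal.ofReal (a / 2) ≠ 0 := by simpa using (by positivity : 0 < a / 2)
    rw [ENNReal.mul_inv (Or.inr hvt) (Or.inr hv0)]
    nth_rewrite 1 [show a = 2 * (a / 2) by ring]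
    rw [ENNReal.ofReal_mul (by norm_num), mul_pow, ENNReal.ofReal_ofNat,
      mul_assoc, ← mul_assoc (ENNReal.ofReal (a / 2) ^ n), ENNReal.mul_inv_cancel
      (pow_ne_zero _ h0) (ENNReal.pow_ne_top ENNReal.ofReal_ne_top), one_mul]
  have hpow1 : ∀ a : ℝ, a ≤ 1 / 2 → ∀ k : ℕ, ENNReal.ofReal a ^ k ≤ 1 := fun a ha k =>
    pow_le_one' (ENNReal.ofReal_le_one.2 (by linarith)) k
  -- In the weight `a^{2n}` one factor `a^n` cancels the loss in `step1`; the other turns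
  -- `Φ(a/2)^{1/2}` into at most `2^n A^{1/2}`. Local integrability of `G` makes `A` finite, so that
  -- it can be absorbed.
  set A := ⨆ a : Ioc (0 : ℝ) (1 / 2), ENNReal.ofReal a ^ (2 * n) * Φ a with hA
  have hAt : A ≠ ∞ := by
    have : A ≤ C * (2 ^ n * v⁻¹ * ∫⁻ y in ball c (2 * r), G y) + C * m := by
      refine iSup_le fun ⟨a, ha0, ha1⟩ => ?_
      calc ENNReal.ofReal a ^ (2 * n) * Φ a
          ≤ ENNReal.ofReal a ^ (2 * n) * (C * ((ENNReal.ofReal (a / 2) ^ n * v)⁻¹ *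
            ∫⁻ y in ball c (2 * r), G y) + C * m) := by
            refine mul_le_mul_right ((step1 a ha0 ha1).trans ?_) _
            gcongr
            linarith
        _ = ENNReal.ofReal a ^ n * (C * ((ENNReal.ofReal a ^ n *
            (ENNReal.ofReal (a / 2) ^ n * v)⁻¹) * ∫⁻ y in ball c (2 * r), G y))
            + ENNReal.ofReal a ^ (2 * n) * (C * m) := by
            rw [two_mul, pow_add]; ring
        _ ≤ 1 * (C * ((2 ^ n * v⁻¹) * ∫⁻ y in ball c (2 * r), G y)) + 1 * (C * m) := by
            rw [hinv a ha0]
            gcongr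
            · exact hpow1 a ha1 _
            · exact hpow1 a ha1 _
        _ = _ := by rw [one_mul, one_mul]
    refine ne_top_of_le_ne_top ?_ this
    have : v⁻¹ ≠ ∞ := ENNReal.inv_ne_top.2 hv0
    finiteness
  have hmain : A ≤ A ^ (1 / 2 : ℝ) * (C * 4 ^ n * (v⁻¹ * J)) + C * m := by
    refine iSup_le fun ⟨a, ha0, ha1⟩ => ?_
    have hint2 : ∫⁻ y in ball c ((3 / 2 - a / 2) * r), G y ≤ Φ (a / 2) ^ (1 / 2 : ℝ) * J := by
      calc ∫⁻ y in ball c ((3 / 2 - a / 2) * r), G y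
          ≤ ∫⁻ y in ball c ((3 / 2 - a / 2) * r),
            Φ (a / 2) ^ (1 / 2 : ℝ) * G y ^ (1 / 2 : ℝ) := by
            refine lintegral_mono_ae ?_
            filter_upwards [ae_le_essSup (f := G)
              (μ := volume.restrict (ball c ((3 / 2 - a / 2) * r)))] with y hy
            calc G y = G y ^ (1 / 2 : ℝ) * G y ^ (1 / 2 : ℝ) := by
                  rw [← ENNReal.rpow_add_of_nonneg _ _ (by norm_num) (by norm_num)]
                  norm_num
              _ ≤ _ := by gcongr
        _ = Φ (a / 2) ^ (1 / 2 : ℝ) * ∫⁻ y in ball c ((3 / 2 - a / 2) * r), G y ^ (1 / 2 : ℝ) :=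
            lintegral_const_mul _ (by fun_prop)
        _ ≤ _ := by
            exact mul_le_mul_right (lintegral_mono_set (hsub (a / 2) (by positivity))) _
    have hroot : ENNReal.ofReal a ^ n * Φ (a / 2) ^ (1 / 2 : ℝ) ≤ 2 ^ n * A ^ (1 / 2 : ℝ) := by
      have h1 : ENNReal.ofReal (a / 2) ^ (2 * n) * Φ (a / 2) ≤ A :=
        le_iSup (fun a : Ioc (0 : ℝ) (1 / 2) => ENNReal.ofReal a ^ (2 * n) * Φ a)
          ⟨a / 2, by positivity, by linarith⟩
      have h2 := ENNReal.rpow_le_rpow h1 (by norm_num : (0 : ℝ) ≤ 1 / 2)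
      rw [ENNReal.mul_rpow_of_nonneg _ _ (by norm_num), pow_mul', ← ENNReal.rpow_natCast _ 2,
        ← ENNReal.rpow_mul] at h2
      norm_num at h2
      nth_rewrite 1 [show a = 2 * (a / 2) by ring]
      rw [ENNReal.ofReal_mul (by norm_num), mul_pow, ENNReal.ofReal_ofNat, mul_assoc]
      norm_num
      gcongr
    calc ENNReal.ofReal a ^ (2 * n) * Φ a
        ≤ ENNReal.ofReal a ^ (2 * n) * (C * ((ENNReal.ofReal (a / 2) ^ n * v)⁻¹ *
          (Φ (a / 2) ^ (1 / 2 : ℝ) * J)) + C * m) := by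
          refine mul_le_mul_right ((step1 a ha0 ha1).trans ?_) _
          gcongr
      _ = (ENNReal.ofReal a ^ n * Φ (a / 2) ^ (1 / 2 : ℝ)) * (C * ((ENNReal.ofReal a ^ n *
            (ENNReal.ofReal (a / 2) ^ n * v)⁻¹) * J)) + ENNReal.ofReal a ^ (2 * n) * (C * m) := by
          rw [two_mul, pow_add]; ring
      _ ≤ (2 ^ n * A ^ (1 / 2 : ℝ)) * (C * ((2 ^ n * v⁻¹) * J)) + 1 * (C * m) := by
          rw [hinv a ha0]
          gcongr
          exact hpow1 a ha1 _
      _ = _ := by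
          rw [show (4 : ℝ≥0∞) = 2 * 2 by norm_num, mul_pow]; ring
  have hA2 := le_sq_add_of_le_sqrt_mul hAt hmain
  have hΦA : essSup G (volume.restrict (ball c r)) ≤ 4 ^ n * A := by
    have h1 : ENNReal.ofReal (1 / 2) ^ (2 * n) * Φ (1 / 2) ≤ A :=
      le_iSup (fun a : Ioc (0 : ℝ) (1 / 2) => ENNReal.ofReal a ^ (2 * n) * Φ a)
        ⟨1 / 2, by norm_num, le_rfl⟩
    have h2 : Φ (1 / 2) = essSup G (volume.restrict (ball c r)) := by
      simp only [hΦ]; norm_num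
    have h3 : (4 : ℝ≥0∞) ^ n * ENNReal.ofReal (1 / 2) ^ (2 * n) = 1 := by
      rw [pow_mul, ← mul_pow, ← ENNReal.ofReal_pow (by norm_num), ← ENNReal.ofReal_ofNat,
        ← ENNReal.ofReal_mul (by norm_num)]
      norm_num
    rw [← h2, ← one_mul (Φ (1 / 2)), ← h3, mul_assoc]
    gcongr
  have hvJ : v⁻¹ * J = 2 ^ n * ((volume (ball c (2 * r)))⁻¹ * J) := by
    rw [volume_ball_mul c c (by norm_num) hr, ENNReal.mul_inv (Or.inr hvt) (Or.inr hv0),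
      ENNReal.ofReal_ofNat, ← mul_assoc, ← mul_assoc, ENNReal.mul_inv_cancel (by simp) (by simp),
      one_mul]
  calc essSup G (volume.restrict (ball c r)) ≤ 4 ^ n * A := hΦA
    _ ≤ 4 ^ n * ((C * 4 ^ n * (v⁻¹ * J)) ^ 2 + 2 * (C * m)) := by gcongr
    _ = 4 ^ n * ((C * 8 ^ n) ^ 2 * ((volume (ball c (2 * r)))⁻¹ * J) ^ 2 + 2 * C * m) := by
        rw [hvJ, show (8 : ℝ≥0∞) = 4 * 2 by norm_num, mul_pow 4 2 n]; ring
    _ ≤ 4 ^ n * (((C * 8 ^ n) ^ 2 + 2 * C) * ((volume (ball c (2 * r)))⁻¹ * J) ^ 2 +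
        ((C * 8 ^ n) ^ 2 + 2 * C) * m) := by
        gcongr
        · exact le_self_add
        · exact le_add_self
    _ = _ := by ring

/-- Away from the support of `f`, the maximal function of `f` is essentially constant. -/
theorem maxFn_le_of_ae_eq_zero {g : E n → ℝ≥0∞} {c : E n} {r : ℝ}
    (hg : ∀ᵐ x, x ∈ ball c (4 * r) → g x = 0) {x y : E n} (hx : x ∈ ball c (3 / 2 * r))
    (hy : y ∈ ball c r) : maxFn volume g x ≤ 3 ^ n * maxFn volume g y := by
  have hr : 0 < r := pos_of_mem_ball hy
  refine iSup_le fun z => iSup_le fun ρ => iSup_le fun hz => ?_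
  have hρ : 0 < ρ := pos_of_mem_ball hz
  by_cases hsub : ball z ρ ⊆ ball c (4 * r)
  · have : ∫⁻ y in ball z ρ, g y = 0 := by
      rw [setLIntegral_congr_fun_ae (g := fun _ => 0) measurableSet_ball, lintegral_zero]
      filter_upwards [hg] with y hy hyz
      exact hy (hsub hyz)
    rw [this, mul_zero]
    exact zero_le
  · obtain ⟨w, hw, hwc⟩ := not_subset.1 hsub
    rw [mem_ball] at hx hy hz hw
    rw [mem_ball, not_lt] at hwc
    have h1 : dist w c ≤ dist w z + dist x z + dist x c := by
      have := dist_triangle w z c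
      have := dist_triangle_left z c x
      linarith
    have h2 : dist y z ≤ dist y c + dist x c + dist x z := by
      have := dist_triangle y c z
      have := dist_triangle_left c z x
      linarith
    -- From `4r ≤ |w - c| < 2ρ + 3r/2` one gets `5r/2 < 2ρ`, hence `|y - z| < ρ + 5r/2 < 3ρ`.
    have hyz : y ∈ ball z (3 * ρ) := mem_ball.2 (by linarith)
    refine le_trans ?_ (mul_le_mul_right (avg_le_maxFn hyz) _)
    rw [volume_ball_mul z z (by norm_num) hρ, ENNReal.mul_inv
      (Or.inr (volume_ball_ne_top _ _)) (Or.inr (volume_ball_ne_zero _ hρ)),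
      ENNReal.ofReal_ofNat, ← mul_assoc, ← mul_assoc, ENNReal.mul_inv_cancel (by simp) (by simp),
      one_mul]
    gcongr
    linarith

variable {𝕜 : Type*} [RCLike 𝕜]

theorem measurable_enorm_Lp (f : Lp 𝕜 2 (volume : Measure (E n))) : Measurable fun x => ‖f x‖ₑ :=
  (Lp.stronglyMeasurable f).enorm

theorem setLIntegral_enorm_Lp_ne_top (f : Lp 𝕜 2 (volume : Measure (E n))) (c : E n) (r : ℝ) :
    ∫⁻ x in ball c r, ‖f x‖ₑ ≠ ∞ := by
  have : IsFiniteMeasure (volume.restrict (ball c r)) :=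
    isFiniteMeasure_restrict.2 (volume_ball_ne_top c r)
  exact (((Lp.memLp f).restrict (ball c r)).integrable (by norm_num)).hasFiniteIntegral.ne

theorem maxFn_ne_top_of_memLp_top {f : E n → 𝕜} (hf : MemLp f ∞ volume) (x : E n) :
    maxFn volume (fun y => ‖f y‖ₑ) x ≠ ∞ := by
  have h : ∀ᵐ y, ‖f y‖ₑ ≤ eLpNorm f ∞ volume := by
    rw [eLpNorm_exponent_top]; exact enorm_ae_le_eLpNormEssSup f volume
  exact ne_top_of_le_ne_top hf.2.ne ((maxFn_mono h x).trans (maxFn_const_le _ _ x))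

/-- The sup condition with an `L^{1/2}` average of `|Tf|`. -/
theorem SupCondition.exists_sqrt
    {T : Lp 𝕜 2 (volume : Measure (E n)) → Lp 𝕜 2 (volume : Measure (E n))}
    (hT : SupCondition T) :
    ∃ C : ℝ≥0∞, C ≠ ∞ ∧ ∀ (c : E n) (r : ℝ), 0 < r → ∀ f : Lp 𝕜 2 (volume : Measure (E n)),
      IsBoundedSupportedOn f (ball c (4 * r))ᶜ → (∃ R : ℝ, IsBoundedSupportedOn f (ball 0 R)) →
      essSup (fun x => ‖T f x‖ₑ) (volume.restrict (ball c r)) ≤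
        C * (((volume (ball c (2 * r)))⁻¹ *
          ∫⁻ x in ball c (2 * r), ‖T f x‖ₑ ^ (1 / 2 : ℝ)) ^ 2 +
          ⨅ x ∈ ball c r, maxFn volume (fun y => ‖f y‖ₑ) x) := by
  obtain ⟨C, hC⟩ := hT
  refine ⟨4 ^ n * (((C : ℝ≥0∞) * 8 ^ n) ^ 2 + 2 * C) * 3 ^ n, by finiteness, ?_⟩
  intro c r hr f hf hfR
  set m := ⨅ x ∈ ball c r, maxFn volume (fun y => ‖f y‖ₑ) x with hm
  have hfz : ∀ᵐ x, x ∈ ball c (4 * r) → ‖f x‖ₑ = 0 := by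
    filter_upwards [hf.2] with x hx hxb
    simp [hx (not_not.2 hxb)]
  have hmt : m ≠ ∞ := ne_top_of_le_ne_top (maxFn_ne_top_of_memLp_top hf.1 c)
    (iInf₂_le c (mem_ball_self hr))
  have key := essSup_le_avg_sqrt (measurable_enorm_Lp (T f)) hr
    (setLIntegral_enorm_Lp_ne_top (T f) c (2 * r)) (C := C) (m := 3 ^ n * m) (by simp)
    (ENNReal.mul_ne_top (by simp) hmt) ?_
  · refine key.trans ?_
    rw [mul_assoc _ (3 ^ n : ℝ≥0∞)]
    refine mul_le_mul_right ?_ _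
    rw [mul_add]
    gcongr
    exact le_mul_of_one_le_left' (one_le_pow₀ (by norm_num))
  · intro x δ hδ hsub hx
    -- The condition applies to the small balls because their fourfold enlargements stay inside the
    -- ball on which `f` vanishes.
    refine (hC x δ hδ f ⟨hf.1, ?_⟩ hfR).trans ?_
    · filter_upwards [hf.2] with y hy hyx
      refine hy fun hyc => hyc ?_
      rw [mem_compl_iff, not_not] at hyx
      exact ball_subset_ball (by linarith) (hsub hyx)
    · have h1 : ⨅ z ∈ ball x δ, maximalFunction f z ≤ 3 ^ n * m := by
        refine (iInf₂_le x (mem_ball_self hδ)).trans ?_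
        rw [hm, ENNReal.mul_iInf_of_ne (by simp) (by simp)]
        refine le_iInf fun y => ?_
        rw [ENNReal.mul_iInf_of_ne (by simp) (by simp)]
        exact le_iInf fun hy => maxFn_le_of_ae_eq_zero hfz hx hy
      exact add_le_add le_rfl (mul_le_mul_right h1 _)

end CZO

/-! ### Kolmogorov inequalities and restrictions -/

namespace CZO

open Set Filter Topology

variable {n : ℕ}

/-- The tail of a function in weak `L^r`. -/
theorem setLIntegral_sqrt_tail_le {G : E n → ℝ≥0∞} (hG : Measurable G) {r : ℝ} (hr : 1 ≤ r)
    {N : ℝ≥0∞} (hN : ∀ t : ℝ≥0∞, t ^ r * volume {x | t < G x} ≤ N) {s : ℝ≥0∞} (hs : s ≠ 0)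
    (hs' : s ≠ ∞) :
    ∫⁻ x in {x | s < G x}, G x ^ (1 / 2 : ℝ) ≤ 2 * s ^ (1 / 2 - r) * N := by
  have hset : MeasurableSet {x | s < G x} := measurableSet_lt measurable_const hG
  set F := {x | s < G x}.indicator G with hF
  have hFm : Measurable F := hG.indicator hset
  have hdist : ∀ t : ℝ≥0∞, t ≠ 0 → t ≠ ∞ → volume {x | t < G x} ≤ t ^ (-r) * N := by
    intro t h0 htop
    have h1 : t ^ (-r) * t ^ r = 1 := by
      rw [← ENNReal.rpow_add _ _ h0 htop, neg_add_cancel, ENNReal.rpow_zero]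
    calc volume {x | t < G x} = t ^ (-r) * (t ^ r * volume {x | t < G x}) := by
          rw [← mul_assoc, h1, one_mul]
      _ ≤ _ := by gcongr; exact hN t
  -- The distribution function of the tail is at most `N s^{-r}` for heights below `s` and at most
  -- `N t^{-r}` above.
  have hbound : ∀ t ∈ Ioi (0 : ℝ), ENNReal.ofReal t ^ (1 / 2 - 1 : ℝ) *
      volume {x | ENNReal.ofReal t < F x} ≤
      N * (s ^ (-r) * {t : ℝ | ENNReal.ofReal t < s}.indicator
        (fun t => ENNReal.ofReal t ^ (1 / 2 - 1 : ℝ)) t + {t : ℝ | s ≤ ENNReal.ofReal t}.indicator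
        (fun t => ENNReal.ofReal t ^ (-(r - 1 / 2) - 1)) t) := by
    intro t ht
    have ht0 : ENNReal.ofReal t ≠ 0 := by simpa using ht
    have hsub : {x | ENNReal.ofReal t < F x} ⊆ {x | s < G x} ∩ {x | ENNReal.ofReal t < G x} := by
      intro x hx
      by_cases hxs : s < G x
      · refine ⟨hxs, ?_⟩
        simpa [F, indicator, hxs] using hx
      · simp [F, indicator, hxs] at hx
    by_cases hts : ENNReal.ofReal t < s
    · simp only [indicator, mem_ofPred_eq, hts, if_true, not_le.2 hts, if_false, add_zero]
      calc _ ≤ ENNReal.ofReal t ^ (1 / 2 - 1 : ℝ) * (s ^ (-r) * N) := by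
            gcongr
            exact (measure_mono (hsub.trans inter_subset_left)).trans (hdist s hs hs')
        _ = _ := by ring
    · simp only [indicator, mem_ofPred_eq, hts, if_false, not_lt.1 hts, if_true, mul_zero, zero_add]
      calc _ ≤ ENNReal.ofReal t ^ (1 / 2 - 1 : ℝ) * (ENNReal.ofReal t ^ (-r) * N) := by
            gcongr
            exact (measure_mono (hsub.trans inter_subset_right)).trans
              (hdist _ ht0 ENNReal.ofReal_ne_top)
        _ = _ := by
            rw [← mul_assoc, ← ENNReal.rpow_add _ _ ht0 ENNReal.ofReal_ne_top, mul_comm]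
            congr 2; ring
  have hm1 : Measurable ({t : ℝ | ENNReal.ofReal t < s}.indicator
      (fun t => ENNReal.ofReal t ^ (1 / 2 - 1 : ℝ))) :=
    Measurable.indicator (by fun_prop) (measurableSet_lt (by fun_prop) (by fun_prop))
  have hm2 : Measurable ({t : ℝ | s ≤ ENNReal.ofReal t}.indicator
      (fun t => ENNReal.ofReal t ^ (-(r - 1 / 2) - 1))) :=
    Measurable.indicator (by fun_prop) (measurableSet_le (by fun_prop) (by fun_prop))
  calc ∫⁻ x in {x | s < G x}, G x ^ (1 / 2 : ℝ) = ∫⁻ x, F x ^ (1 / 2 : ℝ) := by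
        rw [← lintegral_indicator hset]
        refine lintegral_congr fun x => ?_
        by_cases hx : s < G x <;> simp [F, indicator, hx]
    _ ≤ ENNReal.ofReal (1 / 2) * ∫⁻ t in Ioi (0 : ℝ),
        N * (s ^ (-r) * {t : ℝ | ENNReal.ofReal t < s}.indicator
        (fun t => ENNReal.ofReal t ^ (1 / 2 - 1 : ℝ)) t + {t : ℝ | s ≤ ENNReal.ofReal t}.indicator
        (fun t => ENNReal.ofReal t ^ (-(r - 1 / 2) - 1)) t) := by
        rw [lintegral_rpow_eq_layercake hFm (by norm_num)]
        exact mul_le_mul_right (setLIntegral_mono' measurableSet_Ioi hbound) _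
    _ ≤ ENNReal.ofReal (1 / 2) * (N * (s ^ (-r) * (ENNReal.ofReal (1 / 2)⁻¹ * s ^ (1 / 2 : ℝ)) +
        ENNReal.ofReal (r - 1 / 2)⁻¹ * s ^ (-(r - 1 / 2)))) := by
        rw [lintegral_const_mul _ (by fun_prop), lintegral_add_left (by fun_prop),
          lintegral_const_mul _ hm1, setLIntegral_rpow_lt (by norm_num)]
        gcongr
        exact setLIntegral_rpow_ge_le (by linarith) hs'
    _ ≤ ENNReal.ofReal (1 / 2) * (N * (2 * s ^ (1 / 2 - r) + 2 * s ^ (1 / 2 - r))) := by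
        have e1 : s ^ (-r) * (ENNReal.ofReal (1 / 2)⁻¹ * s ^ (1 / 2 : ℝ)) =
            2 * s ^ (1 / 2 - r) := by
          rw [mul_left_comm, ← ENNReal.rpow_add _ _ hs hs']
          congr 2
          · norm_num
          · ring
        rw [e1, show -(r - 1 / 2) = 1 / 2 - r by ring]
        gcongr
        rw [← ENNReal.ofReal_ofNat]
        apply ENNReal.ofReal_le_ofReal
        -- Here `r ≥ 1` enters: `(r - 1/2)⁻¹ ≤ 2`, so the constant does not depend on `r`.
        rw [inv_le_comm₀ (by linarith) (by norm_num)]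
        linarith
    _ = (ENNReal.ofReal (1 / 2) * 2) * (2 * s ^ (1 / 2 - r) * N) := by ring
    _ = _ := by
        have : ENNReal.ofReal (1 / 2) * 2 = 1 := by
          rw [← ENNReal.ofReal_ofNat, ← ENNReal.ofReal_mul (by norm_num)]; norm_num
        rw [this, one_mul]

/-- Kolmogorov's inequality with exponent `1/2`. -/
theorem avg_sqrt_le {G : E n → ℝ≥0∞} (hG : Measurable G) {r : ℝ} (hr : 1 ≤ r) {N : ℝ≥0∞}
    (hN : ∀ t : ℝ≥0∞, t ^ r * volume {x | t < G x} ≤ N) {s : ℝ≥0∞} (hs : s ≠ 0) (hs' : s ≠ ∞)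
    {B : Set (E n)} (hB : volume B ≠ 0) (hB' : volume B ≠ ∞) (hNs : N ≤ s ^ r * volume B) :
    (volume B)⁻¹ * ∫⁻ x in B, G x ^ (1 / 2 : ℝ) ≤ 3 * s ^ (1 / 2 : ℝ) := by
  have hset : MeasurableSet {x | s < G x} := measurableSet_lt measurable_const hG
  have h1 : ∫⁻ x in B, G x ^ (1 / 2 : ℝ) ≤ volume B * (3 * s ^ (1 / 2 : ℝ)) := by
    calc ∫⁻ x in B, G x ^ (1 / 2 : ℝ)
        ≤ ∫⁻ x in B, (s ^ (1 / 2 : ℝ) +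
          {x | s < G x}.indicator (fun x => G x ^ (1 / 2 : ℝ)) x) := by
          refine lintegral_mono fun x => ?_
          by_cases hx : s < G x
          · simp [indicator, hx]
          · simp only [indicator, mem_ofPred_eq, hx, if_false, add_zero]
            exact ENNReal.rpow_le_rpow (not_lt.1 hx) (by norm_num)
      _ = s ^ (1 / 2 : ℝ) * volume B +
          ∫⁻ x in B, {x | s < G x}.indicator (fun x => G x ^ (1 / 2 : ℝ)) x := by
          rw [lintegral_add_left measurable_const, setLIntegral_const]
      _ ≤ s ^ (1 / 2 : ℝ) * volume B + 2 * s ^ (1 / 2 - r) * (s ^ r * volume B) := by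
          gcongr
          refine (setLIntegral_le_lintegral _ _).trans ?_
          rw [lintegral_indicator hset]
          refine (setLIntegral_sqrt_tail_le hG hr hN hs hs').trans ?_
          gcongr
      _ = s ^ (1 / 2 : ℝ) * volume B + 2 * (s ^ (1 / 2 - r) * s ^ r) * volume B := by ring
      _ = _ := by
          rw [← ENNReal.rpow_add _ _ hs hs', sub_add_cancel]; ring
  calc _ ≤ (volume B)⁻¹ * (volume B * (3 * s ^ (1 / 2 : ℝ))) := by gcongr
    _ = _ := by rw [← mul_assoc, ENNReal.inv_mul_cancel hB hB', one_mul]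

/-- The maximal function of `G^{1/2}` for `G` in weak `L^r`. -/
theorem mul_volume_lt_maxFn_sqrt_le {G : E n → ℝ≥0∞} (hG : Measurable G) {r : ℝ} (hr : 1 ≤ r)
    {N : ℝ≥0∞} (hN : ∀ t : ℝ≥0∞, t ^ r * volume {x | t < G x} ≤ N) {s : ℝ≥0∞} (hs : s ≠ 0)
    (hs' : s ≠ ∞) :
    s ^ r * volume {x | 2 * s ^ (1 / 2 : ℝ) < maxFn volume (fun y => G y ^ (1 / 2 : ℝ)) x} ≤
      4 ^ n * 2 * N := by
  have h := mul_measure_two_mul_lt_maxFn_le (μ := volume) (D := 4 ^ n)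
    (fun c r hr => volume_ball_four_mul c hr) (g := fun y => G y ^ (1 / 2 : ℝ)) (by fun_prop)
    (s ^ (1 / 2 : ℝ))
  have hset : {x | s ^ (1 / 2 : ℝ) < G x ^ (1 / 2 : ℝ)} = {x | s < G x} := by
    ext x
    exact ENNReal.rpow_lt_rpow_iff (by norm_num)
  rw [hset] at h
  set V := volume {x | 2 * s ^ (1 / 2 : ℝ) < maxFn volume (fun y => G y ^ (1 / 2 : ℝ)) x}
  calc s ^ r * V = s ^ (r - 1 / 2) * (s ^ (1 / 2 : ℝ) * V) := by
        rw [← mul_assoc, ← ENNReal.rpow_add _ _ hs hs', sub_add_cancel]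
    _ ≤ s ^ (r - 1 / 2) * (4 ^ n * (2 * s ^ (1 / 2 - r) * N)) := by
        refine mul_le_mul_right (h.trans (mul_le_mul_right ?_ _)) _
        exact setLIntegral_sqrt_tail_le hG hr hN hs hs'
    _ = (s ^ (r - 1 / 2) * s ^ (1 / 2 - r)) * (4 ^ n * 2 * N) := by ring
    _ = _ := by
        rw [← ENNReal.rpow_add _ _ hs hs']
        norm_num

/-- A substitute for Jensen's inequality, at the cost of the factor 2: pointwise `g ≤ τ + τ^{1-r}
g^r`, according as `g ≤ τ` or not, and this is averaged. -/
theorem maxFn_le_two_mul_of_rpow {g : E n → ℝ≥0∞} {r : ℝ} (hr : 1 ≤ r) {τ : ℝ≥0∞}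
    (hτ : τ ≠ 0) (hτ' : τ ≠ ∞) {x : E n} (h : maxFn volume (fun y => g y ^ r) x ≤ τ ^ r) :
    maxFn volume g x ≤ 2 * τ := by
  have hp : ∀ y, g y ≤ τ + τ ^ (1 - r) * g y ^ r := by
    intro y
    rcases le_or_gt (g y) τ with hy | hy
    · exact hy.trans le_self_add
    · refine le_trans ?_ le_add_self
      rcases eq_or_ne (g y) ∞ with ht | ht
      · rw [ht, ENNReal.top_rpow_of_pos (by linarith), ENNReal.mul_top]
        exact (ENNReal.rpow_pos (pos_iff_ne_zero.2 hτ) hτ').ne'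
      · have h0 : g y ≠ 0 := (pos_of_gt hy).ne'
        calc g y = g y ^ (1 - r) * g y ^ r := by
              rw [← ENNReal.rpow_add _ _ h0 ht, sub_add_cancel, ENNReal.rpow_one]
          _ ≤ _ := by
              refine mul_le_mul_left ?_ _
              rw [show 1 - r = -(r - 1) by ring, ENNReal.rpow_neg, ENNReal.rpow_neg]
              exact ENNReal.inv_le_inv.2 (ENNReal.rpow_le_rpow hy.le (by linarith))
  refine iSup_le fun c => iSup_le fun ρ => iSup_le fun hx => ?_
  have hc0 : τ ^ (1 - r) ≠ ∞ := by
    simp [ENNReal.rpow_eq_top_iff, hτ, hτ']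
  calc (volume (ball c ρ))⁻¹ * ∫⁻ y in ball c ρ, g y
      ≤ (volume (ball c ρ))⁻¹ * ∫⁻ y in ball c ρ, (τ + τ ^ (1 - r) * g y ^ r) := by
        gcongr with y
        exact hp y
    _ = (volume (ball c ρ))⁻¹ * (τ * volume (ball c ρ)) +
        τ ^ (1 - r) * ((volume (ball c ρ))⁻¹ * ∫⁻ y in ball c ρ, g y ^ r) := by
        rw [lintegral_add_left measurable_const, setLIntegral_const,
          lintegral_const_mul' _ _ hc0]
        ring
    _ ≤ τ + τ ^ (1 - r) * τ ^ r := by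
        gcongr
        · rw [mul_left_comm]
          exact mul_le_of_le_one_right' (ENNReal.inv_mul_le_one _)
        · exact (avg_le_maxFn hx).trans h
    _ = 2 * τ := by
        rw [← ENNReal.rpow_add _ _ hτ hτ', sub_add_cancel, ENNReal.rpow_one, two_mul]

/-! ### Restrictions of `L²` functions and sublinearity -/

variable {𝕜 : Type*} [RCLike 𝕜]

/-- The restriction of an `L²` function to a measurable set. -/
def cut {s : Set (E n)} (hs : MeasurableSet s) (f : Lp 𝕜 2 (volume : Measure (E n))) :
    Lp 𝕜 2 (volume : Measure (E n)) :=
  ((Lp.memLp f).indicator hs).toLp _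

theorem coeFn_cut {s : Set (E n)} (hs : MeasurableSet s) (f : Lp 𝕜 2 (volume : Measure (E n))) :
    cut hs f =ᵐ[volume] s.indicator f :=
  MemLp.coeFn_toLp _

theorem lintegral_enorm_cut_rpow {s : Set (E n)} (hs : MeasurableSet s)
    (f : Lp 𝕜 2 (volume : Measure (E n))) {r : ℝ} (hr : 0 < r) :
    ∫⁻ x, ‖cut hs f x‖ₑ ^ r = ∫⁻ x in s, ‖f x‖ₑ ^ r := by
  rw [← lintegral_indicator hs]
  refine lintegral_congr_ae ?_
  filter_upwards [coeFn_cut hs f] with x hx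
  rw [hx]
  by_cases hxs : x ∈ s <;> simp [hxs, hr]

theorem IsBoundedSupportedOn.cut {f : Lp 𝕜 2 (volume : Measure (E n))} {t : Set (E n)}
    (hf : IsBoundedSupportedOn f t) {s : Set (E n)} (hs : MeasurableSet s) :
    IsBoundedSupportedOn (cut hs f) t := by
  refine ⟨(memLp_congr_ae (coeFn_cut hs f)).2 (hf.1.indicator hs), ?_⟩
  filter_upwards [coeFn_cut hs f, hf.2] with x hx h hxt
  rw [hx, indicator_apply_eq_zero]
  exact fun _ => h hxt

theorem IsBoundedSupportedOn.cut_subset {f : Lp 𝕜 2 (volume : Measure (E n))} {t : Set (E n)}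
    (hf : IsBoundedSupportedOn f t) {s u : Set (E n)} (hs : MeasurableSet s) (hsu : s ⊆ u) :
    IsBoundedSupportedOn (CZO.cut hs f) u := by
  refine ⟨(hf.cut hs).1, ?_⟩
  filter_upwards [coeFn_cut hs f] with x hx hxs
  rw [hx, indicator_of_notMem fun h => hxs (hsu h)]

theorem cut_eq_add {s t : Set (E n)} (hs : MeasurableSet s) (ht : MeasurableSet t) (hts : t ⊆ s)
    (f : Lp 𝕜 2 (volume : Measure (E n))) :
    cut hs f = cut (hs.diff ht) f + cut ht f := by
  refine Lp.ext ?_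
  filter_upwards [coeFn_cut hs f, coeFn_cut (hs.diff ht) f, coeFn_cut ht f,
    Lp.coeFn_add (cut (hs.diff ht) f) (cut ht f)] with x h1 h2 h3 h4
  rw [h4, Pi.add_apply, h1, h2, h3]
  by_cases hx : x ∈ t
  · simp [hx, hts hx]
  · by_cases hxs : x ∈ s <;> simp [hx, hxs]

variable {T : Lp 𝕜 2 (volume : Measure (E n)) → Lp 𝕜 2 (volume : Measure (E n))}

theorem IsSublinear.enorm_add_le (hT : IsSublinear T) (f g : Lp 𝕜 2 (volume : Measure (E n))) :
    ∀ᵐ x, ‖T (f + g) x‖ₑ ≤ ‖T f x‖ₑ + ‖T g x‖ₑ := by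
  filter_upwards [hT.add_le f g] with x hx
  rw [← ofReal_norm, ← ofReal_norm, ← ofReal_norm,
    ← ENNReal.ofReal_add (norm_nonneg _) (norm_nonneg _)]
  exact ENNReal.ofReal_le_ofReal hx

theorem IsSublinear.enorm_neg (hT : IsSublinear T) (f : Lp 𝕜 2 (volume : Measure (E n))) :
    ∀ᵐ x, ‖T (-f) x‖ₑ = ‖T f x‖ₑ := by
  filter_upwards [hT.smul_eq (-1) f] with x hx
  rw [neg_one_smul, abs_neg, abs_one, one_mul] at hx
  rw [← ofReal_norm, ← ofReal_norm, hx]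

theorem IsSublinear.enorm_sub_le (hT : IsSublinear T) (f g : Lp 𝕜 2 (volume : Measure (E n))) :
    ∀ᵐ x, ‖T (f - g) x‖ₑ ≤ ‖T f x‖ₑ + ‖T g x‖ₑ := by
  filter_upwards [hT.enorm_add_le f (-g), hT.enorm_neg g] with x h1 h2
  rw [sub_eq_add_neg, ← h2]
  exact h1

theorem BoundedOnL2.map_zero (hT : BoundedOnL2 T) : T 0 = 0 := by
  obtain ⟨C, hC⟩ := hT
  have := hC 0
  rw [norm_zero, mul_zero] at this
  exact norm_le_zero_iff.1 this

/-- `T` is of weak type `(r,r)` with constant `K`, on bounded functions with bounded support. -/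
def WeakBound (T : Lp 𝕜 2 (volume : Measure (E n)) → Lp 𝕜 2 (volume : Measure (E n)))
    (r : ℝ) (K : ℝ≥0∞) : Prop :=
  ∀ f : Lp 𝕜 2 (volume : Measure (E n)), (∃ R : ℝ, IsBoundedSupportedOn f (ball 0 R)) →
    ∀ t : ℝ≥0∞, t ^ r * volume {x | t < ‖T f x‖ₑ} ≤ K * ∫⁻ x, ‖f x‖ₑ ^ r

end CZO

/-! ### Sparse domination: one step -/

namespace CZO

open Set Filter Topology

variable {n : ℕ} {𝕜 : Type*} [RCLike 𝕜]
  {T : Lp 𝕜 2 (volume : Measure (E n)) → Lp 𝕜 2 (volume : Measure (E n))}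

/-- The enlarged ball around a dyadic cube. -/
def cubeBall (s : ℝ) (Q : Idx n) : Set (E n) := ball (cubeCenter s Q) (4 * cubeRadius s Q)

theorem measurableSet_cubeBall (s : ℝ) (Q : Idx n) : MeasurableSet (cubeBall s Q) :=
  measurableSet_ball

theorem cube_subset_cubeBall {s : ℝ} (hs : 0 < s) (Q : Idx n) : cube s Q ⊆ cubeBall s Q :=
  (cube_subset_ball hs Q).trans (ball_subset_ball (by linarith [cubeRadius_pos hs Q]))

/-- With radii `ρ_P ≤ ρ_Q / 2`, a common point of the cubes puts the centers within `ρ_P + ρ_Q`, and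
`4ρ_P + ρ_P + ρ_Q ≤ 4ρ_Q`. -/
theorem cubeBall_subset {s : ℝ} (hs : 0 < s) {P Q : Idx n} (h : Q.1 < P.1)
    (hPQ : cube s P ⊆ cube s Q) : cubeBall s P ⊆ cubeBall s Q := by
  have hne : (cube s P).Nonempty := by
    rw [nonempty_iff_ne_empty]
    intro h0
    have := volume_cube_ne_zero hs P
    rw [h0] at this
    simp at this
  obtain ⟨x, hx⟩ := hne
  have h1 := mem_ball.1 (cube_subset_ball hs P hx)
  have h2 := mem_ball.1 (cube_subset_ball hs Q (hPQ hx))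
  have h3 := cubeRadius_le hs h
  have h4 := dist_triangle_left (cubeCenter s P) (cubeCenter s Q) x
  have := cubeRadius_pos hs P
  exact ball_subset_ball' (by linarith)

theorem volume_cubeBall_eq {s : ℝ} (hs : 0 < s) (Q : Idx n) :
    volume (cubeBall s Q) = 4 ^ n * cubeConst n * volume (cube s Q) := by
  rw [cubeBall, volume_mul_cubeBall hs Q _ (by norm_num), ENNReal.ofReal_ofNat]

/-- The `L^r` average of `f` over the enlarged ball around a dyadic cube. -/
def cubeAvg (r s : ℝ) (f : E n → 𝕜) (Q : Idx n) : ℝ≥0∞ :=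
  ((volume (cubeBall s Q))⁻¹ * ∫⁻ y in cubeBall s Q, ‖f y‖ₑ ^ r) ^ r⁻¹

/-- Maximal cubes in which the open set `U` has large density. -/
theorem exists_density_stopping_cubes {s : ℝ} (hs : 0 < s) (Q : Idx n) {U : Set (E n)}
    (hU : IsOpen U) (hvol : volume U ≤ (4 * 2 ^ n)⁻¹ * volume (cube s Q)) :
    ∃ J : Set (Idx n), (∀ P ∈ J, Q.1 < P.1 ∧ cube s P ⊆ cube s Q ∧ ∃ x ∈ cube s P, x ∉ U) ∧
      J.PairwiseDisjoint (cube s) ∧ volume (⋃ P ∈ J, cube s P) ≤ 2⁻¹ * volume (cube s Q) ∧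
      ∀ x ∈ cube s Q, x ∈ U → x ∈ ⋃ P ∈ J, cube s P := by
  have h2n0 : (2 * 2 ^ n : ℝ≥0∞) ≠ 0 := by positivity
  have h2nt : (2 * 2 ^ n : ℝ≥0∞) ≠ ∞ := by finiteness
  have hQ0 := volume_cube_ne_zero hs Q
  have hQt := volume_cube_ne_top hs Q
  have hhalf : (2 * 2 ^ n : ℝ≥0∞) * volume U ≤ 2⁻¹ * volume (cube s Q) := by
    calc (2 * 2 ^ n : ℝ≥0∞) * volume U
        ≤ (2 * 2 ^ n) * ((4 * 2 ^ n)⁻¹ * volume (cube s Q)) := by gcongr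
      _ = 2⁻¹ * volume (cube s Q) := by
          rw [← mul_assoc]
          congr 1
          rw [show (4 * 2 ^ n : ℝ≥0∞) = 2 * (2 * 2 ^ n) by ring,
            ENNReal.mul_inv (Or.inl (by norm_num)) (Or.inl (by norm_num)), mul_left_comm,
            ENNReal.mul_inv_cancel h2n0 h2nt, mul_one]
  -- The threshold `1/(2·2^n)` leaves a selected cube at most half filled by `U`, because its
  -- parent, `2^n` times as large, is not bad.
  set bad : Idx n → Prop := fun P => volume (cube s P) < 2 * 2 ^ n * volume (cube s P ∩ U)
    with hbad
  have hQ : ¬ bad Q := by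
    rw [hbad, not_lt]
    calc 2 * 2 ^ n * volume (cube s Q ∩ U) ≤ 2 * 2 ^ n * volume U := by
          gcongr; exact inter_subset_right
      _ ≤ 2⁻¹ * volume (cube s Q) := hhalf
      _ ≤ volume (cube s Q) := mul_le_of_le_one_left' (by simp)
  obtain ⟨J, hJ, hdisj, hcov⟩ := exists_stopping_cubes s Q bad hQ
  refine ⟨J, fun P hP => ?_, hdisj, ?_, ?_⟩
  · obtain ⟨-, hlt, hsub, R, hR, hRP, hPR, -⟩ := hJ P hP
    refine ⟨hlt, hsub, ?_⟩
    by_contra! hall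
    rw [hbad, not_lt, volume_cube_succ hs hRP] at hR
    have h1 : volume (cube s P) ≤ volume (cube s R ∩ U) :=
      measure_mono fun x hx => ⟨hPR hx, hall x hx⟩
    have h2 : (2 * 2 ^ n : ℝ≥0∞) * volume (cube s P) ≤ 2 ^ n * volume (cube s P) :=
      (mul_le_mul_right h1 _).trans hR
    rw [ENNReal.mul_le_mul_iff_left (volume_cube_ne_zero hs P) (volume_cube_ne_top hs P)] at h2
    nth_rewrite 2 [← one_mul (2 ^ n : ℝ≥0∞)] at h2
    rw [ENNReal.mul_le_mul_iff_left (by positivity) (by finiteness)] at h2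
    norm_num at h2
  · have hcount : J.Countable := to_countable J
    rw [measure_biUnion hcount hdisj fun P _ => measurableSet_cube s P]
    calc ∑' P : J, volume (cube s P.1) ≤ ∑' P : J, 2 * 2 ^ n * volume (cube s P.1 ∩ U) :=
          ENNReal.tsum_le_tsum fun P => (hJ P.1 P.2).1.le
      _ = 2 * 2 ^ n * volume (⋃ P ∈ J, cube s P ∩ U) := by
          rw [ENNReal.tsum_mul_left, measure_biUnion hcount
            (hdisj.mono fun P => inter_subset_left)
            fun P _ => (measurableSet_cube s P).inter hU.measurableSet]
      _ ≤ 2 * 2 ^ n * volume U := by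
          gcongr
          exact iUnion₂_subset fun P _ => inter_subset_right
      _ ≤ _ := hhalf
  · intro x hx hxU
    -- Since `U` is open, a point of `U` has a dyadic cube inside `U`, which is bad because its
    -- density is 1.
    obtain ⟨k, hk, hsub⟩ := exists_cube_subset hs hU hxU Q.1
    refine hcov x hx k hk ?_
    change volume (cube s (k, cubeIdx s k x)) < 2 * 2 ^ n * volume (cube s (k, cubeIdx s k x) ∩ U)
    rw [inter_eq_left.2 hsub]
    refine lt_of_lt_of_le ?_ (mul_le_mul_left (b := (2 : ℝ≥0∞)) ?_ _)
    · rw [two_mul]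
      exact ENNReal.lt_add_right (volume_cube_ne_top hs _) (volume_cube_ne_zero hs _)
    · exact le_mul_of_one_le_right' (one_le_pow₀ (by norm_num))


/-- Each of the three sets obeys a weak type bound at height `A α`, and the integral of `g^r` equals
`α^r` times the measure of the ball. So `A^r` times its measure is at most a multiple of the measure
of the cube, and `A ≤ A^r`. A large `A` thus makes the exceptional set relatively small. -/
theorem volume_exceptional_le {s r : ℝ} (hs : 0 < s) (hr : 1 ≤ r) {K : ℝ≥0∞}
    {f : Lp 𝕜 2 (volume : Measure (E n))} (Q : Idx n) {G g : E n → ℝ≥0∞} (hG : Measurable G)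
    (hN : ∀ t : ℝ≥0∞, t ^ r * volume {x | t < G x} ≤ K * ∫⁻ x, g x ^ r)
    (hg : ∫⁻ x, g x ^ r = ∫⁻ x in cubeBall s Q, ‖f x‖ₑ ^ r)
    (h0 : cubeAvg r s f Q ≠ 0) (htop : cubeAvg r s f Q ≠ ∞) {A : ℝ≥0∞} (hA1 : 1 ≤ A)
    (hAt : A ≠ ∞) :
    A * volume ({x | A * cubeAvg r s f Q < G x} ∪
      {x | 2 * (A * cubeAvg r s f Q) ^ (1 / 2 : ℝ) < maxFn volume (fun y => G y ^ (1 / 2 : ℝ)) x} ∪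
      {x | (A * cubeAvg r s f Q) ^ r < maxFn volume (fun y => g y ^ r) x}) ≤
      (K + 4 ^ n * 2 * K + 4 ^ n) * (4 ^ n * cubeConst n) * volume (cube s Q) := by
  have hr0 : 0 < r := by linarith
  set α := cubeAvg r s f Q with hα
  set τ := A * α with hτ
  have hA0 : A ≠ 0 := (lt_of_lt_of_le one_pos hA1).ne'
  have hτ0 : τ ≠ 0 := mul_ne_zero hA0 h0
  have hτt : τ ≠ ∞ := ENNReal.mul_ne_top hAt htop
  have hB0 : volume (cubeBall s Q) ≠ 0 :=
    volume_ball_ne_zero _ (by linarith [cubeRadius_pos hs Q])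
  have hBt : volume (cubeBall s Q) ≠ ∞ := volume_ball_ne_top _ _
  have hint : ∫⁻ x, g x ^ r = volume (cubeBall s Q) * α ^ r := by
    rw [hg, hα, cubeAvg, ← ENNReal.rpow_mul, inv_mul_cancel₀ hr0.ne', ENNReal.rpow_one,
      ← mul_assoc, ENNReal.mul_inv_cancel hB0 hBt, one_mul]
  have hαr0 : α ^ r ≠ 0 := (ENNReal.rpow_pos (pos_iff_ne_zero.2 h0) htop).ne'
  have hαrt : α ^ r ≠ ∞ := ENNReal.rpow_ne_top_of_nonneg hr0.le htop
  have key : ∀ (S : Set (E n)) (L : ℝ≥0∞), τ ^ r * volume S ≤ L * ∫⁻ x, g x ^ r →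
      A * volume S ≤ L * (4 ^ n * cubeConst n * volume (cube s Q)) := by
    intro S L hS
    rw [hint, hτ, ENNReal.mul_rpow_of_nonneg _ _ hr0.le, volume_cubeBall_eq hs] at hS
    have h1 : A ≤ A ^ r := by
      nth_rewrite 1 [← ENNReal.rpow_one A]
      exact ENNReal.rpow_le_rpow_of_exponent_le hA1 hr
    refine (mul_le_mul_left h1 _).trans ?_
    refine (ENNReal.mul_le_mul_iff_left hαr0 hαrt).1 ?_
    calc A ^ r * volume S * α ^ r = A ^ r * α ^ r * volume S := by ring
      _ ≤ _ := hS
      _ = _ := by ring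
  have k1 := key _ K (hN τ)
  have k2 := key _ (4 ^ n * 2 * K) ((mul_volume_lt_maxFn_sqrt_le hG hr hN hτ0 hτt).trans_eq
    (mul_assoc _ _ _).symm)
  have k3 := key _ (4 ^ n) (mul_measure_lt_maxFn_le (fun c r hr => volume_ball_four_mul c hr)
    (fun y => g y ^ r) (τ ^ r))
  calc _ ≤ A * (volume {x | τ < G x} + volume {x | 2 * τ ^ (1 / 2 : ℝ) <
          maxFn volume (fun y => G y ^ (1 / 2 : ℝ)) x} +
          volume {x | τ ^ r < maxFn volume (fun y => g y ^ r) x}) := by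
        gcongr
        exact (measure_union_le _ _).trans (add_le_add_left (measure_union_le _ _) _)
    _ ≤ _ := by
        rw [mul_add, mul_add]
        refine (add_le_add (add_le_add k1 k2) k3).trans_eq ?_
        ring

/-- One step of the sparse domination. -/
theorem exists_sparse_children (hT : IsSublinear T) (hT2 : BoundedOnL2 T) (hsup : SupCondition T)
    {r : ℝ} (hr : 1 ≤ r) {K : ℝ≥0∞} (hK1 : 1 ≤ K) (hKt : K ≠ ∞) (hW : WeakBound T r K) :
    ∃ A : ℝ≥0∞, A ≠ ∞ ∧ ∀ f : Lp 𝕜 2 (volume : Measure (E n)),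
      (∃ R : ℝ, IsBoundedSupportedOn f (ball 0 R)) → ∀ s : ℝ, 0 < s → ∀ Q : Idx n,
      ∃ J : Set (Idx n), (∀ P ∈ J, cube s P ⊆ cube s Q) ∧ J.PairwiseDisjoint (cube s) ∧
        volume (⋃ P ∈ J, cube s P) ≤ 2⁻¹ * volume (cube s Q) ∧
        ∀ᵐ x, x ∈ cube s Q →
          (x ∉ ⋃ P ∈ J, cube s P →
            ‖T (cut (measurableSet_cubeBall s Q) f) x‖ₑ ≤ A * cubeAvg r s f Q) ∧
          ∀ P ∈ J, x ∈ cube s P → ‖T (cut (measurableSet_cubeBall s Q) f) x‖ₑ ≤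
            A * cubeAvg r s f Q + ‖T (cut (measurableSet_cubeBall s P) f) x‖ₑ := by
  obtain ⟨C, hCt, hC⟩ := hsup.exists_sqrt
  have hr0 : 0 < r := by linarith
  set X : ℝ≥0∞ := (K + 4 ^ n * 2 * K + 4 ^ n) * (4 ^ n * cubeConst n) with hX
  have hXt : X ≠ ∞ := by
    have := cubeConst_ne_top n
    finiteness
  -- The factor 8 gives twice the smallness required, leaving room for an open set around the
  -- exceptional set.
  set A : ℝ≥0∞ := 1 + 8 * 2 ^ n * (X + 1) with hA
  have hA1 : 1 ≤ A := le_self_add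
  have hAt : A ≠ ∞ := by finiteness
  set A' : ℝ≥0∞ := (1 + C * (8 + 18 * (K * 2 ^ n) + 2)) * A with hA'
  refine ⟨A', by finiteness, ?_⟩
  intro f hf s hs Q
  obtain ⟨R, hfR⟩ := hf
  set fQ := cut (measurableSet_cubeBall s Q) f with hfQ
  set α := cubeAvg r s f Q with hα
  have hB0 : volume (cubeBall s Q) ≠ 0 :=
    volume_ball_ne_zero _ (by linarith [cubeRadius_pos hs Q])
  have hBt : volume (cubeBall s Q) ≠ ∞ := volume_ball_ne_top _ _
  have hint : ∫⁻ x, ‖fQ x‖ₑ ^ r = ∫⁻ x in cubeBall s Q, ‖f x‖ₑ ^ r :=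
    lintegral_enorm_cut_rpow _ f hr0
  have hαt : α ≠ ∞ := by
    have h1 : ∀ᵐ y, ‖f y‖ₑ ≤ eLpNorm f ∞ volume := by
      rw [eLpNorm_exponent_top]; exact enorm_ae_le_eLpNormEssSup f volume
    have h2 : ∫⁻ y in cubeBall s Q, ‖f y‖ₑ ^ r ≠ ∞ := by
      refine ne_top_of_le_ne_top ?_ (lintegral_mono_ae (g := fun _ => eLpNorm f ∞ volume ^ r)
        (ae_restrict_of_ae (h1.mono fun y hy => ENNReal.rpow_le_rpow hy hr0.le)))
      rw [setLIntegral_const]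
      exact ENNReal.mul_ne_top (ENNReal.rpow_ne_top_of_nonneg hr0.le hfR.1.2.ne) hBt
    exact ENNReal.rpow_ne_top_of_nonneg (inv_nonneg.2 hr0.le)
      (ENNReal.mul_ne_top (ENNReal.inv_ne_top.2 hB0) h2)
  -- For `α = 0` the function vanishes on the enlarged ball, and `T 0 = 0`; no children are needed.
  rcases eq_or_ne α 0 with hα0 | hα0
  · refine ⟨∅, by simp, by simp, by simp, ?_⟩
    have hz : fQ = 0 := by
      have h1 : ∫⁻ x, ‖fQ x‖ₑ ^ r = 0 := by
        rw [hint]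
        rw [hα, cubeAvg, ENNReal.rpow_eq_zero_iff_of_pos (inv_pos.2 hr0), mul_eq_zero,
          ENNReal.inv_eq_zero] at hα0
        exact hα0.resolve_left hBt
      rw [lintegral_eq_zero_iff ((measurable_enorm_Lp fQ).pow_const r)] at h1
      refine Lp.ext ?_
      filter_upwards [h1, Lp.coeFn_zero 𝕜 2 (volume : Measure (E n))] with x hx h0
      rw [h0]
      simpa [hr0, hr0.not_gt] using hx
    rw [hz, hT2.map_zero]
    filter_upwards with x _
    simp
  set G : E n → ℝ≥0∞ := fun x => ‖T fQ x‖ₑ with hG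
  have hGm : Measurable G := measurable_enorm_Lp (T fQ)
  have hN : ∀ t : ℝ≥0∞, t ^ r * volume {x | t < G x} ≤ K * ∫⁻ x, ‖fQ x‖ₑ ^ r :=
    hW fQ ⟨R, hfR.cut _⟩
  set τ := A * α with hτ
  have hτ0 : τ ≠ 0 := mul_ne_zero (lt_of_lt_of_le one_pos hA1).ne' hα0
  have hτt : τ ≠ ∞ := ENNReal.mul_ne_top hAt hαt
  set Ex := {x | τ < G x} ∪
      {x | 2 * τ ^ (1 / 2 : ℝ) < maxFn volume (fun y => G y ^ (1 / 2 : ℝ)) x} ∪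
      {x | τ ^ r < maxFn volume (fun y => ‖fQ y‖ₑ ^ r) x} with hEx
  have hExv : A * volume Ex ≤ X * volume (cube s Q) :=
    volume_exceptional_le hs hr Q hGm hN hint hα0 hαt hA1 hAt
  have hQ0 := volume_cube_ne_zero hs Q
  have hQt := volume_cube_ne_top hs Q
  have hlt : volume Ex < (4 * 2 ^ n)⁻¹ * volume (cube s Q) := by
    have h1 : (8 * 2 ^ n * (X + 1)) * volume Ex ≤ (X + 1) * volume (cube s Q) := by
      calc _ ≤ A * volume Ex := by gcongr; exact le_add_self
        _ ≤ X * volume (cube s Q) := hExv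
        _ ≤ _ := by gcongr; exact le_self_add
    have h2 : (8 * 2 ^ n : ℝ≥0∞) * volume Ex ≤ volume (cube s Q) := by
      refine (ENNReal.mul_le_mul_iff_right (a := X + 1) (by positivity) (by finiteness)).1 ?_
      calc _ = (8 * 2 ^ n * (X + 1)) * volume Ex := by ring
        _ ≤ _ := h1
    have h3 : volume Ex ≤ 2⁻¹ * ((4 * 2 ^ n)⁻¹ * volume (cube s Q)) := by
      rw [← mul_assoc, ← ENNReal.mul_inv (Or.inl (by norm_num)) (Or.inl (by norm_num)),
        mul_comm _ (volume (cube s Q)), ← div_eq_mul_inv,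
        ENNReal.le_div_iff_mul_le (Or.inl (by positivity)) (Or.inl (by finiteness)), mul_comm]
      refine le_trans (le_of_eq ?_) h2
      ring
    refine h3.trans_lt ?_
    set Y := (4 * 2 ^ n : ℝ≥0∞)⁻¹ * volume (cube s Q) with hY
    have hY0 : Y ≠ 0 := mul_ne_zero (ENNReal.inv_ne_zero.2 (by finiteness)) hQ0
    have hYt : Y ≠ ∞ := ENNReal.mul_ne_top (ENNReal.inv_ne_top.2 (by positivity)) hQt
    rw [mul_comm, ← div_eq_mul_inv]
    exact ENNReal.half_lt_self hY0 hYt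
  obtain ⟨U, hExU, hUo, hUv⟩ := Ex.exists_isOpen_lt_of_lt _ hlt
  obtain ⟨J, hJ, hdisj, hvol, hcov⟩ := exists_density_stopping_cubes hs Q hUo hUv.le
  refine ⟨J, fun P hP => (hJ P hP).2.1, hdisj, hvol, ?_⟩
  have hAA' : τ ≤ A' * α := by
    rw [hA', mul_assoc, ← hτ]
    exact le_mul_of_one_le_left' le_self_add
  have hchild : ∀ P ∈ J, ∀ᵐ x, x ∈ cube s P → G x ≤
      A' * α + ‖T (cut (measurableSet_cubeBall s P) f) x‖ₑ := by
    intro P hP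
    -- The point `z` of `P` lies outside the exceptional set, so averages over balls containing it
    -- are under control.
    obtain ⟨hlev, hPQ, z, hzP, hzU⟩ := hJ P hP
    have hzEx : z ∉ Ex := fun h => hzU (hExU h)
    simp only [hEx, mem_union, mem_ofPred_eq, not_or, not_lt] at hzEx
    obtain ⟨⟨-, hz2⟩, hz3⟩ := hzEx
    have hPpos := cubeRadius_pos hs P
    have hBB := cubeBall_subset hs hlev hPQ
    set fP := cut (measurableSet_cubeBall s P) f with hfP
    set gP := cut ((measurableSet_cubeBall s Q).diff (measurableSet_cubeBall s P)) f with hgP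
    have hsplit : fQ = gP + fP := cut_eq_add _ _ hBB f
    have hzb : z ∈ ball (cubeCenter s P) (cubeRadius s P) := cube_subset_ball hs P hzP
    have hz2b : z ∈ ball (cubeCenter s P) (2 * cubeRadius s P) :=
      ball_subset_ball (by linarith) hzb
    have hz4b : z ∈ cubeBall s P := ball_subset_ball (by linarith) hzb
    set B2 := ball (cubeCenter s P) (2 * cubeRadius s P) with hB2
    have hB20 : volume B2 ≠ 0 := volume_ball_ne_zero _ (by linarith)
    have hB2t : volume B2 ≠ ∞ := volume_ball_ne_top _ _
    have hvol4 : volume (cubeBall s P) = 2 ^ n * volume B2 := by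
      rw [cubeBall, show 4 * cubeRadius s P = 2 * (2 * cubeRadius s P) by ring,
        volume_ball_mul _ (cubeCenter s P) (by norm_num) (by linarith), ENNReal.ofReal_ofNat]
    have hess := hC (cubeCenter s P) (cubeRadius s P) hPpos gP
      (hfR.cut_subset _ fun x hx => hx.2) ⟨R, hfR.cut _⟩
    -- the average of `|T f_P|^{1/2}`
    have havgP : (volume B2)⁻¹ * ∫⁻ x in B2, ‖T fP x‖ₑ ^ (1 / 2 : ℝ) ≤
        3 * (K * 2 ^ n * τ) ^ (1 / 2 : ℝ) := by
      refine avg_sqrt_le (measurable_enorm_Lp (T fP)) hr (hW fP ⟨R, hfR.cut _⟩)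
        (mul_ne_zero (mul_ne_zero (lt_of_lt_of_le one_pos hK1).ne' (by positivity)) hτ0)
        (by finiteness) hB20 hB2t ?_
      have h1 : ∫⁻ x, ‖fP x‖ₑ ^ r ≤ volume (cubeBall s P) * τ ^ r := by
        have h2 : ∫⁻ x, ‖fP x‖ₑ ^ r = ∫⁻ x in cubeBall s P, ‖fQ x‖ₑ ^ r := by
          rw [lintegral_enorm_cut_rpow _ f hr0]
          refine setLIntegral_congr_fun_ae (measurableSet_cubeBall s P) ?_
          filter_upwards [coeFn_cut (measurableSet_cubeBall s Q) f] with x hx hxP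
          rw [hfQ, hx, indicator_of_mem (hBB hxP)]
        have h3 := (avg_le_maxFn (μ := volume) (g := fun y => ‖fQ y‖ₑ ^ r) hz4b).trans hz3
        have hb0 : volume (cubeBall s P) ≠ 0 := volume_ball_ne_zero _ (by linarith)
        have hbt : volume (cubeBall s P) ≠ ∞ := volume_ball_ne_top _ _
        rw [h2]
        calc _ = volume (cubeBall s P) * ((volume (cubeBall s P))⁻¹ *
              ∫⁻ x in cubeBall s P, ‖fQ x‖ₑ ^ r) := by
              rw [← mul_assoc, ENNReal.mul_inv_cancel hb0 hbt, one_mul]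
          _ ≤ _ := by gcongr; exact h3
      calc K * ∫⁻ x, ‖fP x‖ₑ ^ r ≤ K * (volume (cubeBall s P) * τ ^ r) := by gcongr
        _ = (K * 2 ^ n) * (τ ^ r * volume B2) := by rw [hvol4]; ring
        -- The place where `1 ≤ K` is used: the constant is moved inside the power `r`, as the
        -- height in Kolmogorov's inequality requires.
        _ ≤ (K * 2 ^ n) ^ r * (τ ^ r * volume B2) := by
            gcongr
            nth_rewrite 1 [← ENNReal.rpow_one (K * 2 ^ n)]
            refine ENNReal.rpow_le_rpow_of_exponent_le ?_ hr
            exact one_le_mul hK1 (one_le_pow₀ (by norm_num))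
        _ = _ := by rw [ENNReal.mul_rpow_of_nonneg _ τ hr0.le, mul_assoc]
    have havgQ : (volume B2)⁻¹ * ∫⁻ x in B2, G x ^ (1 / 2 : ℝ) ≤ 2 * τ ^ (1 / 2 : ℝ) :=
      (avg_le_maxFn (μ := volume) (g := fun y => G y ^ (1 / 2 : ℝ)) hz2b).trans hz2
    have hsqrt : ∀ y : ℝ≥0∞, (y ^ (1 / 2 : ℝ)) ^ 2 = y := fun y => by
      rw [← ENNReal.rpow_natCast, ← ENNReal.rpow_mul]; norm_num
    have havg : ((volume B2)⁻¹ * ∫⁻ x in B2, ‖T gP x‖ₑ ^ (1 / 2 : ℝ)) ^ 2 ≤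
        (8 + 18 * (K * 2 ^ n)) * τ := by
      have h1 : (volume B2)⁻¹ * ∫⁻ x in B2, ‖T gP x‖ₑ ^ (1 / 2 : ℝ) ≤
          2 * τ ^ (1 / 2 : ℝ) + 3 * (K * 2 ^ n * τ) ^ (1 / 2 : ℝ) := by
        -- `T gP` is compared with `T fQ`, controlled at `z`, and with `T fP`, controlled by the
        -- weak type; the square root is subadditive.
        have hgsub : gP = fQ - fP := by rw [hsplit]; abel
        calc _ ≤ (volume B2)⁻¹ * ∫⁻ x in B2, (G x ^ (1 / 2 : ℝ) + ‖T fP x‖ₑ ^ (1 / 2 : ℝ)) := by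
              refine mul_le_mul_right (lintegral_mono_ae (ae_restrict_of_ae ?_)) _
              filter_upwards [hT.enorm_sub_le fQ fP] with x hx
              rw [hgsub]
              exact (ENNReal.rpow_le_rpow hx (by norm_num)).trans
                (ENNReal.rpow_add_le_add_rpow _ _ (by norm_num) (by norm_num))
          _ = ((volume B2)⁻¹ * ∫⁻ x in B2, G x ^ (1 / 2 : ℝ)) +
              (volume B2)⁻¹ * ∫⁻ x in B2, ‖T fP x‖ₑ ^ (1 / 2 : ℝ) := by
              rw [lintegral_add_left (hGm.pow_const _), mul_add]
          _ ≤ _ := add_le_add havgQ havgP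
      have h2 : ∀ a b : ℝ≥0∞, (a + b) ^ 2 ≤ 2 * a ^ 2 + 2 * b ^ 2 := by
        intro a b
        rcases eq_or_ne a ∞ with rfl | ha
        · simp
        rcases eq_or_ne b ∞ with rfl | hb
        · simp
        lift a to ℝ≥0 using ha
        lift b to ℝ≥0 using hb
        norm_cast
        have : ((a : ℝ) + b) ^ 2 ≤ 2 * a ^ 2 + 2 * b ^ 2 := by nlinarith [sq_nonneg ((a : ℝ) - b)]
        exact_mod_cast this
      calc _ ≤ (2 * τ ^ (1 / 2 : ℝ) + 3 * (K * 2 ^ n * τ) ^ (1 / 2 : ℝ)) ^ 2 := by gcongr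
        _ ≤ _ := h2 _ _
        _ = _ := by rw [mul_pow, mul_pow, hsqrt, hsqrt]; ring
    have hM : ⨅ x ∈ ball (cubeCenter s P) (cubeRadius s P),
        maxFn volume (fun y => ‖gP y‖ₑ) x ≤ 2 * τ := by
      refine (iInf₂_le z hzb).trans ((maxFn_mono (h := fun y => ‖fQ y‖ₑ) ?_ z).trans
        (maxFn_le_two_mul_of_rpow hr hτ0 hτt hz3))
      filter_upwards [coeFn_cut (measurableSet_cubeBall s Q) f,
        coeFn_cut ((measurableSet_cubeBall s Q).diff (measurableSet_cubeBall s P)) f] with x h1 h2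
      rw [hgP, h2, hfQ, h1]
      by_cases hxQ : x ∈ cubeBall s Q <;> by_cases hxP : x ∈ cubeBall s P <;> simp [hxQ, hxP]
    have hfinal : essSup (fun x => ‖T gP x‖ₑ)
        (volume.restrict (ball (cubeCenter s P) (cubeRadius s P))) ≤ A' * α := by
      refine hess.trans ?_
      calc _ ≤ C * ((8 + 18 * (K * 2 ^ n)) * τ + 2 * τ) := by gcongr
        _ = C * (8 + 18 * (K * 2 ^ n) + 2) * A * α := by rw [hτ]; ring
        _ ≤ _ := by
            rw [hA']
            gcongr
            exact le_add_self
    have hae := ae_le_essSup (f := fun x => ‖T gP x‖ₑ)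
      (μ := volume.restrict (ball (cubeCenter s P) (cubeRadius s P)))
    rw [ae_restrict_iff' measurableSet_ball] at hae
    filter_upwards [hae, hT.enorm_add_le gP fP] with x hx1 hx2 hxP
    rw [hG]
    dsimp only
    rw [hsplit]
    refine hx2.trans (add_le_add ((hx1 (cube_subset_ball hs P hxP)).trans hfinal) le_rfl)
  have hchild' : ∀ᵐ x, ∀ P ∈ J, x ∈ cube s P → G x ≤
      A' * α + ‖T (cut (measurableSet_cubeBall s P) f) x‖ₑ :=
    (ae_ball_iff (to_countable J)).2 hchild
  filter_upwards [hchild'] with x hx hxQ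
  refine ⟨fun hxJ => ?_, hx⟩
  have hxEx : x ∉ Ex := fun h => hxJ (hcov x hxQ (hExU h))
  simp only [hEx, mem_union, mem_ofPred_eq, not_or, not_lt] at hxEx
  exact hxEx.1.1.trans hAA'

end CZO

/-! ### Sparse domination: summation -/

namespace CZO

open Set Filter Topology

variable {n : ℕ} {𝕜 : Type*} [RCLike 𝕜]
  {T : Lp 𝕜 2 (volume : Measure (E n)) → Lp 𝕜 2 (volume : Measure (E n))}

/-- The generations of the tree with children `J` and root `Q`. -/
def generation (J : Idx n → Set (Idx n)) (Q : Idx n) : ℕ → Set (Idx n)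
  | 0 => {Q}
  | l + 1 => {P | ∃ R ∈ generation J Q l, P ∈ J R}

/-! ### The tree of stopping cubes -/

section Tree

variable {s : ℝ} {J : Idx n → Set (Idx n)} (Q₀ : Idx n)

theorem generation_pairwiseDisjoint (hsub : ∀ Q, ∀ P ∈ J Q, cube s P ⊆ cube s Q)
    (hdisj : ∀ Q, (J Q).PairwiseDisjoint (cube s)) (l : ℕ) :
    (generation J Q₀ l).PairwiseDisjoint (cube s) := by
  induction l with
  | zero => exact pairwiseDisjoint_singleton _ _
  | succ l ih =>
    rintro P ⟨R, hR, hP⟩ P' ⟨R', hR', hP'⟩ hne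
    by_cases h : R = R'
    · subst h
      exact hdisj R hP hP' hne
    · exact (ih hR hR' h).mono (hsub R P hP) (hsub R' P' hP')

theorem exists_ancestor (hsub : ∀ Q, ∀ P ∈ J Q, cube s P ⊆ cube s Q) {l l' : ℕ} (h : l ≤ l')
    {P : Idx n} (hP : P ∈ generation J Q₀ l') :
    ∃ R ∈ generation J Q₀ l, cube s P ⊆ cube s R := by
  induction l', h using Nat.le_induction generalizing P with
  | base => exact ⟨P, hP, Subset.rfl⟩
  | succ k _ ih =>
    obtain ⟨R, hR, hPR⟩ := hP
    obtain ⟨R', hR', hRR'⟩ := ih hR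
    exact ⟨R', hR', (hsub R P hPR).trans hRR'⟩

theorem volume_generation_le (hsub : ∀ Q, ∀ P ∈ J Q, cube s P ⊆ cube s Q)
    (hdisj : ∀ Q, (J Q).PairwiseDisjoint (cube s))
    (hvol : ∀ Q, volume (⋃ P ∈ J Q, cube s P) ≤ 2⁻¹ * volume (cube s Q)) (l : ℕ) :
    volume (⋃ P ∈ generation J Q₀ l, cube s P) ≤ 2⁻¹ ^ l * volume (cube s Q₀) := by
  induction l with
  | zero => simp [generation]
  | succ l ih =>
    have hcount : (generation J Q₀ l).Countable := to_countable _
    calc volume (⋃ P ∈ generation J Q₀ (l + 1), cube s P)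
        ≤ volume (⋃ R ∈ generation J Q₀ l, ⋃ P ∈ J R, cube s P) := by
          refine measure_mono (iUnion₂_subset ?_)
          rintro P ⟨R, hR, hP⟩
          exact fun x hx => mem_biUnion hR (mem_biUnion hP hx)
      _ ≤ ∑' R : generation J Q₀ l, volume (⋃ P ∈ J R.1, cube s P) := measure_biUnion_le _ hcount _
      _ ≤ ∑' R : generation J Q₀ l, 2⁻¹ * volume (cube s R.1) :=
          ENNReal.tsum_le_tsum fun R => hvol R.1
      _ = 2⁻¹ * volume (⋃ R ∈ generation J Q₀ l, cube s R) := by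
          rw [ENNReal.tsum_mul_left, measure_biUnion hcount
            (generation_pairwiseDisjoint Q₀ hsub hdisj l) fun R _ => measurableSet_cube s R]
      _ ≤ 2⁻¹ * (2⁻¹ ^ l * volume (cube s Q₀)) := by gcongr
      _ = _ := by rw [pow_succ]; ring

/-- The generations cover sets of geometrically decreasing measure, so almost every point leaves the
tree and the iteration terminates there. -/
theorem ae_exists_notMem_generation (hs : 0 < s) (hsub : ∀ Q, ∀ P ∈ J Q, cube s P ⊆ cube s Q)
    (hdisj : ∀ Q, (J Q).PairwiseDisjoint (cube s))
    (hvol : ∀ Q, volume (⋃ P ∈ J Q, cube s P) ≤ 2⁻¹ * volume (cube s Q)) :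
    ∀ᵐ x, ∃ l, x ∉ ⋃ P ∈ generation J Q₀ l, cube s P := by
  have h0 : volume (⋂ l, ⋃ P ∈ generation J Q₀ l, cube s P) = 0 := by
    have hlim : Tendsto (fun l : ℕ => (2⁻¹ : ℝ≥0∞) ^ l * volume (cube s Q₀)) atTop
        (𝓝 (0 * volume (cube s Q₀))) :=
      ENNReal.Tendsto.mul_const (ENNReal.tendsto_pow_atTop_nhds_zero_of_lt_one (by norm_num))
        (Or.inr (volume_cube_ne_top hs Q₀))
    rw [zero_mul] at hlim
    refine le_antisymm (ge_of_tendsto' hlim fun l => ?_) zero_le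
    exact (measure_mono (iInter_subset _ l)).trans (volume_generation_le Q₀ hsub hdisj hvol l)
  rw [ae_iff]
  refine measure_mono_null (fun x hx => ?_) h0
  simpa using hx

/-- A cube of a later generation lies in some child of a cube of the earlier generation: either of
the cube in question, whose children are removed, or of a disjoint one. Indexing by pairs makes it
unnecessary to know that an index occurs in one generation only. -/
theorem generation_diff_disjoint (hsub : ∀ Q, ∀ P ∈ J Q, cube s P ⊆ cube s Q)
    (hdisj : ∀ Q, (J Q).PairwiseDisjoint (cube s)) {i j : ℕ × Idx n}
    (hi : i.2 ∈ generation J Q₀ i.1) (hj : j.2 ∈ generation J Q₀ j.1) (hij : i ≠ j) :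
    Disjoint (cube s i.2 \ ⋃ P ∈ J i.2, cube s P) (cube s j.2 \ ⋃ P ∈ J j.2, cube s P) := by
  have key : ∀ i j : ℕ × Idx n, i.2 ∈ generation J Q₀ i.1 → j.2 ∈ generation J Q₀ j.1 →
      i.1 < j.1 → Disjoint (cube s i.2 \ ⋃ P ∈ J i.2, cube s P) (cube s j.2) := by
    intro i j hi hj hlt
    obtain ⟨P, ⟨R, hR, hPR⟩, hjP⟩ := exists_ancestor Q₀ hsub (Nat.succ_le_of_lt hlt) hj
    rw [Set.disjoint_left]
    rintro x ⟨hx, hxn⟩ hxj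
    have hxP := hjP hxj
    by_cases h : R = i.2
    · subst h
      exact hxn (mem_biUnion hPR hxP)
    · exact (Set.disjoint_left.1 (generation_pairwiseDisjoint Q₀ hsub hdisj _ hR hi h))
        (hsub R P hPR hxP) hx
  rcases lt_trichotomy i.1 j.1 with h | h | h
  · exact (key i j hi hj h).mono_right sdiff_subset
  · have hne : i.2 ≠ j.2 := fun h' => hij (Prod.ext h h')
    rw [← h] at hj
    exact (generation_pairwiseDisjoint Q₀ hsub hdisj _ hi hj hne).mono sdiff_subset sdiff_subset
  · exact ((key j i hj hi h).mono_right sdiff_subset).symm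

open Classical in
/-- Summation along the tree. -/
theorem le_sum_generation {A : ℝ≥0∞} {x : E n} {G a : Idx n → ℝ≥0∞}
    (h : ∀ Q, x ∈ cube s Q → (x ∉ ⋃ P ∈ J Q, cube s P → G Q ≤ A * a Q) ∧
      ∀ P ∈ J Q, x ∈ cube s P → G Q ≤ A * a Q + G P) (N : ℕ) :
    ∀ l, ∀ Q ∈ generation J Q₀ l, x ∈ cube s Q →
      x ∉ ⋃ P ∈ generation J Q₀ (l + N), cube s P →
      G Q ≤ A * ∑ j ∈ Finset.range N, ∑' P : Idx n,
        if P ∈ generation J Q₀ (l + j) ∧ x ∈ cube s P then a P else 0 := by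
  induction N with
  | zero =>
    intro l Q hQ hx hxn
    exact absurd (mem_biUnion hQ hx) hxn
  | succ N ih =>
    intro l Q hQ hx hxn
    have hterm : a Q ≤ ∑' P : Idx n,
        if P ∈ generation J Q₀ (l + 0) ∧ x ∈ cube s P then a P else 0 := by
      refine le_trans ?_ (ENNReal.le_tsum Q)
      rw [if_pos ⟨hQ, hx⟩]
    -- The term `j = 0` pays for `Q`; the remaining ones are the sum for the child containing `x`,
    -- one generation further.
    rw [Finset.sum_range_succ', mul_add, add_comm]
    by_cases hxJ : x ∈ ⋃ P ∈ J Q, cube s P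
    · obtain ⟨P, hP, hxP⟩ := mem_iUnion₂.1 hxJ
      refine ((h Q hx).2 P hP hxP).trans (add_le_add (mul_le_mul_right hterm _) ?_)
      refine (ih (l + 1) P ⟨Q, hQ, hP⟩ hxP ?_).trans (le_of_eq ?_)
      · rwa [add_right_comm]
      · refine congrArg (A * ·) (Finset.sum_congr rfl fun j _ => ?_)
        rw [add_right_comm, add_assoc]
    · exact ((h Q hx).1 hxJ).trans ((mul_le_mul_right hterm _).trans le_self_add)

end Tree

/-- Monotone convergence along the directed family of finite subsets. It transfers the sparse bound,
proved for finite families, to the whole tree. -/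
theorem lintegral_tsum_rpow_mul_le {ι : Type*} [Countable ι] {a : ι → E n → ℝ≥0∞}
    (ha : ∀ i, Measurable (a i)) {W : E n → ℝ≥0∞} (hW : Measurable W) {p : ℝ} (hp : 0 < p)
    {M : ℝ≥0∞} (h : ∀ I : Finset ι, ∫⁻ x, (∑ i ∈ I, a i x) ^ p * W x ≤ M) :
    ∫⁻ x, (∑' i, a i x) ^ p * W x ≤ M := by
  have h1 : ∀ x, (∑' i, a i x) ^ p * W x = ⨆ I : Finset ι, (∑ i ∈ I, a i x) ^ p * W x := by
    intro x
    rw [ENNReal.tsum_eq_iSup_sum, ← ENNReal.orderIsoRpow_apply p hp, OrderIso.map_iSup,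
      ENNReal.iSup_mul]
    rfl
  simp_rw [h1]
  rw [lintegral_iSup_directed]
  · exact iSup_le h
  · intro I
    exact (((Finset.measurable_fun_sum I fun i _ => ha i).pow_const p).mul hW).aemeasurable
  · refine Monotone.directed_le fun I I' hII' x => ?_
    dsimp only
    gcongr

/-- Weighted bounds for bounded functions with bounded support. -/
theorem exists_weighted_bound (hT : IsSublinear T) (hT2 : BoundedOnL2 T) (hsup : SupCondition T)
    {r : ℝ} (hr : 1 ≤ r) {K : ℝ≥0∞} (hK1 : 1 ≤ K) (hKt : K ≠ ∞) (hWB : WeakBound T r K)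
    {q p : ℝ} (hq : 1 < q) (hp : p = q * r) {W : E n → ℝ≥0∞} {C : ℝ≥0∞} (hW : IsApWeight q W C) :
    ∃ M : ℝ≥0∞, M ≠ ∞ ∧ ∀ f : Lp 𝕜 2 (volume : Measure (E n)),
      (∃ R : ℝ, IsBoundedSupportedOn f (ball 0 R)) →
      ∫⁻ x, ‖T f x‖ₑ ^ p * W x ≤ M * ∫⁻ x, ‖f x‖ₑ ^ p * W x := by
  classical
  have hr0 : 0 < r := by linarith
  have hp0 : 0 < p := by rw [hp]; positivity
  obtain ⟨A, hAt, hA⟩ := exists_sparse_children hT hT2 hsup hr hK1 hKt hWB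
  -- The enlarged ball measures `4 ^ n * cubeConst n` times its cube, and the cube at most twice its
  -- part outside the children.
  obtain ⟨M, hMt, hM⟩ := hW.exists_sparse_bound hq hr hp (L := 4 ^ n * cubeConst n * 2)
    (by have := cubeConst_ne_top n; finiteness)
  refine ⟨A ^ p * M, ENNReal.mul_ne_top (ENNReal.rpow_ne_top_of_nonneg hp0.le hAt) hMt, ?_⟩
  intro f hf
  obtain ⟨R, hfR⟩ := id hf
  have hfr : ∀ c ρ, ∫⁻ y in ball c ρ, ‖f y‖ₑ ^ r ≠ ∞ := by
    intro c ρ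
    have h1 : ∀ᵐ y, ‖f y‖ₑ ≤ eLpNorm f ∞ volume := by
      rw [eLpNorm_exponent_top]; exact enorm_ae_le_eLpNormEssSup f volume
    refine ne_top_of_le_ne_top ?_ (lintegral_mono_ae (g := fun _ => eLpNorm f ∞ volume ^ r)
      (ae_restrict_of_ae (h1.mono fun y hy => ENNReal.rpow_le_rpow hy hr0.le)))
    rw [setLIntegral_const]
    exact ENNReal.mul_ne_top (ENNReal.rpow_ne_top_of_nonneg hr0.le hfR.1.2.ne)
      (volume_ball_ne_top _ _)
  have hcube : ∀ s : ℝ, 0 < s → R ≤ s → ∫⁻ x in cube s ((0, 0) : Idx n), ‖T f x‖ₑ ^ p * W x ≤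
      A ^ p * M * ∫⁻ x, ‖f x‖ₑ ^ p * W x := by
    intro s hs hRs
    choose J hsub hdisj hvol hae using hA f hf s hs
    set Q₀ : Idx n := (0, 0) with hQ₀
    -- The enlarged ball of the root has radius `4(n+1)s ≥ R` and so contains the support of `f`.
    have hroot : cut (measurableSet_cubeBall s Q₀) f = f := by
      refine Lp.ext ?_
      filter_upwards [coeFn_cut (measurableSet_cubeBall s Q₀) f, hfR.2] with x hx hx0
      rw [hx]
      by_cases hxB : x ∈ cubeBall s Q₀
      · rw [indicator_of_mem hxB]
      · rw [indicator_of_notMem hxB, hx0]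
        refine fun hxR => hxB ?_
        have hc : cubeCenter s Q₀ = 0 := by
          ext i
          simp [cubeCenter, hQ₀]
        rw [cubeBall, hc]
        refine ball_subset_ball ?_ hxR
        simp only [cubeRadius, hQ₀, pow_zero, div_one]
        nlinarith [(Nat.cast_nonneg n : (0 : ℝ) ≤ n)]
    set a : ℕ × Idx n → E n → ℝ≥0∞ := fun i x =>
      if i.2 ∈ generation J Q₀ i.1 then
        (cubeBall s i.2).indicator (fun _ => cubeAvg r s f i.2) x else 0 with ha
    have hdom : ∀ᵐ x, x ∈ cube s Q₀ → ‖T f x‖ₑ ≤ A * ∑' i, a i x := by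
      filter_upwards [ae_all_iff.2 hae, ae_exists_notMem_generation Q₀ hs hsub hdisj hvol]
        with x hx hN hxQ
      obtain ⟨N, hN⟩ := hN
      have h1 := le_sum_generation (s := s) Q₀ (J := J) (A := A) (x := x)
        (G := fun Q => ‖T (cut (measurableSet_cubeBall s Q) f) x‖ₑ)
        (a := fun Q => cubeAvg r s f Q) hx N 0 Q₀ rfl hxQ (by rwa [zero_add])
      simp only [hroot, zero_add] at h1
      refine h1.trans (mul_le_mul_right ?_ _)
      rw [show ∑' i, a i x = ∑' l, ∑' P, a (l, P) x from
        ENNReal.tsum_prod (f := fun l P => a (l, P) x)]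
      refine le_trans ?_ (ENNReal.sum_le_tsum (Finset.range N))
      refine Finset.sum_le_sum fun j _ => ENNReal.tsum_le_tsum fun P => ?_
      simp only [ha]
      by_cases hP : P ∈ generation J Q₀ j
      · by_cases hxP : x ∈ cube s P
        · simp [hP, hxP, cube_subset_cubeBall hs P hxP]
        · simp [hxP]
      · simp [hP]
    have ham : ∀ i, Measurable (a i) := by
      intro i
      by_cases hi : i.2 ∈ generation J Q₀ i.1
      · simp only [ha, hi, if_true]
        exact measurable_const.indicator (measurableSet_cubeBall s _)
      · simp only [ha, hi, if_false]
        exact measurable_const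
    have hsum : ∫⁻ x, (∑' i, a i x) ^ p * W x ≤ M * ∫⁻ x, ‖f x‖ₑ ^ p * W x := by
      refine lintegral_tsum_rpow_mul_le ham hW.measurable hp0 fun I => ?_
      have hI := hM (I.filter fun i => i.2 ∈ generation J Q₀ i.1) (fun i => cubeCenter s i.2)
        (fun i => 4 * cubeRadius s i.2) (fun i => cube s i.2 \ ⋃ P ∈ J i.2, cube s P)
        (fun x => ‖f x‖ₑ) (measurable_enorm_Lp f) ?_ ?_
      · refine le_trans (le_of_eq (lintegral_congr fun x => ?_)) hI
        rw [Finset.sum_filter]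
        rfl
      · intro i _
        have hJm : MeasurableSet (⋃ P ∈ J i.2, cube s P) :=
          MeasurableSet.biUnion (to_countable _) fun P _ => measurableSet_cube s P
        refine ⟨by linarith [cubeRadius_pos hs i.2], (measurableSet_cube s _).diff hJm,
          sdiff_subset.trans (cube_subset_cubeBall hs i.2), ?_, hfr _ _⟩
        change volume (cubeBall s i.2) ≤ _
        rw [volume_cubeBall_eq hs, mul_assoc _ 2]
        refine mul_le_mul_right ?_ _
        have hQt := volume_cube_ne_top hs i.2
        have h1 : volume (cube s i.2) ≤ volume (cube s i.2 \ ⋃ P ∈ J i.2, cube s P) +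
            2⁻¹ * volume (cube s i.2) := by
          refine (measure_le_inter_add_sdiff volume (cube s i.2) (⋃ P ∈ J i.2, cube s P)).trans ?_
          rw [add_comm]
          gcongr
          exact (measure_mono inter_subset_right).trans (hvol i.2)
        have h2 : volume (cube s i.2) =
            2⁻¹ * volume (cube s i.2) + 2⁻¹ * volume (cube s i.2) := by
          rw [← add_mul, ENNReal.inv_two_add_inv_two, one_mul]
        have h3 : 2⁻¹ * volume (cube s i.2) ≤ volume (cube s i.2 \ ⋃ P ∈ J i.2, cube s P) := by
          nth_rewrite 1 [h2] at h1
          exact (ENNReal.add_le_add_iff_right (ENNReal.mul_ne_top (by norm_num) hQt)).1 h1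
        calc volume (cube s i.2) = 2 * (2⁻¹ * volume (cube s i.2)) := by
              rw [← mul_assoc, ENNReal.mul_inv_cancel (by norm_num) (by norm_num), one_mul]
          _ ≤ _ := by gcongr
      · intro i hi j hj hij
        rw [Finset.mem_coe, Finset.mem_filter] at hi hj
        exact generation_diff_disjoint Q₀ hsub hdisj hi.2 hj.2 hij
    calc ∫⁻ x in cube s Q₀, ‖T f x‖ₑ ^ p * W x
        ≤ ∫⁻ x in cube s Q₀, A ^ p * ((∑' i, a i x) ^ p * W x) := by
          refine lintegral_mono_ae ((ae_restrict_iff' (measurableSet_cube s Q₀)).2 ?_)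
          filter_upwards [hdom] with x hx hxQ
          rw [← mul_assoc, ← ENNReal.mul_rpow_of_nonneg _ _ hp0.le]
          gcongr
          exact hx hxQ
      _ ≤ ∫⁻ x, A ^ p * ((∑' i, a i x) ^ p * W x) := setLIntegral_le_lintegral _ _
      _ = A ^ p * ∫⁻ x, (∑' i, a i x) ^ p * W x :=
          lintegral_const_mul' _ _ (ENNReal.rpow_ne_top_of_nonneg hp0.le hAt)
      _ ≤ A ^ p * (M * ∫⁻ x, ‖f x‖ₑ ^ p * W x) := by gcongr
      _ = _ := (mul_assoc _ _ _).symm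
  have hmono : Monotone fun N : ℕ => ball (0 : E n) N := fun N N' h =>
    ball_subset_ball (by exact_mod_cast h)
  have huniv : ⋃ N : ℕ, ball (0 : E n) N = univ := iUnion_ball_nat 0
  rw [← setLIntegral_univ, ← huniv, ← withDensity_apply _ (MeasurableSet.iUnion fun _ =>
    measurableSet_ball), hmono.measure_iUnion]
  refine iSup_le fun N => ?_
  rw [withDensity_apply _ measurableSet_ball]
  -- The bound does not depend on `s`: a root cube containing `ball 0 N`, and large compared with
  -- the support of `f`, is used for each `N`.
  set s : ℝ := max (2 * N) (max R 1) with hs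
  have hs1 : 1 ≤ s := le_max_of_le_right (le_max_right _ _)
  refine (lintegral_mono_set (Subset.trans ?_ (ball_subset_cube_zero (s := s) (by linarith)))).trans
    (hcube s (by linarith) (le_max_of_le_right (le_max_left _ _)))
  refine ball_subset_ball ?_
  have : 2 * (N : ℝ) ≤ s := le_max_left _ _
  linarith

end CZO

/-! ### Calderón–Zygmund decomposition -/

namespace CZO

open Set Filter Topology

variable {n : ℕ} {𝕜 : Type*} [RCLike 𝕜]
  {T : Lp 𝕜 2 (volume : Measure (E n)) → Lp 𝕜 2 (volume : Measure (E n))}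

theorem lintegral_enorm_rpow_two (f : Lp 𝕜 2 (volume : Measure (E n))) :
    ∫⁻ x, ‖f x‖ₑ ^ (2 : ℝ) = ‖f‖ₑ ^ (2 : ℝ) := by
  rw [Lp.enorm_def, eLpNorm_eq_lintegral_rpow_enorm_toReal (by norm_num) (by norm_num),
    ← ENNReal.rpow_mul]
  norm_num

/-- `max C 1` covers a negative `C` and provides the normalisation `1 ≤ K` wanted in the sparse
domination. -/
theorem BoundedOnL2.exists_lintegral_le (hT : BoundedOnL2 T) :
    ∃ K : ℝ≥0∞, 1 ≤ K ∧ K ≠ ∞ ∧ ∀ f : Lp 𝕜 2 (volume : Measure (E n)),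
      ∫⁻ x, ‖T f x‖ₑ ^ (2 : ℝ) ≤ K * ∫⁻ x, ‖f x‖ₑ ^ (2 : ℝ) := by
  obtain ⟨C, hC⟩ := hT
  have hpos : 0 ≤ max C 1 := le_max_of_le_right zero_le_one
  refine ⟨ENNReal.ofReal (max C 1) ^ (2 : ℝ), ?_, by finiteness, fun f => ?_⟩
  · refine ENNReal.one_le_rpow ?_ (by norm_num)
    rw [← ENNReal.ofReal_one]
    exact ENNReal.ofReal_le_ofReal (le_max_right _ _)
  · rw [lintegral_enorm_rpow_two, lintegral_enorm_rpow_two,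
      ← ENNReal.mul_rpow_of_nonneg _ _ (by norm_num)]
    refine ENNReal.rpow_le_rpow ?_ (by norm_num)
    rw [← ofReal_norm, ← ofReal_norm, ← ENNReal.ofReal_mul hpos]
    refine ENNReal.ofReal_le_ofReal ((hC f).trans ?_)
    gcongr
    exact le_max_left _ _

theorem rpow_mul_volume_lt_le {G : E n → ℝ≥0∞} (hG : Measurable G) {r : ℝ} (hr : 0 < r)
    (t : ℝ≥0∞) : t ^ r * volume {x | t < G x} ≤ ∫⁻ x, G x ^ r := by
  refine le_trans ?_ (mul_meas_ge_le_lintegral (hG.pow_const r) (t ^ r))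
  refine mul_le_mul_right (measure_mono fun x hx => ?_) _
  exact ENNReal.rpow_le_rpow (le_of_lt hx) hr.le

theorem IsSublinear.enorm_sum_le (hT : IsSublinear T) (hT2 : BoundedOnL2 T) {ι : Type*}
    (I : Finset ι) (b : ι → Lp 𝕜 2 (volume : Measure (E n))) :
    ∀ᵐ x, ‖T (∑ i ∈ I, b i) x‖ₑ ≤ ∑ i ∈ I, ‖T (b i) x‖ₑ := by
  classical
  induction I using Finset.induction_on with
  | empty =>
    rw [Finset.sum_empty, hT2.map_zero]
    filter_upwards with x
    simp
  | insert i I hi ih =>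
    rw [Finset.sum_insert hi]
    filter_upwards [ih, hT.enorm_add_le (b i) (∑ j ∈ I, b j)] with x h1 h2
    rw [Finset.sum_insert hi]
    exact h2.trans (add_le_add le_rfl h1)

/-- Lebesgue differentiation along dyadic cubes. -/
theorem ae_enorm_le_of_cubes {f : E n → 𝕜} (hf : LocallyIntegrable f volume) {s : ℝ} (hs : 0 < s)
    (t : ℝ≥0∞) : ∀ᵐ x, (∀ k, ∫⁻ y in cube s (k, cubeIdx s k x), ‖f y‖ₑ ≤
      t * volume (cube s (k, cubeIdx s k x))) → ‖f x‖ₑ ≤ t := by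
  filter_upwards [(IsUnifLocDoublingMeasure.vitaliFamily (volume : Measure (E n))
    1).ae_tendsto_lintegral_enorm_sub_div hf] with x hx hcube
  set δ : ℕ → ℝ := fun k => 2 * ((n + 1) * (s / 2 ^ k)) with hδ
  have hδpos : ∀ k, 0 < δ k := fun k => by positivity
  have hδlim : Tendsto δ atTop (𝓝[>] 0) := by
    refine tendsto_nhdsWithin_iff.2 ⟨?_, Eventually.of_forall hδpos⟩
    have : Tendsto δ atTop (𝓝 (2 * ((n + 1) * 0))) := by
      refine Tendsto.const_mul _ (Tendsto.const_mul _ ?_)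
      exact tendsto_const_nhds.div_atTop (tendsto_pow_atTop_atTop_of_one_lt (by norm_num))
    simpa using this
  have hlim := hx.comp (IsUnifLocDoublingMeasure.tendsto_closedBall_filterAt
    (volume : Measure (E n)) (K := 1) (x := x) (fun _ => x) δ hδlim
    (Eventually.of_forall fun k => by
      rw [one_mul]; exact mem_closedBall_self (hδpos k).le))
  have hκ := cubeConst_ne_top n
  have hlim2 : Tendsto (fun k => 4 ^ n * cubeConst n * ((∫⁻ y in closedBall x (δ k), ‖f y - f x‖ₑ) /
      volume (closedBall x (δ k))) + t) atTop (𝓝 (4 ^ n * cubeConst n * 0 + t)) :=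
    (ENNReal.Tendsto.const_mul hlim (Or.inr (by finiteness))).add tendsto_const_nhds
  rw [mul_zero, zero_add] at hlim2
  refine ge_of_tendsto' hlim2 fun k => ?_
  set Q : Idx n := (k, cubeIdx s k x) with hQ
  have hxQ : x ∈ cube s Q := mem_cube_self s k x
  have hQ0 := volume_cube_ne_zero hs Q
  have hQt := volume_cube_ne_top hs Q
  have hsub : cube s Q ⊆ closedBall x (δ k) := by
    intro y hy
    have h1 := mem_ball.1 (cube_subset_ball hs Q hy)
    have h2 := mem_ball.1 (cube_subset_ball hs Q hxQ)
    have h3 := dist_triangle_right y x (cubeCenter s Q)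
    simp only [cubeRadius, hQ] at h1 h2
    rw [mem_closedBall]
    simp only [hδ]
    linarith
  -- Cube and ball have comparable measure, so differentiation along balls passes to the cubes.
  have hvolB : volume (closedBall x (δ k)) ≤ 4 ^ n * cubeConst n * volume (cube s Q) := by
    have : volume (ball x (4 * cubeRadius s Q)) = 4 ^ n * cubeConst n * volume (cube s Q) := by
      rw [volume_mul_cubeBall hs Q _ (by norm_num), ENNReal.ofReal_ofNat]
    rw [← this]
    refine measure_mono (closedBall_subset_ball ?_)
    have : 0 < (n + 1) * (s / 2 ^ k) := by positivity
    simp only [hδ, cubeRadius, hQ]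
    linarith
  have hB0 : volume (closedBall x (δ k)) ≠ 0 := (measure_closedBall_pos _ _ (hδpos k)).ne'
  have hBt : volume (closedBall x (δ k)) ≠ ∞ := measure_closedBall_lt_top.ne
  set D := ∫⁻ y in closedBall x (δ k), ‖f y - f x‖ₑ with hD
  refine (ENNReal.mul_le_mul_iff_left hQ0 hQt).1 ?_
  calc ‖f x‖ₑ * volume (cube s Q) = ∫⁻ y in cube s Q, ‖f x‖ₑ := by rw [setLIntegral_const]
    _ ≤ ∫⁻ y in cube s Q, (‖f y - f x‖ₑ + ‖f y‖ₑ) := by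
        refine lintegral_mono fun y => ?_
        have : f x = -(f y - f x) + f y := by ring
        nth_rewrite 1 [this]
        refine (enorm_add_le _ _).trans ?_
        rw [enorm_neg]
    _ ≤ (∫⁻ y in cube s Q, ‖f y - f x‖ₑ) + ∫⁻ y in cube s Q, ‖f y‖ₑ := by
        rw [lintegral_add_left']
        exact ((hf.aestronglyMeasurable.sub aestronglyMeasurable_const).enorm).restrict
    _ ≤ D + t * volume (cube s Q) := add_le_add (lintegral_mono_set hsub) (hcube k)
    _ = D / volume (closedBall x (δ k)) * volume (closedBall x (δ k)) +
        t * volume (cube s Q) := by rw [ENNReal.div_mul_cancel hB0 hBt]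
    _ ≤ D / volume (closedBall x (δ k)) * (4 ^ n * cubeConst n * volume (cube s Q)) +
        t * volume (cube s Q) := by gcongr
    _ = _ := by ring

section CalderonZygmund

variable {s : ℝ} (hs : 0 < s) (f : Lp 𝕜 2 (volume : Measure (E n))) (P : Idx n)

/-- The mean of `f` over a dyadic cube. -/
def cubeMean (s : ℝ) (f : Lp 𝕜 2 (volume : Measure (E n))) (P : Idx n) : 𝕜 :=
  ⨍ x in cube s P, f x

theorem enorm_cubeMean_le : ‖cubeMean s f P‖ₑ ≤
    (volume (cube s P))⁻¹ * ∫⁻ x in cube s P, ‖f x‖ₑ := by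
  rw [cubeMean, setAverage_eq']
  refine (enorm_integral_le_lintegral_enorm _).trans ?_
  rw [lintegral_smul_measure, smul_eq_mul]

/-- The part of `f` with mean zero that lives on a dyadic cube. -/
def badPart (hs : 0 < s) (f : Lp 𝕜 2 (volume : Measure (E n))) (P : Idx n) :
    Lp 𝕜 2 (volume : Measure (E n)) :=
  cut (measurableSet_cube s P) f -
    indicatorConstLp 2 (measurableSet_cube s P) (volume_cube_ne_top hs P) (cubeMean s f P)

theorem coeFn_badPart : badPart hs f P =ᵐ[volume]
    (cube s P).indicator fun x => f x - cubeMean s f P := by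
  filter_upwards [Lp.coeFn_sub (cut (measurableSet_cube s P) f)
    (indicatorConstLp 2 (measurableSet_cube s P) (volume_cube_ne_top hs P) (cubeMean s f P)),
    coeFn_cut (measurableSet_cube s P) f, indicatorConstLp_coeFn (p := 2)
      (hs := measurableSet_cube s P) (hμs := volume_cube_ne_top hs P) (c := cubeMean s f P)]
    with x h1 h2 h3
  rw [badPart, h1, Pi.sub_apply, h2, h3]
  by_cases hx : x ∈ cube s P <;> simp [hx]

theorem isBoundedSupportedOn_badPart {R : Set (E n)} (hf : IsBoundedSupportedOn f R) :
    IsBoundedSupportedOn (badPart hs f P) (ball (cubeCenter s P) (cubeRadius s P)) := by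
  constructor
  · rw [memLp_congr_ae (coeFn_badPart hs f P)]
    have h1 := hf.1.indicator (measurableSet_cube s P)
    have h2 := memLp_indicator_const (μ := volume) ∞ (measurableSet_cube s P) (cubeMean s f P)
      (Or.inr (volume_cube_ne_top hs P))
    have h3 := h1.sub h2
    have : (cube s P).indicator (fun x => f x - cubeMean s f P) =
        (cube s P).indicator f - (cube s P).indicator fun _ => cubeMean s f P := by
      ext x
      by_cases hx : x ∈ cube s P <;> simp [hx]
    rwa [this]
  · filter_upwards [coeFn_badPart hs f P] with x hx hxb
    rw [hx, indicator_of_notMem fun h => hxb (cube_subset_ball hs P h)]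

theorem integrableOn_cube {s : ℝ} (hs : 0 < s) (f : Lp 𝕜 2 (volume : Measure (E n)))
    (P : Idx n) : IntegrableOn f (cube s P) volume := by
  have : IsFiniteMeasure (volume.restrict (cube s P)) :=
    isFiniteMeasure_restrict.2 (volume_cube_ne_top hs P)
  exact ((Lp.memLp f).restrict (cube s P)).integrable (by norm_num)

theorem integral_badPart : ∫ x, badPart hs f P x = 0 := by
  have : IsFiniteMeasure (volume.restrict (cube s P)) :=
    isFiniteMeasure_restrict.2 (volume_cube_ne_top hs P)
  rw [integral_congr_ae (coeFn_badPart hs f P), integral_indicator (measurableSet_cube s P),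
    integral_sub (integrableOn_cube hs f P) (integrable_const _), cubeMean, setIntegral_const,
    setAverage_eq, smul_smul, mul_inv_cancel₀, one_smul, sub_self]
  rw [Measure.real, ENNReal.toReal_ne_zero]
  exact ⟨volume_cube_ne_zero hs P, volume_cube_ne_top hs P⟩

theorem lintegral_badPart_le : ∫⁻ x, ‖badPart hs f P x‖ₑ ≤ 2 * ∫⁻ x in cube s P, ‖f x‖ₑ := by
  calc ∫⁻ x, ‖badPart hs f P x‖ₑ = ∫⁻ x in cube s P, ‖f x - cubeMean s f P‖ₑ := by
        rw [← lintegral_indicator (measurableSet_cube s P)]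
        refine lintegral_congr_ae ?_
        filter_upwards [coeFn_badPart hs f P] with x hx
        rw [hx]
        by_cases hxP : x ∈ cube s P <;> simp [hxP]
    _ ≤ ∫⁻ x in cube s P, (‖f x‖ₑ + ‖cubeMean s f P‖ₑ) :=
        lintegral_mono fun x => enorm_sub_le
    _ = (∫⁻ x in cube s P, ‖f x‖ₑ) + ‖cubeMean s f P‖ₑ * volume (cube s P) := by
        rw [lintegral_add_left (measurable_enorm_Lp f), setLIntegral_const]
    _ ≤ (∫⁻ x in cube s P, ‖f x‖ₑ) + ((volume (cube s P))⁻¹ * ∫⁻ x in cube s P, ‖f x‖ₑ) *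
        volume (cube s P) := by
        gcongr
        exact enorm_cubeMean_le f P
    _ = _ := by
        rw [mul_right_comm, ENNReal.inv_mul_cancel (volume_cube_ne_zero hs P)
          (volume_cube_ne_top hs P), one_mul, two_mul]

end CalderonZygmund

/-- The Calderón–Zygmund argument for a function that lives on a large dyadic cube. -/
theorem mul_volume_two_mul_lt_le (hT : IsSublinear T) (hT2 : BoundedOnL2 T) {K₂ : ℝ≥0∞}
    (hK₂ : ∀ f : Lp 𝕜 2 (volume : Measure (E n)),
      ∫⁻ x, ‖T f x‖ₑ ^ (2 : ℝ) ≤ K₂ * ∫⁻ x, ‖f x‖ₑ ^ (2 : ℝ)) {C : ℝ≥0∞}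
    (hC : ∀ (c : E n) (r : ℝ), 0 < r → ∀ f : Lp 𝕜 2 (volume : Measure (E n)),
      IsBoundedSupportedOn f (ball c r) → ∫ x, f x = 0 →
      ∫⁻ x in (ball c (4 * r))ᶜ, ‖T f x‖ₑ ≤ C * ∫⁻ x in ball c r, ‖f x‖ₑ)
    {f : Lp 𝕜 2 (volume : Measure (E n))} {s : ℝ} (hs : 0 < s) {Q₀ : Idx n}
    (hf : IsBoundedSupportedOn f (cube s Q₀)) {t : ℝ≥0∞} (ht0 : t ≠ 0) (ht : t ≠ ∞)
    (hsmall : ∫⁻ x, ‖f x‖ₑ ≤ t * volume (cube s Q₀)) :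
    t * volume {x | 2 * t < ‖T f x‖ₑ} ≤
      (4 ^ n * cubeConst n + 2 * C + K₂ * (2 + 2 ^ n)) * ∫⁻ x, ‖f x‖ₑ := by
  classical
  set I := ∫⁻ x, ‖f x‖ₑ with hI
  have hIt : I ≠ ∞ := ne_top_of_le_ne_top (ENNReal.mul_ne_top ht (volume_cube_ne_top hs Q₀)) hsmall
  set bad : Idx n → Prop := fun P => t * volume (cube s P) < ∫⁻ x in cube s P, ‖f x‖ₑ with hbad
  have hQ₀ : ¬ bad Q₀ := not_lt.2 ((setLIntegral_le_lintegral _ _).trans hsmall)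
  obtain ⟨J, hJ, hdisj, hcov⟩ := exists_stopping_cubes s Q₀ bad hQ₀
  have hJc : J.Countable := to_countable J
  set Ω := ⋃ P ∈ J, cube s P with hΩ
  have hlow : ∀ P ∈ J, t * volume (cube s P) ≤ ∫⁻ x in cube s P, ‖f x‖ₑ := fun P hP =>
    (hJ P hP).1.le
  have hup : ∀ P ∈ J, ∫⁻ x in cube s P, ‖f x‖ₑ ≤ 2 ^ n * t * volume (cube s P) := by
    intro P hP
    obtain ⟨-, -, -, R, hR, hRP, hPR, -⟩ := hJ P hP
    rw [hbad, not_lt, volume_cube_succ hs hRP] at hR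
    refine (lintegral_mono_set hPR).trans (hR.trans (le_of_eq ?_))
    ring
  have hoff : ∀ᵐ x, x ∉ Ω → ‖f x‖ₑ ≤ t := by
    filter_upwards [hf.2, ae_enorm_le_of_cubes ((Lp.memLp f).locallyIntegrable (by norm_num)) hs t]
      with x hx0 hx hxΩ
    by_cases hxQ : x ∈ cube s Q₀
    · refine hx fun k => ?_
      by_cases hk : Q₀.1 ≤ k
      · by_contra! hlt
        exact hxΩ (hcov x hxQ k hk hlt)
      · push Not at hk
        -- Cubes coarser than `Q₀` are not covered by the selection; for them the smallness of the
        -- total mass suffices.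
        have hsub : cube s Q₀ ⊆ cube s (k, cubeIdx s k x) :=
          cube_subset_of_mem hk.le hxQ (mem_cube_self s k x)
        refine (setLIntegral_le_lintegral _ _).trans (hsmall.trans ?_)
        gcongr
    · simp [hx0 hxQ]
  -- a finite subfamily that carries most of the mass
  have hsumF2 : ∑' P : J, ∫⁻ x in cube s P.1, ‖f x‖ₑ ^ (2 : ℝ) ≠ ∞ := by
    rw [← lintegral_biUnion hJc (fun P _ => measurableSet_cube s P) hdisj]
    refine ne_top_of_le_ne_top ?_ (setLIntegral_le_lintegral _ _)
    rw [lintegral_enorm_rpow_two]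
    finiteness
  -- Subadditivity of `T` handles finite sums only. The cubes outside `S` remain in the good part,
  -- where an `L²` mass of `t * I` is affordable; `I = 0` is separate, since the tail argument needs
  -- a positive bound.
  obtain ⟨S, hS⟩ : ∃ S : Finset J, ∑' P : {P : J // P ∉ S},
      ∫⁻ x in cube s P.1.1, ‖f x‖ₑ ^ (2 : ℝ) ≤ t * I := by
    rcases eq_or_ne I 0 with h0 | h0
    · refine ⟨∅, ?_⟩
      have hfz : ∀ᵐ x, ‖f x‖ₑ ^ (2 : ℝ) = 0 := by
        have := (lintegral_eq_zero_iff (measurable_enorm_Lp f)).1 h0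
        filter_upwards [this] with x hx
        rw [hx]; simp
      have : ∀ P : {P : J // P ∉ (∅ : Finset J)},
          ∫⁻ x in cube s P.1.1, ‖f x‖ₑ ^ (2 : ℝ) = 0 := fun P => by
        rw [lintegral_congr_ae (ae_restrict_of_ae hfz), lintegral_zero]
      exact (ENNReal.tsum_eq_zero.2 this).le.trans zero_le
    · have hlim := ENNReal.tendsto_tsum_compl_atTop_zero hsumF2
      have hpos : 0 < t * I := pos_iff_ne_zero.2 (mul_ne_zero ht0 h0)
      obtain ⟨S, hS⟩ := (hlim.eventually (gt_mem_nhds hpos)).exists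
      exact ⟨S, hS.le⟩
  set ΩS := ⋃ P ∈ S, cube s P.1 with hΩS
  have hdisjS : (S : Set J).PairwiseDisjoint fun P => cube s P.1 := fun P _ P' _ hne =>
    hdisj P.2 P'.2 fun h => hne (Subtype.ext h)
  have hΩSm : MeasurableSet ΩS := S.measurableSet_biUnion fun P _ => measurableSet_cube s P.1
  have hΩm : MeasurableSet Ω := MeasurableSet.biUnion hJc fun P _ => measurableSet_cube s P
  have htail : ∫⁻ x in Ω \ ΩS, ‖f x‖ₑ ^ (2 : ℝ) ≤ t * I := by
    refine le_trans (le_trans (lintegral_mono_set ?_) (lintegral_iUnion_le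
      (fun P : {P : J // P ∉ S} => cube s P.1.1) _)) hS
    rintro x ⟨hxΩ, hxS⟩
    obtain ⟨P, hP, hxP⟩ := mem_iUnion₂.1 hxΩ
    refine mem_iUnion.2 ⟨⟨⟨P, hP⟩, fun hPS => hxS ?_⟩, hxP⟩
    exact mem_biUnion (x := (⟨P, hP⟩ : J)) hPS hxP
  set b : J → Lp 𝕜 2 (volume : Measure (E n)) := fun P => badPart hs f P.1 with hb
  set g := f - ∑ P ∈ S, b P with hg
  have hSI : ∑ P ∈ S, ∫⁻ x in cube s P.1, ‖f x‖ₑ ≤ I := by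
    rw [← lintegral_biUnion_finset hdisjS fun P _ => measurableSet_cube s P.1]
    exact setLIntegral_le_lintegral _ _
  -- the good part
  have hgae : ∀ᵐ x, ‖g x‖ₑ ^ (2 : ℝ) ≤ t * ‖f x‖ₑ +
      (Ω \ ΩS).indicator (fun x => ‖f x‖ₑ ^ (2 : ℝ)) x +
      ∑ P ∈ S, (cube s P.1).indicator (fun _ => ‖cubeMean s f P.1‖ₑ ^ (2 : ℝ)) x := by
    have hbae : ∀ᵐ x, ∀ P : J, b P x =
        (cube s P.1).indicator (fun x => f x - cubeMean s f P.1) x :=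
      ae_all_iff.2 fun P => coeFn_badPart hs f P.1
    have hsum : ∀ᵐ x, (∑ P ∈ S, b P : Lp 𝕜 2 (volume : Measure (E n))) x = ∑ P ∈ S, b P x := by
      filter_upwards [Lp.coeFn_finsetSum S b] with x hx
      rw [hx, Finset.sum_apply]
    filter_upwards [hbae, hsum, Lp.coeFn_sub f (∑ P ∈ S, b P), hoff] with x h1 h2 h3 h4
    rw [hg, h3, Pi.sub_apply, h2]
    -- On a cube of `S` the good part is the mean of `f`. Elsewhere it is `f`: of small `L²` mass on
    -- the discarded cubes, and at most `t` off `Ω`.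
    by_cases hxS : x ∈ ΩS
    · obtain ⟨P, hP, hxP⟩ := mem_iUnion₂.1 hxS
      have e1 : ∑ P ∈ S, b P x = f x - cubeMean s f P.1 := by
        rw [Finset.sum_eq_single_of_mem P hP, h1, indicator_of_mem hxP]
        intro P' hP' hne
        rw [h1, indicator_of_notMem]
        exact fun h => Set.disjoint_left.1 (hdisjS hP' hP hne) h hxP
      rw [e1, sub_sub_cancel]
      refine le_trans ?_ le_add_self
      refine le_trans ?_ (Finset.single_le_sum (f := fun P : J => (cube s P.1).indicator
        (fun _ => ‖cubeMean s f P.1‖ₑ ^ (2 : ℝ)) x) (fun _ _ => zero_le) hP)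
      rw [indicator_of_mem hxP]
    · have e1 : ∑ P ∈ S, b P x = 0 := Finset.sum_eq_zero fun P hP => by
        rw [h1, indicator_of_notMem fun h => hxS (mem_biUnion hP h)]
      rw [e1, sub_zero]
      refine le_trans ?_ le_self_add
      by_cases hxΩ : x ∈ Ω
      · rw [indicator_of_mem (show x ∈ Ω \ ΩS from ⟨hxΩ, hxS⟩)]
        exact le_add_self
      · refine le_trans ?_ le_self_add
        rw [ENNReal.rpow_two, sq]
        gcongr
        exact h4 hxΩ
  have hmean : ∀ P ∈ S, ‖cubeMean s f P.1‖ₑ ^ (2 : ℝ) * volume (cube s P.1) ≤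
      2 ^ n * t * ∫⁻ x in cube s P.1, ‖f x‖ₑ := by
    intro P _
    have hP0 := volume_cube_ne_zero hs P.1
    have hPt := volume_cube_ne_top hs P.1
    have h1 := enorm_cubeMean_le (s := s) f P.1
    have h2 : ‖cubeMean s f P.1‖ₑ ≤ 2 ^ n * t := by
      refine h1.trans ((mul_le_mul_right (hup P.1 P.2) _).trans (le_of_eq ?_))
      rw [mul_left_comm, ENNReal.inv_mul_cancel hP0 hPt, mul_one]
    have h3 : ‖cubeMean s f P.1‖ₑ * volume (cube s P.1) ≤ ∫⁻ x in cube s P.1, ‖f x‖ₑ := by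
      refine (mul_le_mul_left h1 _).trans (le_of_eq ?_)
      rw [mul_right_comm, ENNReal.inv_mul_cancel hP0 hPt, one_mul]
    rw [ENNReal.rpow_two, sq, mul_assoc]
    exact mul_le_mul' h2 h3
  have hgint : ∫⁻ x, ‖g x‖ₑ ^ (2 : ℝ) ≤ (2 + 2 ^ n) * t * I := by
    have hfm := measurable_enorm_Lp f
    have hm1 : Measurable fun x => t * ‖f x‖ₑ := hfm.const_mul t
    have hm2 : Measurable ((Ω \ ΩS).indicator (fun x => ‖f x‖ₑ ^ (2 : ℝ))) :=
      (hfm.pow_const _).indicator (hΩm.diff hΩSm)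
    have hm12 : Measurable fun x => t * ‖f x‖ₑ +
        (Ω \ ΩS).indicator (fun x => ‖f x‖ₑ ^ (2 : ℝ)) x := hm1.add hm2
    refine (lintegral_mono_ae hgae).trans ?_
    rw [lintegral_add_left hm12, lintegral_add_left hm1, lintegral_const_mul _ hfm,
      lintegral_indicator (hΩm.diff hΩSm), lintegral_finsetSum _ fun P _ =>
        measurable_const.indicator (measurableSet_cube s P.1)]
    calc _ ≤ t * I + t * I + ∑ P ∈ S, 2 ^ n * t * ∫⁻ x in cube s P.1, ‖f x‖ₑ := by
          refine add_le_add (add_le_add le_rfl htail) (Finset.sum_le_sum fun P hP => ?_)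
          rw [lintegral_indicator (measurableSet_cube s P.1), setLIntegral_const]
          exact hmean P hP
      _ ≤ t * I + t * I + 2 ^ n * t * I := by
          rw [← Finset.mul_sum]
          gcongr
      _ = _ := by ring
  have hgood : t * volume {x | t < ‖T g x‖ₑ} ≤ K₂ * (2 + 2 ^ n) * I := by
    have h1 := (rpow_mul_volume_lt_le (measurable_enorm_Lp (T g)) (r := 2) (by norm_num) t).trans
      ((hK₂ g).trans (mul_le_mul_right hgint _))
    refine (ENNReal.mul_le_mul_iff_right ht0 ht).1 ?_
    rw [ENNReal.rpow_two, sq, mul_assoc] at h1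
    refine h1.trans (le_of_eq ?_)
    ring
  -- the exceptional set
  set Ωs := ⋃ P ∈ S, cubeBall s P.1 with hΩs
  have hΩsm : MeasurableSet Ωs := S.measurableSet_biUnion fun P _ => measurableSet_cubeBall s P.1
  have hΩsv : t * volume Ωs ≤ 4 ^ n * cubeConst n * I := by
    calc t * volume Ωs ≤ t * ∑ P ∈ S, volume (cubeBall s P.1) := by
          gcongr
          exact measure_biUnion_finset_le _ _
      _ = 4 ^ n * cubeConst n * ∑ P ∈ S, t * volume (cube s P.1) := by
          rw [Finset.mul_sum, Finset.mul_sum]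
          refine Finset.sum_congr rfl fun P _ => ?_
          rw [volume_cubeBall_eq hs]; ring
      _ ≤ 4 ^ n * cubeConst n * ∑ P ∈ S, ∫⁻ x in cube s P.1, ‖f x‖ₑ := by
          gcongr with P hP
          exact hlow P.1 P.2
      _ ≤ _ := by gcongr
  -- the bad part
  have hbadint : ∫⁻ x in Ωsᶜ, ∑ P ∈ S, ‖T (b P) x‖ₑ ≤ 2 * C * I := by
    rw [lintegral_finsetSum _ fun P _ => measurable_enorm_Lp (T (b P))]
    calc ∑ P ∈ S, ∫⁻ x in Ωsᶜ, ‖T (b P) x‖ₑ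
        ≤ ∑ P ∈ S, 2 * C * ∫⁻ x in cube s P.1, ‖f x‖ₑ := by
          refine Finset.sum_le_sum fun P hP => ?_
          calc ∫⁻ x in Ωsᶜ, ‖T (b P) x‖ₑ ≤ ∫⁻ x in (cubeBall s P.1)ᶜ, ‖T (b P) x‖ₑ :=
                lintegral_mono_set (compl_subset_compl.2
                  (subset_biUnion_of_mem (u := fun P : J => cubeBall s P.1) hP))
            _ ≤ C * ∫⁻ x in ball (cubeCenter s P.1) (cubeRadius s P.1), ‖b P x‖ₑ :=
                hC _ _ (cubeRadius_pos hs P.1) (b P) (isBoundedSupportedOn_badPart hs f P.1 hf)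
                  (integral_badPart hs f P.1)
            _ ≤ C * (2 * ∫⁻ x in cube s P.1, ‖f x‖ₑ) := by
                gcongr
                exact (setLIntegral_le_lintegral _ _).trans (lintegral_badPart_le hs f P.1)
            _ = _ := by ring
      _ = 2 * C * ∑ P ∈ S, ∫⁻ x in cube s P.1, ‖f x‖ₑ := by rw [Finset.mul_sum]
      _ ≤ _ := by gcongr
  have hbadm : t * volume ({x | t < ∑ P ∈ S, ‖T (b P) x‖ₑ} ∩ Ωsᶜ) ≤ 2 * C * I := by
    refine le_trans ?_ hbadint
    have hm : Measurable fun x => ∑ P ∈ S, ‖T (b P) x‖ₑ :=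
      Finset.measurable_fun_sum S fun P _ => measurable_enorm_Lp (T (b P))
    refine le_trans ?_ (mul_meas_ge_le_lintegral hm t)
    rw [← Measure.restrict_apply' hΩsm.compl]
    refine mul_le_mul_right (measure_mono fun x hx => ?_) _
    exact le_of_lt (show t < ∑ P ∈ S, ‖T (b P) x‖ₑ from hx)
  have hcover : ∀ᵐ x, 2 * t < ‖T f x‖ₑ →
      x ∈ {x | t < ‖T g x‖ₑ} ∪ (Ωs ∪ ({x | t < ∑ P ∈ S, ‖T (b P) x‖ₑ} ∩ Ωsᶜ)) := by
    have hfg : f = g + ∑ P ∈ S, b P := by rw [hg]; abel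
    filter_upwards [hT.enorm_add_le g (∑ P ∈ S, b P), hT.enorm_sum_le hT2 S b] with x h1 h2 h3
    rw [← hfg] at h1
    by_cases hxg : t < ‖T g x‖ₑ
    · exact Or.inl hxg
    · refine Or.inr ?_
      by_cases hxΩ : x ∈ Ωs
      · exact Or.inl hxΩ
      · refine Or.inr ⟨?_, hxΩ⟩
        by_contra hle
        rw [mem_ofPred_eq, not_lt] at hle
        rw [not_lt] at hxg
        have := h1.trans (add_le_add hxg (h2.trans hle))
        rw [← two_mul] at this
        exact absurd this (not_le.2 h3)
  calc t * volume {x | 2 * t < ‖T f x‖ₑ}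
      ≤ t * (volume {x | t < ‖T g x‖ₑ} + (volume Ωs +
          volume ({x | t < ∑ P ∈ S, ‖T (b P) x‖ₑ} ∩ Ωsᶜ))) := by
        refine mul_le_mul_right ((measure_mono_ae hcover).trans ?_) _
        exact (measure_union_le _ _).trans (add_le_add le_rfl (measure_union_le _ _))
    _ ≤ K₂ * (2 + 2 ^ n) * I + (4 ^ n * cubeConst n * I + 2 * C * I) := by
        rw [mul_add, mul_add]
        exact add_le_add hgood (add_le_add hΩsv hbadm)
    _ = _ := by ring

end CZO

/-! ### Weak type bounds and approximation -/

namespace CZO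

open Set Filter Topology

variable {n : ℕ} {𝕜 : Type*} [RCLike 𝕜]
  {T : Lp 𝕜 2 (volume : Measure (E n)) → Lp 𝕜 2 (volume : Measure (E n))}

/-- In dimension zero all cubes have measure 1, so no root cube can be made large; the weak type
bound then follows from the size of the space. -/
theorem volume_univ_of_dim_zero : volume (univ : Set (E 0)) = 1 := by
  have h1 : cube (n := 0) 1 (0, 0) = univ := by
    ext x
    simp [mem_cube_iff one_pos]
  rw [← h1, volume_cube one_pos, pow_zero]

theorem CancellationCondition.exists_weakBound (hcanc : CancellationCondition T)
    (hT : IsSublinear T) (hT2 : BoundedOnL2 T) :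
    ∃ K : ℝ≥0∞, 1 ≤ K ∧ K ≠ ∞ ∧ WeakBound T 1 K := by
  obtain ⟨C, hC⟩ := hcanc
  obtain ⟨K₂, hK1, hKt, hK₂⟩ := hT2.exists_lintegral_le
  set D : ℝ≥0∞ := 4 ^ n * cubeConst n + 2 * C + K₂ * (2 + 2 ^ n) with hD
  have hDt : D ≠ ∞ := by
    have := cubeConst_ne_top n
    finiteness
  have hD1 : 1 ≤ D := by
    refine le_trans ?_ le_add_self
    calc (1 : ℝ≥0∞) = 1 * 1 := (mul_one 1).symm
      _ ≤ K₂ * (2 + 2 ^ n) := by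
        refine mul_le_mul' hK1 (le_trans ?_ le_self_add)
        norm_num
  have h2D : D ≤ 2 * D := by rw [two_mul]; exact le_self_add
  refine ⟨2 * D, hD1.trans h2D, by finiteness, fun f hf t => ?_⟩
  obtain ⟨R, hfR⟩ := hf
  simp only [ENNReal.rpow_one]
  rcases eq_or_ne t 0 with ht0 | ht0
  · simp [ht0]
  rcases eq_or_ne t ∞ with ht | ht
  · simp [ht]
  set I := ∫⁻ x, ‖f x‖ₑ with hI
  have hIt : I ≠ ∞ := by
    have h1 : I = ∫⁻ x in ball 0 R, ‖f x‖ₑ := by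
      rw [← lintegral_indicator measurableSet_ball]
      refine lintegral_congr_ae ?_
      filter_upwards [hfR.2] with x hx
      by_cases hxb : x ∈ ball 0 R
      · rw [indicator_of_mem hxb]
      · rw [indicator_of_notMem hxb, hx hxb, enorm_zero]
    rw [h1]
    exact setLIntegral_enorm_Lp_ne_top f 0 R
  set τ := t / 2 with hτ
  have hτ2 : 2 * τ = t := ENNReal.mul_div_cancel (by norm_num) (by norm_num)
  have hτ0 : τ ≠ 0 := fun h => ht0 (by rw [← hτ2, h, mul_zero])
  have hτt : τ ≠ ∞ := fun h => ht (by rw [← hτ2, h]; simp)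
  by_cases hn : n = 0 ∧ τ < I
  · obtain ⟨hn, hlt⟩ := hn
    have hv : volume {x | t < ‖T f x‖ₑ} ≤ 1 := by
      subst hn
      exact (measure_mono (subset_univ _)).trans volume_univ_of_dim_zero.le
    calc t * volume {x | t < ‖T f x‖ₑ} ≤ t * 1 := mul_le_mul_right hv _
      _ = 2 * 1 * τ := by rw [← hτ2]; ring
      _ ≤ 2 * D * I := by gcongr
  -- Large enough that the cube contains the support and, as `s ≥ 1` gives `s ≤ s ^ n` for `n ≥ 1`,
  -- that the mean of `|f|` over it is at most `τ`.
  · set s := max (max (2 * R) 1) (I / τ).toReal with hs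
    have hs1 : 1 ≤ s := le_max_of_le_left (le_max_right _ _)
    have hs0 : 0 < s := one_pos.trans_le hs1
    have hRs : R ≤ s / 2 := by
      have : 2 * R ≤ s := le_max_of_le_left (le_max_left _ _)
      linarith
    have hsub : ball (0 : E n) R ⊆ cube s (0, 0) :=
      (ball_subset_ball hRs).trans (ball_subset_cube_zero hs0)
    have hfc : IsBoundedSupportedOn f (cube s (0, 0)) :=
      ⟨hfR.1, hfR.2.mono fun x hx hxc => hx fun h => hxc (hsub h)⟩
    have hsmall : I ≤ τ * volume (cube (n := n) s (0, 0)) := by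
      rw [volume_cube hs0, pow_zero, div_one]
      rcases Nat.eq_zero_or_pos n with h0 | h0
      · have : I ≤ τ := not_lt.1 fun h => hn ⟨h0, h⟩
        simpa [h0] using this
      · have h1 : (1 : ℝ≥0∞) ≤ ENNReal.ofReal s := by
          rw [← ENNReal.ofReal_one]; exact ENNReal.ofReal_le_ofReal hs1
        have h2 : I / τ ≤ ENNReal.ofReal s := by
          rw [← ENNReal.ofReal_toReal (ENNReal.div_ne_top hIt hτ0)]
          exact ENNReal.ofReal_le_ofReal (le_max_right _ _)
        calc I = τ * (I / τ) := (ENNReal.mul_div_cancel hτ0 hτt).symm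
          _ ≤ τ * ENNReal.ofReal s ^ 1 := by rw [pow_one]; gcongr
          _ ≤ τ * ENNReal.ofReal s ^ n := by gcongr; exact h0
    have key := mul_volume_two_mul_lt_le hT hT2 hK₂ hC hs0 hfc hτ0 hτt hsmall
    rw [hτ2] at key
    calc t * volume {x | t < ‖T f x‖ₑ} = 2 * (τ * volume {x | t < ‖T f x‖ₑ}) := by
          rw [← mul_assoc, hτ2]
      _ ≤ 2 * (D * I) := by gcongr
      _ = _ := by ring

theorem BoundedOnL2.exists_weakBound (hT2 : BoundedOnL2 T) :
    ∃ K : ℝ≥0∞, 1 ≤ K ∧ K ≠ ∞ ∧ WeakBound T 2 K := by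
  obtain ⟨K₂, hK1, hKt, hK₂⟩ := hT2.exists_lintegral_le
  exact ⟨K₂, hK1, hKt, fun f _ t =>
    (rpow_mul_volume_lt_le (measurable_enorm_Lp (T f)) two_pos t).trans (hK₂ f)⟩

/-- Every `L²` function is approximated by bounded functions `g k` with bounded support,
dominated by it, along which `‖T f‖ₑ` is lower semicontinuous. -/
theorem exists_approx (hT : IsSublinear T) (hT2 : BoundedOnL2 T)
    (f : Lp 𝕜 2 (volume : Measure (E n))) :
    ∃ g : ℕ → Lp 𝕜 2 (volume : Measure (E n)),
      (∀ k, ∃ R : ℝ, IsBoundedSupportedOn (g k) (ball 0 R)) ∧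
      (∀ k, ∀ᵐ x, ‖g k x‖ₑ ≤ ‖f x‖ₑ) ∧
      ∀ᵐ x, ‖T f x‖ₑ ≤ liminf (fun k => ‖T (g k) x‖ₑ) atTop := by
  have hfm := measurable_enorm_Lp f
  set S : ℕ → Set (E n) := fun k => ball 0 k ∩ {x | ‖f x‖ₑ ≤ k} with hS
  have hSm : ∀ k, MeasurableSet (S k) := fun k =>
    measurableSet_ball.inter (measurableSet_le hfm measurable_const)
  set g : ℕ → Lp 𝕜 2 (volume : Measure (E n)) := fun k => cut (hSm k) f with hg
  have hgb : ∀ k, ∃ R : ℝ, IsBoundedSupportedOn (g k) (ball 0 R) := by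
    refine fun k => ⟨k, ?_, ?_⟩
    · refine memLp_top_of_bound (Lp.aestronglyMeasurable _) k ?_
      filter_upwards [coeFn_cut (hSm k) f] with x hx
      rw [hg, hx]
      by_cases hxS : x ∈ S k
      · rw [indicator_of_mem hxS]
        have := hxS.2
        rw [mem_ofPred_eq, ← ofReal_norm, ← ENNReal.ofReal_natCast] at this
        exact (ENNReal.ofReal_le_ofReal_iff (Nat.cast_nonneg k)).1 this
      · rw [indicator_of_notMem hxS, norm_zero]
        exact Nat.cast_nonneg k
    · filter_upwards [coeFn_cut (hSm k) f] with x hx hxb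
      rw [hg, hx, indicator_of_notMem fun h => hxb h.1]
  have hgf : ∀ k, ∀ᵐ x, ‖g k x‖ₑ ≤ ‖f x‖ₑ := by
    intro k
    filter_upwards [coeFn_cut (hSm k) f] with x hx
    rw [hg, hx]
    by_cases hxS : x ∈ S k <;> simp [hxS]
  have hlim : Tendsto (fun k => f - g k) atTop (𝓝 0) := by
    have hint : Tendsto (fun k => ∫⁻ x, (S k)ᶜ.indicator (fun x => ‖f x‖ₑ ^ (2 : ℝ)) x) atTop
        (𝓝 (∫⁻ _ : E n, 0)) := by
      refine tendsto_lintegral_of_dominated_convergence (fun x => ‖f x‖ₑ ^ (2 : ℝ))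
        (fun k => (hfm.pow_const _).indicator (hSm k).compl)
        (fun k => ae_of_all _ fun x => indicator_le_self _ _ x) ?_ ?_
      · rw [lintegral_enorm_rpow_two]
        finiteness
      · refine ae_of_all _ fun x => tendsto_const_nhds.congr' ?_
        obtain ⟨k₁, hk₁⟩ := exists_nat_gt ‖x‖
        obtain ⟨k₂, hk₂⟩ := exists_nat_gt ‖f x‖
        filter_upwards [eventually_ge_atTop (max k₁ k₂)] with k hk
        rw [indicator_of_notMem]
        rw [notMem_compl_iff]
        refine ⟨?_, ?_⟩
        · rw [mem_ball_zero_iff]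
          exact hk₁.trans_le (by exact_mod_cast (le_max_left _ _).trans hk)
        · rw [mem_ofPred_eq, ← ofReal_norm, ← ENNReal.ofReal_natCast]
          exact ENNReal.ofReal_le_ofReal
            (hk₂.le.trans (by exact_mod_cast (le_max_right _ _).trans hk))
    rw [lintegral_zero] at hint
    have he : ∀ k, ‖f - g k‖ₑ ^ (2 : ℝ) =
        ∫⁻ x, (S k)ᶜ.indicator (fun x => ‖f x‖ₑ ^ (2 : ℝ)) x := by
      intro k
      rw [← lintegral_enorm_rpow_two]
      refine lintegral_congr_ae ?_
      filter_upwards [coeFn_cut (hSm k) f, Lp.coeFn_sub f (g k)] with x h1 h2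
      rw [h2, Pi.sub_apply, hg, h1]
      by_cases hxS : x ∈ S k <;> simp [hxS]
    have hint2 := hint.ennrpow_const ((2 : ℝ)⁻¹)
    rw [ENNReal.zero_rpow_of_pos (by norm_num)] at hint2
    rw [tendsto_zero_iff_norm_tendsto_zero]
    have hint3 := (ENNReal.tendsto_toReal ENNReal.zero_ne_top).comp hint2
    rw [ENNReal.toReal_zero] at hint3
    refine hint3.congr fun k => ?_
    rw [Function.comp_apply, ← he, ← ENNReal.rpow_mul, mul_inv_cancel₀ (by norm_num),
      ENNReal.rpow_one, toReal_enorm]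
  have hTlim : Tendsto (fun k => T (f - g k)) atTop (𝓝 0) := by
    obtain ⟨C, hC⟩ := hT2
    rw [tendsto_zero_iff_norm_tendsto_zero] at hlim ⊢
    refine squeeze_zero (fun _ => norm_nonneg _) (fun k => hC _) ?_
    simpa using hlim.const_mul C
  -- `T (f - g k)` tends to `0` in `L²`, hence almost everywhere along a subsequence; with `|Tf| ≤
  -- |T(g k)| + |T(f - g k)|` this gives the semicontinuity.
  obtain ⟨ns, -, hns⟩ := (tendstoInMeasure_of_tendsto_Lp hTlim).exists_seq_tendsto_ae
  refine ⟨fun k => g (ns k), fun k => hgb _, fun k => hgf _, ?_⟩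
  have hadd : ∀ᵐ x, ∀ k, ‖T f x‖ₑ ≤ ‖T (g (ns k)) x‖ₑ + ‖T (f - g (ns k)) x‖ₑ := by
    refine ae_all_iff.2 fun k => ?_
    have := hT.enorm_add_le (g (ns k)) (f - g (ns k))
    rwa [add_sub_cancel] at this
  filter_upwards [hadd, hns, Lp.coeFn_zero 𝕜 2 (volume : Measure (E n))] with x h1 h2 h3
  rw [h3, Pi.zero_apply] at h2
  have h4 : Tendsto (fun k => ‖T f x‖ₑ - ‖T (f - g (ns k)) x‖ₑ) atTop (𝓝 (‖T f x‖ₑ - 0)) := by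
    refine ENNReal.Tendsto.sub tendsto_const_nhds ?_ (Or.inl enorm_ne_top)
    simpa using h2.enorm
  rw [tsub_zero] at h4
  rw [← h4.liminf_eq]
  exact liminf_le_liminf (Eventually.of_forall fun k => tsub_le_iff_right.2 (h1 k))

/-- Fatou's lemma along the approximations, whose norms are at most that of `f`. -/
theorem lintegral_bound_extend (hT : IsSublinear T) (hT2 : BoundedOnL2 T) {p : ℝ}
    (hp : 0 < p) {W : E n → ℝ≥0∞} (hW : Measurable W)
    (hWt : ∀ x, W x ≠ ∞) {M : ℝ≥0∞}
    (hM : ∀ f : Lp 𝕜 2 (volume : Measure (E n)), (∃ R : ℝ, IsBoundedSupportedOn f (ball 0 R)) →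
      ∫⁻ x, ‖T f x‖ₑ ^ p * W x ≤ M * ∫⁻ x, ‖f x‖ₑ ^ p * W x)
    (f : Lp 𝕜 2 (volume : Measure (E n))) :
    ∫⁻ x, ‖T f x‖ₑ ^ p * W x ≤ M * ∫⁻ x, ‖f x‖ₑ ^ p * W x := by
  obtain ⟨g, hgb, hgf, hlim⟩ := exists_approx hT hT2 f
  calc ∫⁻ x, ‖T f x‖ₑ ^ p * W x
      ≤ ∫⁻ x, liminf (fun k => ‖T (g k) x‖ₑ ^ p * W x) atTop := by
        refine lintegral_mono_ae ?_
        filter_upwards [hlim] with x hx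
        have hmono : Monotone fun a : ℝ≥0∞ => a ^ p * W x := fun a b hab => by
          dsimp only
          gcongr
        have hcont : Continuous fun a : ℝ≥0∞ => a ^ p * W x :=
          (ENNReal.continuous_mul_const (hWt x)).comp ENNReal.continuous_rpow_const
        refine (hmono hx).trans (le_of_eq ?_)
        exact hmono.map_liminf_of_continuousAt _ hcont.continuousAt
    _ ≤ liminf (fun k => ∫⁻ x, ‖T (g k) x‖ₑ ^ p * W x) atTop :=
        lintegral_liminf_le fun k => ((measurable_enorm_Lp (T (g k))).pow_const p).mul hW
    _ ≤ M * ∫⁻ x, ‖f x‖ₑ ^ p * W x := by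
        refine liminf_le_of_le (by isBoundedDefault) fun b hb => ?_
        obtain ⟨k, hk⟩ := hb.exists
        refine hk.trans ((hM (g k) (hgb k)).trans (mul_le_mul_right (lintegral_mono_ae ?_) _))
        filter_upwards [hgf k] with x hx
        gcongr

/-- By semicontinuity, a point where `|Tf| > t` lies in the level sets of all late approximations;
their tail intersections increase. -/
theorem WeakBound.extend {K : ℝ≥0∞} (hK : WeakBound T 1 K) (hT : IsSublinear T)
    (hT2 : BoundedOnL2 T) (f : Lp 𝕜 2 (volume : Measure (E n))) (t : ℝ≥0∞) :
    t * volume {x | t < ‖T f x‖ₑ} ≤ K * ∫⁻ x, ‖f x‖ₑ := by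
  obtain ⟨g, hgb, hgf, hlim⟩ := exists_approx hT hT2 f
  set A : ℕ → Set (E n) := fun N => ⋂ k ∈ Ici N, {x | t < ‖T (g k) x‖ₑ} with hA
  have hmono : Monotone A := fun N N' h => biInter_subset_biInter_left (Ici_subset_Ici.2 h)
  have hsub : volume {x | t < ‖T f x‖ₑ} ≤ volume (⋃ N, A N) := by
    refine measure_mono_ae ?_
    filter_upwards [hlim] with x hx hxt
    have h1 : ∀ᶠ k in atTop, t < ‖T (g k) x‖ₑ :=
      eventually_lt_of_lt_liminf (lt_of_lt_of_le hxt hx)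
    obtain ⟨N, hN⟩ := eventually_atTop.1 h1
    exact mem_iUnion.2 ⟨N, mem_iInter₂.2 fun k hk => hN k hk⟩
  refine (mul_le_mul_right hsub _).trans ?_
  rw [hmono.measure_iUnion, ENNReal.mul_iSup]
  refine iSup_le fun N => ?_
  have h1 := hK (g N) (hgb N) t
  simp only [ENNReal.rpow_one] at h1
  refine (mul_le_mul_right (measure_mono ?_) _).trans
    (h1.trans (mul_le_mul_right (lintegral_mono_ae (hgf N)) _))
  exact biInter_subset_of_mem (mem_Ici.2 le_rfl)

end CZO

/-! ### Interpolation, weights and conclusion -/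

namespace CZO

open Set Filter Topology

variable {n : ℕ} {𝕜 : Type*} [RCLike 𝕜]
  {T : Lp 𝕜 2 (volume : Measure (E n)) → Lp 𝕜 2 (volume : Measure (E n))}

theorem boundedOnLp_of_lintegral_le {p : ℝ} (hp : 0 < p) {μ : Measure (E n)} {M : ℝ≥0∞}
    (hMt : M ≠ ∞) (hM : ∀ f : Lp 𝕜 2 (volume : Measure (E n)),
      ∫⁻ x, ‖T f x‖ₑ ^ p ∂μ ≤ M * ∫⁻ x, ‖f x‖ₑ ^ p ∂μ) : BoundedOnLp T p μ := by
  have hp1 : ENNReal.ofReal p ≠ 0 := (ENNReal.ofReal_pos.2 hp).ne'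
  have hM' : M ^ (1 / p) ≠ ∞ := ENNReal.rpow_ne_top_of_nonneg (by positivity) hMt
  refine ⟨(M ^ (1 / p)).toNNReal, fun f _ => ?_⟩
  rw [ENNReal.coe_toNNReal hM', eLpNorm_eq_lintegral_rpow_enorm_toReal hp1 ENNReal.ofReal_ne_top,
    eLpNorm_eq_lintegral_rpow_enorm_toReal hp1 ENNReal.ofReal_ne_top, ENNReal.toReal_ofReal hp.le,
    ← ENNReal.mul_rpow_of_nonneg _ _ (by positivity)]
  exact ENNReal.rpow_le_rpow (hM f) (by positivity)

theorem weakTypeOneOne_of_mul_volume_le {K : ℝ≥0∞} (hKt : K ≠ ∞)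
    (hK : ∀ (f : Lp 𝕜 2 (volume : Measure (E n))) (t : ℝ≥0∞),
      t * volume {x | t < ‖T f x‖ₑ} ≤ K * ∫⁻ x, ‖f x‖ₑ) : WeakTypeOneOne T := by
  refine ⟨K.toNNReal, fun f _ t ht => ?_⟩
  have ht0 : (t : ℝ≥0∞) ≠ 0 := by exact_mod_cast ht.ne'
  rw [ENNReal.coe_toNNReal hKt, eLpNorm_one_eq_lintegral_enorm, ENNReal.mul_div_right_comm.symm,
    ENNReal.le_div_iff_mul_le (Or.inl ht0) (Or.inl ENNReal.coe_ne_top), mul_comm]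
  exact hK f t

/-- `f` is cut at height `t/2`. One of the two pieces must exceed `t/2` after applying `T`: the
large one is treated by weak type `(1,1)`, the small one by Chebyshev in `L²`. -/
theorem volume_lt_le_of_split (hT : IsSublinear T) {K K₂ : ℝ≥0∞}
    (hK : ∀ (f : Lp 𝕜 2 (volume : Measure (E n))) (t : ℝ≥0∞),
      t * volume {x | t < ‖T f x‖ₑ} ≤ K * ∫⁻ x, ‖f x‖ₑ)
    (hK₂ : ∀ f : Lp 𝕜 2 (volume : Measure (E n)),
      ∫⁻ x, ‖T f x‖ₑ ^ (2 : ℝ) ≤ K₂ * ∫⁻ x, ‖f x‖ₑ ^ (2 : ℝ))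
    (f : Lp 𝕜 2 (volume : Measure (E n))) {t : ℝ≥0∞} (ht0 : t ≠ 0) (ht : t ≠ ∞) :
    volume {x | t < ‖T f x‖ₑ} ≤ 2 * K * (t⁻¹ * ∫⁻ x in {x | t < 2 * ‖f x‖ₑ}, ‖f x‖ₑ) +
      K₂ * (t ^ (-2 : ℝ) * ∫⁻ x in {x | 2 * ‖f x‖ₑ ≤ t}, (2 * ‖f x‖ₑ) ^ (2 : ℝ)) := by
  have hfm := measurable_enorm_Lp f
  set S := {x | t < 2 * ‖f x‖ₑ} with hS
  have hSm : MeasurableSet S := measurableSet_lt measurable_const (hfm.const_mul 2)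
  have hSc : Sᶜ = {x | 2 * ‖f x‖ₑ ≤ t} := by
    ext x
    simp [hS]
  set τ := t / 2 with hτ
  have hτ2 : 2 * τ = t := ENNReal.mul_div_cancel (by norm_num) (by norm_num)
  have hτ0 : τ ≠ 0 := fun h => ht0 (by rw [← hτ2, h, mul_zero])
  have hτt : τ ≠ ∞ := fun h => ht (by rw [← hτ2, h]; simp)
  have hsplit : f = cut hSm f + cut hSm.compl f := by
    refine Lp.ext ?_
    filter_upwards [coeFn_cut hSm f, coeFn_cut hSm.compl f,
      Lp.coeFn_add (cut hSm f) (cut hSm.compl f)] with x h1 h2 h3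
    rw [h3, Pi.add_apply, h1, h2]
    by_cases hx : x ∈ S <;> simp [hx]
  have hcover : ∀ᵐ x, t < ‖T f x‖ₑ →
      x ∈ {x | τ < ‖T (cut hSm f) x‖ₑ} ∪ {x | τ < ‖T (cut hSm.compl f) x‖ₑ} := by
    filter_upwards [hT.enorm_add_le (cut hSm f) (cut hSm.compl f)] with x h1 h2
    rw [← hsplit] at h1
    by_contra h
    rw [mem_union, not_or, mem_ofPred_eq, mem_ofPred_eq, not_lt, not_lt] at h
    have := h1.trans (add_le_add h.1 h.2)
    rw [← two_mul, hτ2] at this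
    exact absurd this (not_le.2 h2)
  refine (measure_mono_ae hcover).trans ((measure_union_le _ _).trans (add_le_add ?_ ?_))
  · have h1 := hK (cut hSm f) τ
    have h2 := lintegral_enorm_cut_rpow hSm f one_pos
    simp only [ENNReal.rpow_one] at h2
    rw [h2] at h1
    refine (ENNReal.mul_le_mul_iff_right hτ0 hτt).1 (h1.trans (le_of_eq ?_))
    calc K * ∫⁻ x in S, ‖f x‖ₑ = t * t⁻¹ * (K * ∫⁻ x in S, ‖f x‖ₑ) := by
          rw [ENNReal.mul_inv_cancel ht0 ht, one_mul]
      _ = (2 * τ) * t⁻¹ * (K * ∫⁻ x in S, ‖f x‖ₑ) := by rw [hτ2]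
      _ = _ := by ring
  · have h1 := (rpow_mul_volume_lt_le (measurable_enorm_Lp (T (cut hSm.compl f))) two_pos τ).trans
      (hK₂ (cut hSm.compl f))
    rw [lintegral_enorm_cut_rpow hSm.compl f two_pos] at h1
    have hτp0 : τ ^ (2 : ℝ) ≠ 0 := by simp [hτ0]
    have hτpt : τ ^ (2 : ℝ) ≠ ∞ := ENNReal.rpow_ne_top_of_nonneg (by norm_num) hτt
    refine (ENNReal.mul_le_mul_iff_right hτp0 hτpt).1 (h1.trans (le_of_eq ?_))
    rw [← hSc]
    set J := Sᶜ
    have e1 : ∫⁻ x in J, (2 * ‖f x‖ₑ) ^ (2 : ℝ) = 2 ^ (2 : ℝ) * ∫⁻ x in J, ‖f x‖ₑ ^ (2 : ℝ) := by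
      rw [← lintegral_const_mul _ (hfm.pow_const _)]
      exact lintegral_congr fun x => ENNReal.mul_rpow_of_nonneg _ _ (by norm_num)
    have e2 : 2 ^ (2 : ℝ) * τ ^ (2 : ℝ) * t ^ (-2 : ℝ) = 1 := by
      rw [← ENNReal.mul_rpow_of_nonneg _ _ (by norm_num), hτ2, ← ENNReal.rpow_add _ _ ht0 ht]
      norm_num
    rw [e1]
    calc K₂ * ∫⁻ x in J, ‖f x‖ₑ ^ (2 : ℝ)
        = 2 ^ (2 : ℝ) * τ ^ (2 : ℝ) * t ^ (-2 : ℝ) * (K₂ * ∫⁻ x in J, ‖f x‖ₑ ^ (2 : ℝ)) := by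
          rw [e2, one_mul]
      _ = _ := by ring

/-- Marcinkiewicz interpolation between weak type `(1,1)` and strong type `(2,2)`. -/
theorem lintegral_rpow_le_of_interpolation (hT : IsSublinear T) {K K₂ : ℝ≥0∞} (hK₂t : K₂ ≠ ∞)
    (hK : ∀ (f : Lp 𝕜 2 (volume : Measure (E n))) (t : ℝ≥0∞),
      t * volume {x | t < ‖T f x‖ₑ} ≤ K * ∫⁻ x, ‖f x‖ₑ)
    (hK₂ : ∀ f : Lp 𝕜 2 (volume : Measure (E n)),
      ∫⁻ x, ‖T f x‖ₑ ^ (2 : ℝ) ≤ K₂ * ∫⁻ x, ‖f x‖ₑ ^ (2 : ℝ)) {p : ℝ} (hp1 : 1 < p) (hp2 : p < 2)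
    (f : Lp 𝕜 2 (volume : Measure (E n))) :
    ∫⁻ x, ‖T f x‖ₑ ^ p ≤ ENNReal.ofReal p * (2 * K * (ENNReal.ofReal (p - 1)⁻¹ * 2 ^ (p - 1)) +
      K₂ * (ENNReal.ofReal (2 - p)⁻¹ * 2 ^ p)) * ∫⁻ x, ‖f x‖ₑ ^ p := by
  have hfm := measurable_enorm_Lp f
  have hp0 : 0 < p := by linarith
  set A : ℝ → ℝ≥0∞ := fun t => ENNReal.ofReal t ^ (p - 2) *
    ∫⁻ x in {x | ENNReal.ofReal t < 2 * ‖f x‖ₑ}, ‖f x‖ₑ with hA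
  set B : ℝ → ℝ≥0∞ := fun t => ENNReal.ofReal t ^ (p - 3) *
    ∫⁻ x in {x | 2 * ‖f x‖ₑ ≤ ENNReal.ofReal t}, (2 * ‖f x‖ₑ) ^ (2 : ℝ) with hB
  have hAm : Measurable A := by
    refine (ENNReal.measurable_ofReal.pow_const _).mul (Antitone.measurable fun a b hab => ?_)
    exact lintegral_mono_set fun x hx => lt_of_le_of_lt (ENNReal.ofReal_le_ofReal hab) hx
  have hAint : ∫⁻ t in Ioi (0 : ℝ), A t =
      ENNReal.ofReal (p - 1)⁻¹ * 2 ^ (p - 1) * ∫⁻ x, ‖f x‖ₑ ^ p := by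
    rw [hA, setLIntegral_rpow_mul_lintegral_lt hfm 2 hp1, mul_assoc,
      ← lintegral_const_mul _ (hfm.pow_const p)]
    congr 1
    refine lintegral_congr fun x => ?_
    rw [ENNReal.mul_rpow_of_nonneg _ _ (by linarith), mul_left_comm]
    congr 1
    nth_rw 1 [← ENNReal.rpow_one ‖f x‖ₑ]
    rw [← ENNReal.rpow_add_of_nonneg _ _ zero_le_one (by linarith), add_sub_cancel]
  have hBint : ∫⁻ t in Ioi (0 : ℝ), B t ≤
      ENNReal.ofReal (2 - p)⁻¹ * 2 ^ p * ∫⁻ x, ‖f x‖ₑ ^ p := by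
    refine (setLIntegral_rpow_mul_lintegral_le (hfm.const_mul 2)
      (fun x => ENNReal.mul_ne_top (by norm_num) enorm_ne_top) hp0 hp2).trans (le_of_eq ?_)
    rw [mul_assoc, ← lintegral_const_mul _ (hfm.pow_const p)]
    congr 1
    exact lintegral_congr fun x => ENNReal.mul_rpow_of_nonneg _ _ hp0.le
  rw [lintegral_rpow_eq_layercake (measurable_enorm_Lp (T f)) hp0, mul_assoc]
  refine mul_le_mul_right ?_ _
  calc ∫⁻ t in Ioi (0 : ℝ), ENNReal.ofReal t ^ (p - 1) *
        volume {x | ENNReal.ofReal t < ‖T f x‖ₑ}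
      ≤ ∫⁻ t in Ioi (0 : ℝ), (2 * K * A t + K₂ * B t) := by
        refine setLIntegral_mono' measurableSet_Ioi fun t ht => ?_
        have ht0 : ENNReal.ofReal t ≠ 0 := (ENNReal.ofReal_pos.2 ht).ne'
        have htt : ENNReal.ofReal t ≠ ∞ := ENNReal.ofReal_ne_top
        refine (mul_le_mul_right (volume_lt_le_of_split hT hK hK₂ f ht0 htt) _).trans
          (le_of_eq ?_)
        have e1 : ENNReal.ofReal t ^ (p - 2) =
            ENNReal.ofReal t ^ (p - 1) * (ENNReal.ofReal t)⁻¹ := by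
          rw [← ENNReal.rpow_neg_one, ← ENNReal.rpow_add _ _ ht0 htt]
          ring_nf
        have e2 : ENNReal.ofReal t ^ (p - 3) =
            ENNReal.ofReal t ^ (p - 1) * ENNReal.ofReal t ^ (-2 : ℝ) := by
          rw [← ENNReal.rpow_add _ _ ht0 htt]
          ring_nf
        simp only [hA, hB, e1, e2]
        ring
    _ = 2 * K * (∫⁻ t in Ioi (0 : ℝ), A t) + K₂ * ∫⁻ t in Ioi (0 : ℝ), B t := by
        rw [lintegral_add_left (hAm.const_mul _), lintegral_const_mul _ hAm,
          lintegral_const_mul' _ _ hK₂t]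
    _ ≤ 2 * K * (ENNReal.ofReal (p - 1)⁻¹ * 2 ^ (p - 1) * ∫⁻ x, ‖f x‖ₑ ^ p) +
          K₂ * (ENNReal.ofReal (2 - p)⁻¹ * 2 ^ p * ∫⁻ x, ‖f x‖ₑ ^ p) := by
        rw [hAint]
        gcongr
    _ = _ := by ring

/-! ### Muckenhoupt weights and the conclusion -/

theorem isApWeight_one {q : ℝ} (hq : 1 < q) : IsApWeight (n := n) q (fun _ => 1) 1 := by
  refine ⟨measurable_const, fun _ => one_ne_zero, fun _ => ENNReal.one_ne_top, fun c r => ?_,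
    fun c r => ?_, ENNReal.one_ne_top, fun c r hr => ?_⟩
  · rw [setLIntegral_one]
    exact measure_ball_lt_top.ne
  · simp only [ENNReal.one_rpow]
    rw [setLIntegral_one]
    exact measure_ball_lt_top.ne
  · simp only [ENNReal.one_rpow]
    rw [setLIntegral_one, one_mul]
    nth_rw 1 [← ENNReal.rpow_one (volume (ball c r))]
    rw [← ENNReal.rpow_add_of_nonneg _ _ zero_le_one (by linarith), add_sub_cancel]

/-- If `w` has mass on some ball, the `A_q` bound on larger balls forces the dual integral to be
finite, because a positive number times `∞` is `∞`. As negative powers of `0` are `∞`, the weight is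
then positive almost everywhere. -/
theorem MuckenhouptA.eq_zero_or_exists_isApWeight {q : ℝ} (hq : 1 < q) {w : E n → ℝ}
    (hw : MuckenhouptA q w) :
    weightMeasure w = 0 ∨ ∃ W C, IsApWeight q W C ∧ weightMeasure w = volume.withDensity W := by
  obtain ⟨-, hloc, C, hC⟩ := hw
  set u : E n → ℝ≥0∞ := fun x => ENNReal.ofReal (w x) with hu
  have hum : AEMeasurable u volume := hloc.aestronglyMeasurable.aemeasurable.ennreal_ofReal
  have hut : ∀ x, u x ≠ ∞ := fun x => ENNReal.ofReal_ne_top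
  have hq1 : 0 < q - 1 := by linarith
  have he : 1 - q.conjExponent = -(q - 1)⁻¹ := by
    rw [Real.conjExponent]
    field_simp
    ring
  rw [he] at hC
  have hneg : -(q - 1)⁻¹ < 0 := neg_neg_of_pos (inv_pos.2 hq1)
  by_cases hzero : ∀ k : ℕ, ∫⁻ x in ball (0 : E n) k, u x = 0
  · refine Or.inl ?_
    have h0 : u =ᵐ[volume] 0 := by
      have h1 : ∀ k : ℕ, ∀ᵐ x, x ∈ ball (0 : E n) k → u x = 0 := fun k =>
        (ae_restrict_iff' measurableSet_ball).1
          ((lintegral_eq_zero_iff' hum.restrict).1 (hzero k))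
      filter_upwards [ae_all_iff.2 h1] with x hx
      obtain ⟨k, hk⟩ := exists_nat_gt ‖x‖
      exact hx k (mem_ball_zero_iff.2 hk)
    rw [weightMeasure, withDensity_congr_ae h0, withDensity_zero]
  refine Or.inr ?_
  push Not at hzero
  obtain ⟨k₀, hk₀⟩ := hzero
  have hdual : ∀ c r, ∫⁻ x in ball (c : E n) r, u x ^ (-(q - 1)⁻¹) ≠ ∞ := by
    intro c r
    set N : ℝ := max (k₀ + 1) (r + dist c 0) with hN
    have hNpos : 0 < N := lt_of_lt_of_le (by positivity) (le_max_left _ _)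
    have hsub : ball c r ⊆ ball 0 N := ball_subset_ball' (le_max_right _ _)
    have hsub₀ : ball (0 : E n) k₀ ⊆ ball 0 N :=
      ball_subset_ball ((lt_add_one _).le.trans (le_max_left _ _))
    refine ne_top_of_le_ne_top ?_ (lintegral_mono_set hsub)
    intro htop
    have hb := hC 0 N hNpos
    have hvt : volume (ball (0 : E n) N) ≠ ∞ := measure_ball_lt_top.ne
    have h1 : (volume (ball (0 : E n) N))⁻¹ * ∫⁻ x in ball 0 N, u x ≠ 0 := by
      refine mul_ne_zero (ENNReal.inv_ne_zero.2 hvt) fun h => hk₀ ?_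
      exact le_antisymm ((lintegral_mono_set hsub₀).trans h.le) zero_le
    rw [avg, avg, htop, ENNReal.mul_top (ENNReal.inv_ne_zero.2 hvt),
      ENNReal.top_rpow_of_pos hq1, ENNReal.mul_top h1] at hb
    exact ENNReal.coe_ne_top (top_le_iff.1 hb)
  have hne : ∀ᵐ x, u x ≠ 0 := by
    have h1 : ∀ k : ℕ, ∀ᵐ x, x ∈ ball (0 : E n) k → u x ^ (-(q - 1)⁻¹) < ∞ := fun k =>
      (ae_restrict_iff' measurableSet_ball).1
        (ae_lt_top' (hum.restrict.pow_const _) (hdual 0 k))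
    filter_upwards [ae_all_iff.2 h1] with x hx h0
    obtain ⟨k, hk⟩ := exists_nat_gt ‖x‖
    have := hx k (mem_ball_zero_iff.2 hk)
    rw [h0, ENNReal.zero_rpow_of_neg hneg] at this
    exact lt_irrefl _ this
  classical
  -- A measurable version of the weight is changed to 1 on this null set, so that it is positive and
  -- finite everywhere.
  set Z : Set (E n) := {x | hum.mk u x = 0 ∨ hum.mk u x = ∞} with hZ
  have hZm : MeasurableSet Z :=
    (hum.measurable_mk (measurableSet_singleton 0)).union
      (hum.measurable_mk (measurableSet_singleton ∞))
  set W : E n → ℝ≥0∞ := Z.piecewise (fun _ => 1) (hum.mk u) with hW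
  have hWu : W =ᵐ[volume] u := by
    filter_upwards [hum.ae_eq_mk, hne] with x h1 h2
    have : x ∉ Z := by
      rw [hZ, mem_ofPred_eq, ← h1, not_or]
      exact ⟨h2, hut x⟩
    rw [hW, piecewise_eq_of_notMem _ _ _ this, h1]
  have hWe : (fun x => W x ^ (-(q - 1)⁻¹)) =ᵐ[volume] fun x => u x ^ (-(q - 1)⁻¹) := by
    filter_upwards [hWu] with x hx
    rw [hx]
  have hint : ∀ s, ∫⁻ x in s, W x = ∫⁻ x in s, u x := fun s =>
    lintegral_congr_ae (ae_restrict_of_ae hWu)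
  have hinte : ∀ s, ∫⁻ x in s, W x ^ (-(q - 1)⁻¹) = ∫⁻ x in s, u x ^ (-(q - 1)⁻¹) := fun s =>
    lintegral_congr_ae (ae_restrict_of_ae hWe)
  have hWne : ∀ x, W x ≠ 0 ∧ W x ≠ ∞ := by
    intro x
    by_cases hx : x ∈ Z
    · rw [hW, piecewise_eq_of_mem _ _ _ hx]
      exact ⟨one_ne_zero, ENNReal.one_ne_top⟩
    · rw [hW, piecewise_eq_of_notMem _ _ _ hx]
      exact not_or.1 hx
  refine ⟨W, C, ⟨Measurable.piecewise hZm measurable_const hum.measurable_mk, fun x => (hWne x).1,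
    fun x => (hWne x).2, fun c r => ?_, fun c r => ?_, ENNReal.coe_ne_top, fun c r hr => ?_⟩,
    withDensity_congr_ae hWu.symm⟩
  · rw [hint]
    have h1 : IntegrableOn w (ball c r) volume :=
      (hloc.integrableOn_isCompact (isCompact_closedBall c r)).mono_set ball_subset_closedBall
    exact h1.lintegral_lt_top.ne
  · rw [hinte]
    exact hdual c r
  · rw [hint, hinte]
    have hv0 := volume_ball_ne_zero c hr
    have hvt : volume (ball c r) ≠ ∞ := measure_ball_lt_top.ne
    set v := volume (ball c r) with hv
    have hb := hC c r hr
    rw [avg, avg, ← hv, ENNReal.mul_rpow_of_nonneg _ _ hq1.le] at hb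
    set I := ∫⁻ x in ball c r, u x
    set J := ∫⁻ x in ball c r, u x ^ (-(q - 1)⁻¹)
    have e1 : v * v⁻¹ = 1 := ENNReal.mul_inv_cancel hv0 hvt
    have e2 : v ^ (q - 1) * v⁻¹ ^ (q - 1) = 1 := by
      rw [← ENNReal.mul_rpow_of_nonneg _ _ hq1.le, e1, ENNReal.one_rpow]
    have e3 : v ^ q = v * v ^ (q - 1) := by
      nth_rw 2 [← ENNReal.rpow_one v]
      rw [← ENNReal.rpow_add_of_nonneg _ _ zero_le_one hq1.le, add_sub_cancel]
    calc I * J ^ (q - 1) = (v * v⁻¹) * (v ^ (q - 1) * v⁻¹ ^ (q - 1)) * (I * J ^ (q - 1)) := by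
          rw [e1, e2, one_mul, one_mul]
      _ = v * v ^ (q - 1) * (v⁻¹ * I * (v⁻¹ ^ (q - 1) * J ^ (q - 1))) := by ring
      _ ≤ v * v ^ (q - 1) * C := by gcongr
      _ = C * v ^ q := by rw [e3, mul_comm]

theorem boundedOnLp_withDensity (hT : IsSublinear T) (hT2 : BoundedOnL2 T) (hsup : SupCondition T)
    {r : ℝ} (hr : 1 ≤ r) {K : ℝ≥0∞} (hK1 : 1 ≤ K) (hKt : K ≠ ∞) (hWB : WeakBound T r K)
    {q p : ℝ} (hq : 1 < q) (hp : p = q * r) {W : E n → ℝ≥0∞} {C : ℝ≥0∞} (hW : IsApWeight q W C) :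
    BoundedOnLp T p (volume.withDensity W) := by
  have hp0 : 0 < p := by rw [hp]; positivity
  obtain ⟨M, hMt, hM⟩ := exists_weighted_bound hT hT2 hsup hr hK1 hKt hWB hq hp hW
  refine boundedOnLp_of_lintegral_le hp0 hMt fun f => ?_
  have e : ∀ g : Lp 𝕜 2 (volume : Measure (E n)),
      ∫⁻ x, ‖g x‖ₑ ^ p ∂(volume.withDensity W) = ∫⁻ x, ‖g x‖ₑ ^ p * W x := by
    intro g
    rw [lintegral_withDensity_eq_lintegral_mul _ hW.measurable
      ((measurable_enorm_Lp g).pow_const p)]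
    exact lintegral_congr fun x => mul_comm _ _
  rw [e, e]
  exact lintegral_bound_extend hT hT2 hp0 hW.measurable hW.ne_top hM f

theorem boundedOnLp_weightMeasure (hT : IsSublinear T) (hT2 : BoundedOnL2 T)
    (hsup : SupCondition T) {r : ℝ} (hr : 1 ≤ r) {K : ℝ≥0∞} (hK1 : 1 ≤ K) (hKt : K ≠ ∞)
    (hWB : WeakBound T r K) {q p : ℝ} (hq : 1 < q) (hp : p = q * r) {w : E n → ℝ}
    (hw : MuckenhouptA q w) : BoundedOnLp T p (weightMeasure w) := by
  rcases hw.eq_zero_or_exists_isApWeight hq with h0 | ⟨W, C, hW, h⟩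
  · rw [h0]
    exact ⟨0, fun f _ => by simp⟩
  · rw [h]
    exact boundedOnLp_withDensity hT hT2 hsup hr hK1 hKt hWB hq hp hW

end CZO

end

theorem corollary3p3 {n : ℕ} {𝕜 : Type*} [RCLike 𝕜]
    (T : Lp 𝕜 2 (volume : Measure (CZO.E n)) → Lp 𝕜 2 (volume : Measure (CZO.E n)))
    (hT : CZO.IsSublinear T) (hT2 : CZO.BoundedOnL2 T) :
    (CZO.CancellationCondition T →
      CZO.WeakTypeOneOne T ∧ ∀ p : ℝ, 1 < p → p < 2 → CZO.BoundedOnLp T p volume) ∧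
    (CZO.SupCondition T →
      (∀ p : ℝ, 2 < p → CZO.BoundedOnLp T p volume) ∧
      ∀ p : ℝ, 2 < p → ∀ w : CZO.E n → ℝ, CZO.MuckenhouptA (p / 2) w →
        CZO.BoundedOnLp T p (CZO.weightMeasure w)) ∧
    (CZO.CancellationCondition T → CZO.SupCondition T →
      ∀ p : ℝ, 1 < p → ∀ w : CZO.E n → ℝ, CZO.MuckenhouptA p w →
        CZO.BoundedOnLp T p (CZO.weightMeasure w)) := by
  refine ⟨fun hcanc => ?_, fun hsup => ?_, fun hcanc hsup p hp w hw => ?_⟩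
  · obtain ⟨K, -, hKt, hWB⟩ := hcanc.exists_weakBound hT hT2
    obtain ⟨K₂, -, hK₂t, hK₂⟩ := hT2.exists_lintegral_le
    have hK := hWB.extend hT hT2
    refine ⟨CZO.weakTypeOneOne_of_mul_volume_le hKt hK, fun p hp1 hp2 => ?_⟩
    refine CZO.boundedOnLp_of_lintegral_le (by linarith) ?_
      (CZO.lintegral_rpow_le_of_interpolation hT hK₂t hK hK₂ hp1 hp2)
    have h1 : (2 : ℝ≥0∞) ^ (p - 1) ≠ ∞ := ENNReal.rpow_ne_top_of_nonneg (by linarith) (by norm_num)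
    have h2 : (2 : ℝ≥0∞) ^ p ≠ ∞ := ENNReal.rpow_ne_top_of_nonneg (by linarith) (by norm_num)
    finiteness
  -- Without cancellation only weak type `(2,2)` is available: `r = 2`, so `q = p / 2`.
  · obtain ⟨K, hK1, hKt, hWB⟩ := hT2.exists_weakBound
    refine ⟨fun p hp => ?_, fun p hp w hw => ?_⟩
    · have hq : 1 < p / 2 := by linarith
      have := CZO.boundedOnLp_withDensity hT hT2 hsup one_le_two hK1 hKt hWB hq
        (p := p) (by ring) (CZO.isApWeight_one hq)
      simpa only [withDensity_const, one_smul] using this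
    · exact CZO.boundedOnLp_weightMeasure hT hT2 hsup one_le_two hK1 hKt hWB (by linarith)
        (by ring) hw
  -- Cancellation supplies weak type `(1,1)`: `r = 1`, so `q = p`.
  · obtain ⟨K, hK1, hKt, hWB⟩ := hcanc.exists_weakBound hT hT2
    exact CZO.boundedOnLp_weightMeasure hT hT2 hsup le_rfl hK1 hKt hWB hp (mul_one p).symm hw
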